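/- **Setting.** Let $\Theta\subset\mathbb{R}^p$ be compact and $\phi:\mathcal X\times\Theta\to\mathbb{R}^k$ a measurable moment function. For data $X_1,\dots,X_n$ put $g_n(\theta)=n^{-1/2}\sum_{i=1}^n\phi(X_i,\theta)$ and $Q_n(\theta)=g_n(\theta)'\widehat\Sigma_n(\theta)^{-1}g_n(\theta)$, with $\widehat\Sigma_n(\theta)$ a $k\times k$ matrix-valued statistic. For a prior $\pi$ on $\Theta$, the quasi-posterior is $\pi(A\mid g_n)=\int_A e^{-Q_n/2}d\pi\big/\int_\Theta e^{-Q_n/2}d\pi$. Let $P_0$ be a probability measure on $\mathcal X$ with $\phi(\cdot,\theta)\in L_2(P_0)$ for all $\theta\in\Theta$, and put $\Phi(\theta)=\mathbb{E}_{P_0}[\phi(X,\theta)]$, $\Sigma(\theta_1,\theta_2)=\mathrm{Cov}_{P_0}(\phi(X,\theta_1),\phi(X,\theta_2))$, $\Sigma(\theta)=\Sigma(\theta,\theta)$, $\Theta_0=\{\theta\in\Theta:\Phi(\theta)=0\}$. **Assumption 1.** $\Phi$ on $\Theta$ and $\Sigma$ on $\Theta\times\Theta$ are continuous, and $\det\Sigma(\theta)\neq0$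 for all $\theta\in\Theta$. For i.i.d. data from $P_0$, $G_n=g_n-\sqrt n\,\Phi$ converges weakly as a process on $\Theta$ (with respect to uniform convergence, through outer expectations) to a mean-zero Gaussian process with covariance function $\Sigma$ and continuous paths, and $\sup_{\theta\in\Theta}\|\widehat\Sigma_n(\theta)-\Sigma(\theta)\|\to_p0$. **Assumption 2.** There are sets $B\subset\mathbb{R}^q$ and $\Gamma(\beta)\subseteq\mathbb{R}^{p_\gamma}$ $(\beta\in B)$ with $\Xi=\{(\beta,\gamma):\beta\in B,\gamma\in\Gamma(\beta)\}$ compact, and a continuously differentiable $\vartheta:\Xi\to\Theta^*$, where the measurable set $\Theta^*\subseteq\Theta$ contains a neighbourhood of $\Theta_0$ in $\Theta$, such that $\vartheta(\beta,\gamma)\in\Theta_0$ if and only if $\gamma=0$, and $\Gamma(\beta)$ contains a ball around $0$ whose radius does not depend on $\beta\in B$. There is a positive measure $\pi(\beta,\gamma)$ on $\Xi$ whose pushforward under $\vartheta$ is the restriction of $\pi$ to $\Theta^*$. Its marginal $\pi(\beta)$ satisfies $\int_Bd\pi(\beta)>0$, and its conditional distribution of $\gamma$ given $\beta$ has a measurable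 density $\pi_\gamma(\gamma\mid\beta)$ that is uniformly bounded, continuous at $\gamma=0$ uniformly in $\beta\in B$, and positive at $\gamma=0$ for each $\beta\in B$. **Assumption 3.** $\Phi(\vartheta(\beta,\gamma))$ is differentiable in $\gamma$ at $\gamma=0$, uniformly over $\beta\in B$, with derivative $\nabla(\beta)\in\mathbb{R}^{k\times p_\gamma}$, and $J(\beta)=\nabla(\beta)'\Sigma(\beta)^{-1}\nabla(\beta)$ is positive definite for every $\beta\in B$. Here and below $\Sigma(\beta)=\Sigma(\vartheta(\beta,0))$, $g_n(\beta)=g_n(\vartheta(\beta,0))$ and $\vartheta(\beta)=\vartheta(\beta,0)$. **Theorem.** Suppose Assumptions 1, 2 and 3 hold and $\pi$ has a bounded Lebesgue density on $\Theta$. Let $f$ be measurable and $P_{n,f}$ probability measures with $$\int\Big[\sqrt n\,(dP_{n,f}^{1/2}-dP_0^{1/2})-\tfrac12 f\,dP_0^{1/2}\Big]^2\to0,$$ and let $X_1,\dots,X_n$ be i.i.d. from $P_{n,f}$. Put $$M(\beta)=\Sigma(\beta)^{-1}-\Sigma(\beta)^{-1}\nabla(\beta)J(\beta)^{-1}\nabla(\beta)'\Sigma(\beta)^{-1},\quad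 Q_n^\beta(\beta)=g_n(\beta)'M(\beta)g_n(\beta),\quad d\pi^0(\beta)=\pi_\gamma(0\mid\beta)|J(\beta)|^{-1/2}d\pi(\beta)\text{ on }B.$$ With probability tending to one the quasi-posterior is a well-defined probability measure and $0<\int_Be^{-Q_n^\beta/2}d\pi^0<\infty$. For every real sequence $c_n\to\infty$, $$\pi\Big(\big\{\theta\in\Theta:\Phi(\theta)'\Sigma(\theta)^{-1}\Phi(\theta)\ge c_n/n\big\}\,\Big|\,g_n\Big)=o_p(1).$$ For every bounded measurable function $c$ on $\Theta$ that is uniformly continuous at $\Theta_0$ (for every $\varepsilon>0$ there is $\delta>0$ such that $|c(\theta)-c(\theta_0)|<\varepsilon$ whenever $\theta_0\in\Theta_0$, $\theta\in\Theta$, $\|\theta-\theta_0\|<\delta$), $$\int_\Theta c(\theta)\,d\pi(\theta\mid g_n)-\frac{\int_Bc(\vartheta(\beta))\exp\{-\frac12Q_n^\beta(\beta)\}\,d\pi^0(\beta)}{\int_B\exp\{-\frac12Q_n^\beta(\beta)\}\,d\pi^0(\beta)}=o_p(1).$$ -/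

import Mathlib

open MeasureTheory ProbabilityTheory Filter Topology Set Matrix
open scoped BoundedContinuousFunction UniformConvergence

noncomputable section

/-! Vectors in `ℝᵈ` are functions `Fin d → ℝ` with Lebesgue measure `volume`.  Norms occur below only
in topological conditions (uniform continuity, little-o, balls around `0`), which do not depend on
the choice of the norm of a finite-dimensional space. -/

namespace WeakGMM

variable {X : Type*} {p k q r : ℕ}

/-! ### Probability on the sample spaces -/

/-- The law of an i.i.d. sample of size `n` from `P`. -/
def sampleLaw [MeasurableSpace X] (P : Measure X) (n : ℕ) : Measure (Fin n → X) :=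
  Measure.pi fun _ : Fin n => P

/-- Statistics `Z n` of samples of size `n` that are `o_p(1)` when the data are i.i.d. from `P n`.
On a set that is not measurable a measure is the outer measure, so this is convergence to `0` in
outer probability, which for measurable `Z n` is convergence in probability. -/
def IsLittleOp [MeasurableSpace X] (P : ℕ → Measure X) (Z : (n : ℕ) → (Fin n → X) → ℝ) : Prop :=
  ∀ ε : ℝ, 0 < ε → Tendsto (fun n => sampleLaw (P n) n {x | ε ≤ |Z n x|}) atTop (𝓝 0)

/-- Outer expectation: infimum of the expectations of the integrable measurable majorants. -/
def outerExpectation {Ω : Type*} [MeasurableSpace Ω] (μ : Measure Ω) (T : Ω → ℝ) : ℝ :=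
  sInf {a | ∃ U : Ω → ℝ, Measurable U ∧ Integrable U μ ∧ (∀ ω, T ω ≤ U ω) ∧ a = ∫ ω, U ω ∂μ}

/-- Weak convergence, as a process indexed by `S`, of the (possibly not Borel measurable) random
functions `Y n` of the sample to the process `G` with continuous paths: outer expectations converge
for all real functions that are bounded and continuous for uniform convergence on `S`.
(The bounded functions are open and closed in the space `S →ᵤ (Fin k → ℝ)` of all functions with
the topology of uniform convergence, so for bounded paths this is weak convergence in `ℓ^∞(S)`.) -/
def WeakConvergesToProcess [MeasurableSpace X] {S : Type*} [TopologicalSpace S]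
    (P : Measure X) (Y : (n : ℕ) → (Fin n → X) → S → Fin k → ℝ)
    {Ω : Type*} [MeasurableSpace Ω] (ν : Measure Ω) (G : Ω → C(S, Fin k → ℝ)) : Prop :=
  ∀ h : (S →ᵤ (Fin k → ℝ)) →ᵇ ℝ,
    Tendsto (fun n => outerExpectation (sampleLaw P n) fun x => h (UniformFun.ofFun (Y n x)))
      atTop (𝓝 (∫ ω, h (UniformFun.ofFun (G ω)) ∂ν))

/-- `P n` is local to `P₀` with score `f`:
`∫ [√n (dP_n^{1/2} - dP₀^{1/2}) - ½ f dP₀^{1/2}]² → 0`, the square roots of densities being taken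
with respect to the dominating measure `P n + P₀`. -/
def IsLocalSequence [MeasurableSpace X] (P₀ : Measure X) (P : ℕ → Measure X) (f : X → ℝ) : Prop :=
  Measurable f ∧
  Tendsto (fun n : ℕ => ∫⁻ x, ENNReal.ofReal
      ((√(n : ℝ) * (√((P n).rnDeriv (P n + P₀) x).toReal - √(P₀.rnDeriv (P n + P₀) x).toReal)
        - 1 / 2 * f x * √(P₀.rnDeriv (P n + P₀) x).toReal) ^ 2) ∂(P n + P₀))
    atTop (𝓝 0)

/-! ### Moments -/

/-- The quadratic form `v' A v`. -/
def quadForm {m : ℕ} (A : Matrix (Fin m) (Fin m) ℝ) (v : Fin m → ℝ) : ℝ := v ⬝ᵥ (A *ᵥ v)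

/-- Normalized sample moments `g_n(θ) = n^{-1/2} ∑ φ(X_i, θ)`. -/
def sampleMoment (φ : X → (Fin p → ℝ) → Fin k → ℝ) (n : ℕ) (x : Fin n → X) (θ : Fin p → ℝ) :
    Fin k → ℝ :=
  (√(n : ℝ))⁻¹ • ∑ i, φ (x i) θ

/-- Population moments `Φ(θ) = E_P[φ(X, θ)]`. -/
def popMoment [MeasurableSpace X] (φ : X → (Fin p → ℝ) → Fin k → ℝ) (P : Measure X)
    (θ : Fin p → ℝ) : Fin k → ℝ :=
  fun i => ∫ x, φ x θ i ∂P

/-- Covariance function `Σ(θ₁, θ₂) = Cov_P(φ(X, θ₁), φ(X, θ₂))` of the moments. -/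
def momentCov [MeasurableSpace X] (φ : X → (Fin p → ℝ) → Fin k → ℝ) (P : Measure X)
    (θ₁ θ₂ : Fin p → ℝ) : Matrix (Fin k) (Fin k) ℝ :=
  Matrix.of fun i j => cov[fun x => φ x θ₁ i, fun x => φ x θ₂ j; P]

/-- The identified set `Θ₀ = {θ ∈ Θ : E_P[φ(X, θ)] = 0}`. -/
def identifiedSet [MeasurableSpace X] (Θ : Set (Fin p → ℝ)) (φ : X → (Fin p → ℝ) → Fin k → ℝ)
    (P : Measure X) : Set (Fin p → ℝ) :=
  {θ | θ ∈ Θ ∧ popMoment φ P θ = 0}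

/-- The GMM objective `Q_n(θ) = g_n(θ)' Σ̂_n(θ)⁻¹ g_n(θ)`. -/
def gmmObjective (φ : X → (Fin p → ℝ) → Fin k → ℝ)
    (Shat : (n : ℕ) → (Fin n → X) → (Fin p → ℝ) → Matrix (Fin k) (Fin k) ℝ)
    (n : ℕ) (x : Fin n → X) (θ : Fin p → ℝ) : ℝ :=
  quadForm (Shat n x θ)⁻¹ (sampleMoment φ n x θ)

/-- `π` is a measure on `Θ` with a bounded density with respect to Lebesgue measure. -/
def HasBoundedDensityOn (π : Measure (Fin p → ℝ)) (Θ : Set (Fin p → ℝ)) : Prop :=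
  ∃ ρ : (Fin p → ℝ) → ℝ, Measurable ρ ∧ (∃ C : ℝ, ∀ θ ∈ Θ, ρ θ ≤ C) ∧
    π = (volume.restrict Θ).withDensity fun θ => ENNReal.ofReal (ρ θ)

/-- The quasi-posterior `π(A | g_n) = ∫_A exp(-Q_n/2) dπ / ∫_Θ exp(-Q_n/2) dπ`
(the prior `π` is carried by `Θ`). -/
def quasiPosterior (π : Measure (Fin p → ℝ)) (φ : X → (Fin p → ℝ) → Fin k → ℝ)
    (Shat : (n : ℕ) → (Fin n → X) → (Fin p → ℝ) → Matrix (Fin k) (Fin k) ℝ)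
    (n : ℕ) (x : Fin n → X) : Measure (Fin p → ℝ) :=
  π.tilted fun θ => -(1 / 2) * gmmObjective φ Shat n x θ

/-! ### Assumptions -/

/-- The moment process is asymptotically Gaussian, with uniformly consistent variance estimator. -/
structure MomentAsymptotics [MeasurableSpace X] (Θ : Set (Fin p → ℝ))
    (φ : X → (Fin p → ℝ) → Fin k → ℝ)
    (Shat : (n : ℕ) → (Fin n → X) → (Fin p → ℝ) → Matrix (Fin k) (Fin k) ℝ)
    (P₀ : Measure X) {Ω : Type*} [MeasurableSpace Ω] (ν : Measure Ω)
    (G : Ω → C(Θ, Fin k → ℝ)) : Prop where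
  square_integrable : ∀ θ ∈ Θ, ∀ i, MemLp (fun x => φ x θ i) 2 P₀
  continuous_mean : ContinuousOn (popMoment φ P₀) Θ
  continuous_cov : ContinuousOn (fun z : (Fin p → ℝ) × (Fin p → ℝ) => momentCov φ P₀ z.1 z.2)
    (Θ ×ˢ Θ)
  det_ne_zero : ∀ θ ∈ Θ, (momentCov φ P₀ θ θ).det ≠ 0
  gaussian : IsGaussianProcess (fun (θ : Θ) ω => G ω θ) ν
  gaussian_mean : ∀ (θ : Θ) (i : Fin k), ∫ ω, G ω θ i ∂ν = 0
  gaussian_cov : ∀ (θ₁ θ₂ : Θ) (i j : Fin k),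
    cov[fun ω => G ω θ₁ i, fun ω => G ω θ₂ j; ν] = momentCov φ P₀ θ₁ θ₂ i j
  weak_convergence : WeakConvergesToProcess P₀
    (fun n x (θ : Θ) => sampleMoment φ n x θ - √(n : ℝ) • popMoment φ P₀ θ) ν G
  consistent_variance : ∀ ε : ℝ, 0 < ε → Tendsto (fun n => sampleLaw P₀ n
    {x | ∃ θ ∈ Θ, ∃ i j, ε ≤ |Shat n x θ i j - momentCov φ P₀ θ θ i j|}) atTop (𝓝 0)

/-- The set `Ξ = {(β, γ) : β ∈ B, γ ∈ Γ(β)}`. -/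
def graphSet (B : Set (Fin q → ℝ)) (Γ : (Fin q → ℝ) → Set (Fin r → ℝ)) :
    Set ((Fin q → ℝ) × (Fin r → ℝ)) :=
  {z | z.1 ∈ B ∧ z.2 ∈ Γ z.1}

/-- Reparameterization `θ = ϑ(β, γ)` on a neighbourhood `Θs` of `Θ₀` in `Θ`.  The measure `joint` is
the prior `π(β, γ)`, its first marginal `joint.fst` is `π(β)`, and `dens β γ` is the conditional
density `π_γ(γ | β)` (it integrates to one for `π(β)`-almost all `β` by the field `joint_eq`). -/
structure Reparameterization (Θ Θ₀ Θs : Set (Fin p → ℝ)) (π : Measure (Fin p → ℝ))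
    (B : Set (Fin q → ℝ)) (Γ : (Fin q → ℝ) → Set (Fin r → ℝ))
    (ϑ : (Fin q → ℝ) × (Fin r → ℝ) → Fin p → ℝ)
    (joint : Measure ((Fin q → ℝ) × (Fin r → ℝ)))
    (dens : (Fin q → ℝ) → (Fin r → ℝ) → ℝ) : Prop where
  subset : Θs ⊆ Θ
  measurable_set : MeasurableSet Θs
  neighborhood : ∀ θ ∈ Θ₀, Θs ∈ 𝓝[Θ] θ
  compact : IsCompact (graphSet B Γ)
  zero_interior : ∃ δ : ℝ, 0 < δ ∧ ∀ β ∈ B, Metric.ball 0 δ ⊆ Γ β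
  maps_to : MapsTo ϑ (graphSet B Γ) Θs
  cont_diff : ContDiffOn ℝ 1 ϑ (graphSet B Γ)
  mem_iff : ∀ z ∈ graphSet B Γ, ϑ z ∈ Θ₀ ↔ z.2 = 0
  pushforward : joint.map ϑ = π.restrict Θs
  measurable_dens : Measurable fun z : (Fin q → ℝ) × (Fin r → ℝ) => dens z.1 z.2
  joint_eq : joint = ((joint.fst.prod volume).restrict (graphSet B Γ)).withDensity
    fun z => ENNReal.ofReal (dens z.1 z.2)
  dens_bounded : ∃ C : ℝ, ∀ z ∈ graphSet B Γ, 0 ≤ dens z.1 z.2 ∧ dens z.1 z.2 ≤ C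
  dens_unif_cont : ∀ ε : ℝ, 0 < ε → ∃ δ : ℝ, 0 < δ ∧ ∀ z ∈ graphSet B Γ, ‖z.2‖ < δ →
    |dens z.1 z.2 - dens z.1 0| < ε
  dens_pos : ∀ β ∈ B, 0 < dens β 0
  marginal_pos : 0 < joint.fst B

/-- `J = ∇' Σ⁻¹ ∇`. -/
def infoMatrix (S : Matrix (Fin k) (Fin k) ℝ) (D : Matrix (Fin k) (Fin r) ℝ) :
    Matrix (Fin r) (Fin r) ℝ :=
  Dᵀ * S⁻¹ * D

/-- `M = Σ⁻¹ - Σ⁻¹ ∇ J⁻¹ ∇' Σ⁻¹`. -/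
def reducedWeight (S : Matrix (Fin k) (Fin k) ℝ) (D : Matrix (Fin k) (Fin r) ℝ) :
    Matrix (Fin k) (Fin k) ℝ :=
  S⁻¹ - S⁻¹ * D * (infoMatrix S D)⁻¹ * Dᵀ * S⁻¹

/-- `Φ(ϑ(β, γ))` is differentiable in `γ` at `γ = 0`, uniformly over `β ∈ B`, with derivative
`D β = ∇(β)`, and `J(β)` is positive definite. -/
structure MomentExpansion [MeasurableSpace X] (φ : X → (Fin p → ℝ) → Fin k → ℝ) (P₀ : Measure X)
    (B : Set (Fin q → ℝ)) (Γ : (Fin q → ℝ) → Set (Fin r → ℝ))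
    (ϑ : (Fin q → ℝ) × (Fin r → ℝ) → Fin p → ℝ)
    (D : (Fin q → ℝ) → Matrix (Fin k) (Fin r) ℝ) : Prop where
  unif_differentiable : ∀ ε : ℝ, 0 < ε → ∃ δ : ℝ, 0 < δ ∧ ∀ z ∈ graphSet B Γ, ‖z.2‖ < δ →
    ‖popMoment φ P₀ (ϑ z) - popMoment φ P₀ (ϑ (z.1, 0)) - D z.1 *ᵥ z.2‖ ≤ ε * ‖z.2‖
  posDef : ∀ β ∈ B, (infoMatrix (momentCov φ P₀ (ϑ (β, 0)) (ϑ (β, 0))) (D β)).PosDef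

/-! ### The infeasible posterior -/

/-- The adjusted prior `dπ⁰(β) = π_γ(0 | β) |J(β)|^{-1/2} dπ(β)` on `B`. -/
def adjustedPrior [MeasurableSpace X] (φ : X → (Fin p → ℝ) → Fin k → ℝ) (P₀ : Measure X)
    (B : Set (Fin q → ℝ)) (ϑ : (Fin q → ℝ) × (Fin r → ℝ) → Fin p → ℝ)
    (joint : Measure ((Fin q → ℝ) × (Fin r → ℝ))) (dens : (Fin q → ℝ) → (Fin r → ℝ) → ℝ)
    (D : (Fin q → ℝ) → Matrix (Fin k) (Fin r) ℝ) : Measure (Fin q → ℝ) :=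
  (joint.fst.restrict B).withDensity fun β => ENNReal.ofReal
    (dens β 0 * (infoMatrix (momentCov φ P₀ (ϑ (β, 0)) (ϑ (β, 0))) (D β)).det ^ (-(1 / 2) : ℝ))

/-- The reduced objective `Q_n^β(β) = g_n(β)' M(β) g_n(β)`, where `g_n(β) = g_n(ϑ(β, 0))`. -/
def reducedObjective [MeasurableSpace X] (φ : X → (Fin p → ℝ) → Fin k → ℝ) (P₀ : Measure X)
    (ϑ : (Fin q → ℝ) × (Fin r → ℝ) → Fin p → ℝ)
    (D : (Fin q → ℝ) → Matrix (Fin k) (Fin r) ℝ)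
    (n : ℕ) (x : Fin n → X) (β : Fin q → ℝ) : ℝ :=
  quadForm (reducedWeight (momentCov φ P₀ (ϑ (β, 0)) (ϑ (β, 0))) (D β))
    (sampleMoment φ n x (ϑ (β, 0)))

end WeakGMM

end

noncomputable section

namespace WeakGMM

/-! ### Contiguity -/

/-! The proof is a Laplace approximation carried out along deterministic sequences of samples, with
two reductions in front of it.

First, contiguity (`IsLocalSequence.tendsto_sampleLaw`): events whose outer probability vanishes
under i.i.d. sampling from `P₀` also vanish under the local sequence. No likelihood expansion is
needed. The local density is compared with `w * b`, where `w` is a normalized square of `1 + h` and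
`h` is a truncated score divided by `2√n`. The n-fold Hellinger distance to this intermediate law is
small, while the n-fold second moment of `w` stays bounded.

Second, randomness is removed (`MomentAsymptotics.tendsto_sampleLaw_zero`). Weak convergence to a
process with continuous paths makes `g_n - √n Φ` uniformly bounded and asymptotically equicontinuous
with outer probability close to one. If a bad event kept outer probability above some `ε₀`
infinitely often, a diagonal choice would give samples in it along which the centered moments are
bounded and equicontinuous and the variance estimates converge uniformly (`AsymptoticallyRegular`).
It therefore suffices to prove each claim along every such sequence. The Gaussian law plays no
further role: boundedness and equicontinuity carry the rest.

Along such a sequence `Φ` is bounded below by a multiple of `‖γ‖` on the parameterized neighbourhood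
and by a constant outside it. So the objective dominates `b n ‖γ‖² - C` there and `b n - C`
elsewhere (`exists_objective_lower_bound`). Put `γ = u / √n`. At fixed `(β, u)` the objective
differs by `o(1)` from the form of `Σ⁻¹` at `∇ u + g_n(β)`. Completing the square splits this into a
form of `J` in a shift of `u` plus the reduced objective. The Gaussian integral over `u` yields
`(2π)^{r/2} |J|^{-1/2}`, hence the adjusted prior. Dominated convergence, in `u` and then in `β`,
gives `tendsto_integral_sub`.

Since `g_n(β)` need not converge, all limits are stated for differences. Quotients are handled by a
lower bound on the limiting denominator. Both posterior claims are instances of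
`tendsto_posterior_sub`, whose integrands may vary along the sequence: a fixed `c`, or the
indicators of the sets on which concentration is claimed to fail. -/

theorem setLIntegral_pi_prod_ofReal {X : Type*} [MeasurableSpace X] {n : ℕ} {μ : Measure X}
    [IsFiniteMeasure μ] {ρ : X → ℝ} (hint : Integrable ρ μ)
    (h0 : ∀ x, 0 ≤ ρ x) {s : Fin n → Set X} (hs : ∀ i, MeasurableSet (s i)) :
    ∫⁻ x in Set.pi univ s, ENNReal.ofReal (∏ i, ρ (x i)) ∂(Measure.pi fun _ : Fin n => μ) =
      ∏ i, ∫⁻ x in s i, ENNReal.ofReal (ρ x) ∂μ := by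
  have hS : MeasurableSet (Set.pi univ s) := MeasurableSet.univ_pi hs
  rw [← lintegral_indicator hS]
  have h1 : ∀ x : Fin n → X, (Set.pi univ s).indicator
      (fun x => ENNReal.ofReal (∏ i, ρ (x i))) x =
      ENNReal.ofReal (∏ i, (s i).indicator ρ (x i)) := by
    intro x
    by_cases hx : x ∈ Set.pi univ s
    · rw [indicator_of_mem hx]
      congr 1
      exact Finset.prod_congr rfl fun i _ => (indicator_of_mem (hx i (mem_univ i)) _).symm
    · rw [indicator_of_notMem hx]
      have : ∃ i, x i ∉ s i := by simpa [Set.mem_pi] using hx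
      obtain ⟨i, hi⟩ := this
      rw [Finset.prod_eq_zero (Finset.mem_univ i) (indicator_of_notMem hi _)]
      simp
  simp_rw [h1]
  have hi : ∀ i, Integrable ((s i).indicator ρ) μ := fun i => hint.indicator (hs i)
  have hi0 : ∀ i x, 0 ≤ (s i).indicator ρ x := fun i x => indicator_nonneg (fun y _ => h0 y) x
  rw [← ofReal_integral_eq_lintegral_ofReal (Integrable.fintype_prod_dep hi)
    (Eventually.of_forall fun x => Finset.prod_nonneg fun i _ => hi0 i (x i)),
    integral_fintype_prod_eq_prod, ENNReal.ofReal_prod_of_nonneg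
      fun i _ => integral_nonneg (hi0 i)]
  refine Finset.prod_congr rfl fun i _ => ?_
  rw [integral_indicator (hs i), ofReal_integral_eq_lintegral_ofReal hint.integrableOn
    (Eventually.of_forall h0)]

theorem pi_withDensity_ofReal {X : Type*} [MeasurableSpace X] (n : ℕ) {μ : Measure X}
    [IsFiniteMeasure μ] {ρ : X → ℝ} (hint : Integrable ρ μ) (h0 : ∀ x, 0 ≤ ρ x) :
    (Measure.pi fun _ : Fin n => μ.withDensity fun x => ENNReal.ofReal (ρ x)) =
      (Measure.pi fun _ : Fin n => μ).withDensity fun x => ENNReal.ofReal (∏ i, ρ (x i)) := by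
  have : IsFiniteMeasure (μ.withDensity fun x => ENNReal.ofReal (ρ x)) :=
    isFiniteMeasure_withDensity_ofReal hint.2
  refine Measure.pi_eq (μ := fun _ : Fin n => μ.withDensity fun x => ENNReal.ofReal (ρ x)) ?_
  intro s hs
  rw [withDensity_apply _ (MeasurableSet.univ_pi hs), setLIntegral_pi_prod_ofReal hint h0 hs]
  exact Finset.prod_congr rfl fun i _ => (withDensity_apply _ (hs i)).symm

theorem pi_withDensity_real_apply {X : Type*} [MeasurableSpace X] (n : ℕ) {μ : Measure X}
    [IsFiniteMeasure μ] {ρ : X → ℝ} (hint : Integrable ρ μ) (h0 : ∀ x, 0 ≤ ρ x)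
    {S : Set (Fin n → X)} (hS : MeasurableSet S) :
    (Measure.pi fun _ : Fin n => μ.withDensity fun x => ENNReal.ofReal (ρ x)).real S =
      ∫ x in S, ∏ i, ρ (x i) ∂(Measure.pi fun _ : Fin n => μ) := by
  rw [pi_withDensity_ofReal n hint h0, Measure.real, withDensity_apply _ hS,
    integral_eq_lintegral_of_nonneg_ae
      (Eventually.of_forall fun x => Finset.prod_nonneg fun i _ => h0 _)
      (Integrable.fintype_prod fun _ => hint).aestronglyMeasurable.restrict]

/-- Comparison of product measures with densities `a` and `b`, through the intermediate density
`w * b`. -/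
theorem pi_withDensity_real_le {X : Type*} [MeasurableSpace X] (n : ℕ) {μ : Measure X}
    [IsFiniteMeasure μ] {a b w : X → ℝ} (ha0 : ∀ x, 0 ≤ a x) (hb0 : ∀ x, 0 ≤ b x)
    (hw0 : ∀ x, 0 ≤ w x) (ha : Integrable a μ) (hb : Integrable b μ)
    (hwb : Integrable (fun x => w x * b x) μ) (hwwb : Integrable (fun x => w x ^ 2 * b x) μ)
    (ha1 : ∫ x, a x ∂μ = 1) (hwb1 : ∫ x, w x * b x ∂μ = 1)
    {S : Set (Fin n → X)} (hS : MeasurableSet S) {L : ℝ} (hL : 0 < L) :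
    (Measure.pi fun _ : Fin n => μ.withDensity fun x => ENNReal.ofReal (a x)).real S ≤
      2 * (2 - 2 * (∫ x, √(a x) * √(w x * b x) ∂μ) ^ n) +
      2 * (L * (Measure.pi fun _ : Fin n => μ.withDensity fun x => ENNReal.ofReal (b x)).real S +
        L⁻¹ * (∫ x, w x ^ 2 * b x ∂μ) ^ n) := by
  have hs : Integrable (fun x => √(a x) * √(w x * b x)) μ := by
    refine (ha.add hwb).mono' (by
      have h1 := ha.aestronglyMeasurable.aemeasurable.sqrt
      have h2 := hwb.aestronglyMeasurable.aemeasurable.sqrt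
      exact (h1.mul h2).aestronglyMeasurable) (Eventually.of_forall fun x => ?_)
    rw [Real.norm_of_nonneg (by positivity)]
    have h1 := Real.sq_sqrt (ha0 x)
    have h2 := Real.sq_sqrt (mul_nonneg (hw0 x) (hb0 x))
    simp only [Pi.add_apply]
    nlinarith [sq_nonneg (√(a x) - √(w x * b x)), sq_nonneg (√(a x)), sq_nonneg (√(w x * b x))]
  rw [pi_withDensity_real_apply n ha ha0 hS, pi_withDensity_real_apply n hb hb0 hS]
  set m := Measure.pi fun _ : Fin n => μ
  have Ia : Integrable (fun x : Fin n → X => ∏ i, a (x i)) m := .fintype_prod fun _ => ha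
  have Ib : Integrable (fun x : Fin n → X => ∏ i, b (x i)) m := .fintype_prod fun _ => hb
  have Iwb : Integrable (fun x : Fin n → X => ∏ i, (w (x i) * b (x i))) m :=
    .fintype_prod fun _ => hwb
  have Iwwb : Integrable (fun x : Fin n → X => ∏ i, (w (x i) ^ 2 * b (x i))) m :=
    .fintype_prod fun _ => hwwb
  have Is : Integrable (fun x : Fin n → X => ∏ i, (√(a (x i)) * √(w (x i) * b (x i)))) m :=
    .fintype_prod fun _ => hs
  have Ja : ∫ x, ∏ i, a (x i) ∂m = 1 := by
    rw [integral_fintype_prod_eq_prod (fun _ => a)]; simp [ha1]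
  have Jwb : ∫ x, ∏ i, (w (x i) * b (x i)) ∂m = 1 := by
    rw [integral_fintype_prod_eq_prod (fun _ x => w x * b x)]; simp [hwb1]
  have Jwwb : ∫ x, ∏ i, (w (x i) ^ 2 * b (x i)) ∂m = (∫ x, w x ^ 2 * b x ∂μ) ^ n := by
    rw [integral_fintype_prod_eq_prod (fun _ x => w x ^ 2 * b x)]; simp
  have Js : ∫ x, ∏ i, (√(a (x i)) * √(w (x i) * b (x i))) ∂m =
      (∫ x, √(a x) * √(w x * b x) ∂μ) ^ n := by
    rw [integral_fintype_prod_eq_prod (fun _ x => √(a x) * √(w x * b x))]; simp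
  have hsq : ∀ x : Fin n → X, ∏ i, (√(a (x i)) * √(w (x i) * b (x i))) =
      √(∏ i, a (x i)) * √(∏ i, (w (x i) * b (x i))) := by
    intro x
    rw [Finset.prod_mul_distrib, Real.sqrt_prod _ fun i _ => ha0 _,
      Real.sqrt_prod _ fun i _ => mul_nonneg (hw0 _) (hb0 _)]
  let U : (Fin n → X) → ℝ := fun x => ∏ i, a (x i) + ∏ i, (w (x i) * b (x i)) -
    2 * ∏ i, (√(a (x i)) * √(w (x i) * b (x i)))
  have hU0 : ∀ x, 0 ≤ U x := by
    intro x
    have h1 := Real.sq_sqrt (Finset.prod_nonneg fun i (_ : i ∈ Finset.univ) => ha0 (x i))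
    have h2 := Real.sq_sqrt (Finset.prod_nonneg fun i (_ : i ∈ Finset.univ) =>
      mul_nonneg (hw0 (x i)) (hb0 (x i)))
    simp only [U, hsq]
    nlinarith [sq_nonneg (√(∏ i, a (x i)) - √(∏ i, (w (x i) * b (x i))))]
  have Iab : Integrable (fun x : Fin n → X => ∏ i, a (x i) + ∏ i, (w (x i) * b (x i))) m :=
    Ia.add Iwb
  have Ibw : Integrable (fun x : Fin n → X => L * ∏ i, b (x i) +
      L⁻¹ * ∏ i, (w (x i) ^ 2 * b (x i))) m := (Ib.const_mul L).add (Iwwb.const_mul L⁻¹)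
  have IU : Integrable U m := Iab.sub (Is.const_mul 2)
  have JU : ∫ x, U x ∂m = 2 - 2 * (∫ x, √(a x) * √(w x * b x) ∂μ) ^ n := by
    simp only [U]
    rw [integral_sub Iab (Is.const_mul 2), integral_add Ia Iwb, integral_const_mul,
      Ja, Jwb, Js]
    ring
  have hpt : ∀ x : Fin n → X, ∏ i, a (x i) ≤ 2 * U x +
      2 * (L * ∏ i, b (x i) + L⁻¹ * ∏ i, (w (x i) ^ 2 * b (x i))) := by
    intro x
    have h1 := Real.sq_sqrt (Finset.prod_nonneg fun i (_ : i ∈ Finset.univ) => ha0 (x i))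
    have h2 := Real.sq_sqrt (Finset.prod_nonneg fun i (_ : i ∈ Finset.univ) =>
      mul_nonneg (hw0 (x i)) (hb0 (x i)))
    have h3 : ∏ i, (w (x i) * b (x i)) ≤
        L * ∏ i, b (x i) + L⁻¹ * ∏ i, (w (x i) ^ 2 * b (x i)) := by
      rw [Finset.prod_mul_distrib, Finset.prod_mul_distrib, Finset.prod_pow]
      have hB : 0 ≤ ∏ i, b (x i) := Finset.prod_nonneg fun i _ => hb0 _
      have hW : 0 ≤ ∏ i, w (x i) := Finset.prod_nonneg fun i _ => hw0 _
      -- Either the likelihood ratio is at most `L`, or it is at most its square divided by `L`; the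
      -- sum covers both cases.
      have hWL : ∏ i, w (x i) ≤ L + L⁻¹ * (∏ i, w (x i)) ^ 2 := by
        set W := ∏ i, w (x i)
        have : L + L⁻¹ * W ^ 2 - W = L⁻¹ * ((L - W) ^ 2 + L * W) := by field_simp; ring
        have : 0 ≤ L⁻¹ * ((L - W) ^ 2 + L * W) := by positivity
        linarith
      calc (∏ i, w (x i)) * ∏ i, b (x i) ≤ (L + L⁻¹ * (∏ i, w (x i)) ^ 2) * ∏ i, b (x i) :=
            mul_le_mul_of_nonneg_right hWL hB
        _ = _ := by ring
    -- This is `s² ≤ 2 (s - t)² + 2 t²` for the two square roots; the difference of the sides is `(s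
    -- - 2t)²`.
    have h4 : ∏ i, a (x i) ≤ 2 * U x + 2 * ∏ i, (w (x i) * b (x i)) := by
      simp only [U, hsq]
      nlinarith [sq_nonneg (√(∏ i, a (x i)) - 2 * √(∏ i, (w (x i) * b (x i))))]
    linarith
  calc ∫ x in S, ∏ i, a (x i) ∂m
      ≤ ∫ x in S, (2 * U x + 2 * (L * ∏ i, b (x i) + L⁻¹ * ∏ i, (w (x i) ^ 2 * b (x i)))) ∂m :=
        integral_mono Ia.integrableOn ((IU.const_mul 2).add
          (Ibw.const_mul 2)).integrableOn hpt
    _ = 2 * ∫ x in S, U x ∂m + 2 * (L * ∫ x in S, ∏ i, b (x i) ∂m +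
          L⁻¹ * ∫ x in S, ∏ i, (w (x i) ^ 2 * b (x i)) ∂m) := by
        rw [integral_add (IU.const_mul 2).integrableOn
          (Ibw.const_mul 2).integrableOn,
          integral_const_mul, integral_const_mul,
          integral_add (Ib.const_mul L).integrableOn (Iwwb.const_mul L⁻¹).integrableOn,
          integral_const_mul, integral_const_mul]
    _ ≤ _ := by
        have e1 : ∫ x in S, U x ∂m ≤ ∫ x, U x ∂m :=
          setIntegral_le_integral IU (Eventually.of_forall hU0)
        have e2 : ∫ x in S, ∏ i, (w (x i) ^ 2 * b (x i)) ∂m ≤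
            ∫ x, ∏ i, (w (x i) ^ 2 * b (x i)) ∂m :=
          setIntegral_le_integral Iwwb (Eventually.of_forall fun x =>
            Finset.prod_nonneg fun i _ => mul_nonneg (sq_nonneg _) (hb0 _))
        rw [JU] at e1
        rw [Jwwb] at e2
        have := mul_le_mul_of_nonneg_left e2 (inv_nonneg.2 hL.le)
        linarith

/-- The intermediate density is `(1 + h)² b / Z`. Its root is close to that of `a` at Hellinger
scale `δ / n`, so the affinity survives the n-th power. Its second moment is `1 + O(κ)`, hence
bounded after the n-th power when `κ` is of order `1 / n`. -/
theorem pi_withDensity_real_le_of_hellinger {X : Type*} [MeasurableSpace X] {n : ℕ} (hn : 0 < n)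
    {μ : Measure X} [IsFiniteMeasure μ] {a b h : X → ℝ} (ha0 : ∀ x, 0 ≤ a x)
    (hb0 : ∀ x, 0 ≤ b x) (ha : Integrable a μ) (hb : Integrable b μ)
    (ha1 : ∫ x, a x ∂μ = 1) (hb1 : ∫ x, b x ∂μ = 1) (hh : Measurable h) {κ δ : ℝ}
    (hκ : κ ≤ 1 / 4) (hhκ : ∀ x, h x ^ 2 ≤ κ) (hδ : δ ≤ 1)
    (hd : n * ∫ x, (√(a x) - (1 + h x) * √(b x)) ^ 2 ∂μ ≤ δ)
    {S : Set (Fin n → X)} (hS : MeasurableSet S) {L : ℝ} (hL : 0 < L) :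
    (Measure.pi fun _ : Fin n => μ.withDensity fun x => ENNReal.ofReal (a x)).real S ≤
      4 * δ + 2 * (L * (Measure.pi fun _ : Fin n =>
        μ.withDensity fun x => ENNReal.ofReal (b x)).real S + L⁻¹ * Real.exp (144 * κ * n)) := by
  have hh2 : ∀ x, |h x| ≤ 1 / 2 := fun x =>
    abs_le_of_sq_le_sq (by linarith [hhκ x, show (1 / 2 : ℝ) ^ 2 = 1 / 4 by norm_num]) (by norm_num)
  have hl : ∀ x, -(1 / 2) ≤ h x := fun x => (abs_le.1 (hh2 x)).1
  have hu : ∀ x, h x ≤ 1 / 2 := fun x => (abs_le.1 (hh2 x)).2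
  have Ipow : ∀ g : X → ℝ, Measurable g → (∃ C, ∀ x, |g x| ≤ C) →
      Integrable (fun x => g x * b x) μ := fun g hg ⟨C, hC⟩ =>
    hb.bdd_mul hg.aestronglyMeasurable (Eventually.of_forall fun x => (hC x : ‖g x‖ ≤ C))
  have I1 : Integrable (fun x => h x * b x) μ := Ipow h hh ⟨_, hh2⟩
  have I2 : Integrable (fun x => (1 + h x) ^ 2 * b x) μ :=
    Ipow _ (by fun_prop) ⟨4, fun x => by
      rw [abs_of_nonneg (sq_nonneg _)]; nlinarith [hl x, hu x]⟩
  have I4 : Integrable (fun x => (1 + h x) ^ 4 * b x) μ :=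
    Ipow _ (by fun_prop) ⟨16, fun x => by
      rw [abs_of_nonneg (by positivity)]
      have h1 : (1 + h x) ^ 2 ≤ 4 := by nlinarith [hl x, hu x]
      calc (1 + h x) ^ 4 = ((1 + h x) ^ 2) ^ 2 := by ring
        _ ≤ 4 ^ 2 := pow_le_pow_left₀ (sq_nonneg _) h1 2
        _ = 16 := by norm_num⟩
  set Z := ∫ x, (1 + h x) ^ 2 * b x ∂μ with hZ
  set e := ∫ x, h x * b x ∂μ with he
  have hZe : 1 + 2 * e ≤ Z := by
    have : ∫ x, (b x + 2 * (h x * b x)) ∂μ ≤ Z := integral_mono (hb.add (I1.const_mul 2)) I2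
      fun x => by
        have := mul_nonneg (sq_nonneg (h x)) (hb0 x)
        simp only []
        nlinarith
    rwa [integral_add hb (I1.const_mul 2), integral_const_mul, hb1] at this
  have hZ4 : 1 / 4 ≤ Z := by
    have : ∫ x, (1 / 4 * b x) ∂μ ≤ Z := integral_mono (hb.const_mul _) I2 fun x =>
      mul_le_mul_of_nonneg_right (by nlinarith [hl x]) (hb0 x)
    rwa [integral_const_mul, hb1, mul_one] at this
  -- Makes `1 + 2e` nonnegative, so that `1 + 2e ≤ Z` may be squared below.
  have he1 : -(1 / 2) ≤ e := by
    have : ∫ x, (-(1 / 2) * b x) ∂μ ≤ e := integral_mono (hb.const_mul _) I1 fun x =>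
      mul_le_mul_of_nonneg_right (hl x) (hb0 x)
    rwa [integral_const_mul, hb1, mul_one] at this
  have h4e : ∫ x, (1 + h x) ^ 4 * b x ∂μ ≤ 1 + 4 * e + 9 * κ := by
    have : ∫ x, (1 + h x) ^ 4 * b x ∂μ ≤ ∫ x, ((1 + 9 * κ) * b x + 4 * (h x * b x)) ∂μ :=
      integral_mono I4 ((hb.const_mul _).add (I1.const_mul 4)) fun x => by
        have h1 : (1 + h x) ^ 4 ≤ (1 + 9 * κ) + 4 * h x := by
          have h2 : (1 + h x) ^ 4 ≤ 1 + 4 * h x + 9 * h x ^ 2 := by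
            have h3 : 4 * h x + h x ^ 2 ≤ 3 := by nlinarith [hl x, hu x]
            nlinarith [mul_le_mul_of_nonneg_left h3 (sq_nonneg (h x))]
          linarith [hhκ x]
        have := mul_le_mul_of_nonneg_right h1 (hb0 x)
        simp only []
        linarith
    rw [integral_add (hb.const_mul _) (I1.const_mul 4), integral_const_mul, integral_const_mul,
      hb1] at this
    linarith
  -- A negative `κ` would force `X` to be empty, against the total mass one of `b`.
  have hκ0 : 0 ≤ κ := by
    by_contra hneg
    have hE : IsEmpty X := ⟨fun x => by linarith [hhκ x, sq_nonneg (h x)]⟩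
    rw [Measure.eq_zero_of_isEmpty μ] at hb1
    simp at hb1
  have hZ0 : 0 < Z := by linarith
  have hsZ : 1 / 2 ≤ √Z := Real.le_sqrt_of_sq_le
    (by linarith [show (1 / 2 : ℝ) ^ 2 = 1 / 4 by norm_num])
  have hsZ2 : √Z ^ 2 = Z := Real.sq_sqrt hZ0.le
  let w : X → ℝ := fun x => (1 + h x) ^ 2 / Z
  have hwb : (fun x => w x * b x) = fun x => Z⁻¹ * ((1 + h x) ^ 2 * b x) := by
    funext x; simp only [w]; ring
  have hwwb : (fun x => w x ^ 2 * b x) = fun x => (Z ^ 2)⁻¹ * ((1 + h x) ^ 4 * b x) := by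
    funext x; simp only [w]; field_simp
  have hsw : ∀ x, √(w x * b x) = (√Z)⁻¹ * ((1 + h x) * √(b x)) := by
    intro x
    have : w x * b x = Z⁻¹ * ((1 + h x) ^ 2 * b x) := congrFun hwb x
    rw [this, Real.sqrt_mul (inv_nonneg.2 hZ0.le), Real.sqrt_inv, Real.sqrt_mul (sq_nonneg _),
      Real.sqrt_sq (by linarith [hl x])]
  have key := pi_withDensity_real_le n (w := w) ha0 hb0 (fun x => by positivity) ha hb
    (by rw [hwb]; exact I2.const_mul _) (by rw [hwwb]; exact I4.const_mul _) ha1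
    (by rw [hwb, integral_const_mul, ← hZ]; field_simp) hS hL
  have hn' : (0 : ℝ) < n := by exact_mod_cast hn
  -- second moment of the density
  have hE : (∫ x, w x ^ 2 * b x ∂μ) ^ n ≤ Real.exp (144 * κ * n) := by
    -- The first-order term `4e` cancels against `Z² ≥ 1 + 4e`, leaving `9κ / Z²`; with `Z² ≥ 1/16`
    -- this is at most `144κ`.
    have h1 : ∫ x, w x ^ 2 * b x ∂μ ≤ 1 + 144 * κ := by
      rw [hwwb, integral_const_mul]
      have hZZ : 1 + 4 * e ≤ Z ^ 2 := by
        have := pow_le_pow_left₀ (by linarith) hZe 2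
        nlinarith [sq_nonneg e]
      rw [inv_mul_le_iff₀ (by positivity)]
      have : 1 / 16 ≤ Z ^ 2 := by nlinarith
      nlinarith
    calc (∫ x, w x ^ 2 * b x ∂μ) ^ n ≤ (1 + 144 * κ) ^ n :=
          pow_le_pow_left₀ (integral_nonneg fun x => mul_nonneg (sq_nonneg _) (hb0 x)) h1 n
      _ ≤ (Real.exp (144 * κ)) ^ n := pow_le_pow_left₀ (by positivity)
          (by linarith [Real.add_one_le_exp (144 * κ)]) n
      _ = _ := by rw [← Real.exp_nat_mul]; ring_nf
  -- Hellinger affinity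
  have hmeas : AEStronglyMeasurable (fun x => √(a x) * ((1 + h x) * √(b x))) μ :=
    (ha.aestronglyMeasurable.aemeasurable.sqrt.mul ((measurable_const.add hh).aemeasurable.mul
      hb.aestronglyMeasurable.aemeasurable.sqrt)).aestronglyMeasurable
  have Is : Integrable (fun x => √(a x) * ((1 + h x) * √(b x))) μ := by
    refine (ha.add I2).mono' hmeas (Eventually.of_forall fun x => ?_)
    have h0 : 0 ≤ (1 + h x) * √(b x) :=
      mul_nonneg (by linarith [hl x]) (Real.sqrt_nonneg _)
    rw [Real.norm_of_nonneg (mul_nonneg (Real.sqrt_nonneg _) h0)]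
    have h1 := Real.sq_sqrt (ha0 x)
    have h2 : ((1 + h x) * √(b x)) ^ 2 = (1 + h x) ^ 2 * b x := by
      rw [mul_pow, Real.sq_sqrt (hb0 x)]
    simp only [Pi.add_apply]
    nlinarith [sq_nonneg (√(a x) - (1 + h x) * √(b x)), sq_nonneg (√(a x)),
      sq_nonneg ((1 + h x) * √(b x))]
  have hA : ∫ x, √(a x) * √(w x * b x) ∂μ =
      (√Z)⁻¹ * ∫ x, √(a x) * ((1 + h x) * √(b x)) ∂μ := by
    rw [← integral_const_mul]
    refine integral_congr_ae (Eventually.of_forall fun x => ?_)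
    simp only [hsw]
    ring
  set d := ∫ x, (√(a x) - (1 + h x) * √(b x)) ^ 2 ∂μ with hd_def
  have hd0 : 0 ≤ d := integral_nonneg fun x => sq_nonneg _
  have hdexp : d = 1 + Z - 2 * ∫ x, √(a x) * ((1 + h x) * √(b x)) ∂μ := by
    have Iaz : Integrable (fun x => a x + (1 + h x) ^ 2 * b x) μ := ha.add I2
    have haz : ∫ x, (a x + (1 + h x) ^ 2 * b x) ∂μ = 1 + Z := by rw [integral_add ha I2, ha1]
    rw [hd_def, ← haz, ← integral_const_mul, ← integral_sub Iaz (Is.const_mul 2)]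
    refine integral_congr_ae (Eventually.of_forall fun x => ?_)
    simp only []
    rw [sub_sq, Real.sq_sqrt (ha0 x), mul_pow, Real.sq_sqrt (hb0 x)]
    ring
  -- Passing from `(1 + h)√b` to its normalization costs nothing: `(√Z - 1)² ≥ 0` and `√Z ≥ 1/2`
  -- give the bound. Bernoulli's inequality then handles the n-th power.
  have hAd : 1 - d ≤ ∫ x, √(a x) * √(w x * b x) ∂μ := by
    rw [hA, le_inv_mul_iff₀ (by linarith)]
    nlinarith [sq_nonneg (√Z - 1)]
  have hd1 : d ≤ 1 := by
    have : (1 : ℝ) ≤ n := by exact_mod_cast hn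
    nlinarith
  have hAn : 1 - δ ≤ (∫ x, √(a x) * √(w x * b x) ∂μ) ^ n := by
    calc 1 - δ ≤ 1 + n * (-d) := by linarith
      _ ≤ (1 + -d) ^ n := one_add_mul_le_pow (by linarith) n
      _ ≤ _ := pow_le_pow_left₀ (by linarith) (by linarith) n
  have := mul_le_mul_of_nonneg_left hE (inv_nonneg.2 hL.le)
  linarith

theorem withDensity_ofReal_toReal_rnDeriv {X : Type*} [MeasurableSpace X] {P μ : Measure X}
    [IsFiniteMeasure P] [IsFiniteMeasure μ] (h : P ≪ μ) :
    μ.withDensity (fun x => ENNReal.ofReal (P.rnDeriv μ x).toReal) = P := by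
  conv_rhs => rw [← Measure.withDensity_rnDeriv_eq P μ h]
  refine withDensity_congr_ae ?_
  filter_upwards [Measure.rnDeriv_lt_top P μ] with x hx
  exact ENNReal.ofReal_toReal hx.ne

theorem tendsto_integral_sq_sub_truncation {X : Type*} [MeasurableSpace X] {P : Measure X}
    {f : X → ℝ} (hf : Measurable f) (hf2 : Integrable (fun x => f x ^ 2) P) :
    Tendsto (fun M : ℕ => ∫ x, (f x - if |f x| ≤ M then f x else 0) ^ 2 ∂P) atTop (𝓝 0) := by
  have hm : ∀ M : ℕ, Measurable fun x => if |f x| ≤ M then f x else 0 := fun M =>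
    Measurable.ite (measurableSet_le hf.abs measurable_const) hf measurable_const
  have h := tendsto_integral_of_dominated_convergence (μ := P) (f := fun _ => (0 : ℝ))
    (F := fun (M : ℕ) x => (f x - if |f x| ≤ M then f x else 0) ^ 2) (fun x => f x ^ 2)
    (fun M => ((hf.sub (hm M)).pow_const 2).aestronglyMeasurable) hf2
    (fun M => Eventually.of_forall fun x => by
      rw [Real.norm_of_nonneg (sq_nonneg _)]
      split_ifs
      · simp [sq_nonneg]
      · simp)
    (Eventually.of_forall fun x => by
      obtain ⟨N, hN⟩ := exists_nat_ge |f x|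
      refine tendsto_const_nhds.congr' ?_
      filter_upwards [eventually_ge_atTop N] with M hM
      rw [if_pos (hN.trans (by exact_mod_cast hM))]
      simp)
  simpa using h

/-- **Contiguity**: the laws of i.i.d. samples from a sequence local to `P₀` are contiguous with
respect to the laws of i.i.d. samples from `P₀`. -/
theorem IsLocalSequence.tendsto_sampleLaw {X : Type*} [MeasurableSpace X] {P₀ : Measure X}
    [IsProbabilityMeasure P₀] {P : ℕ → Measure X} [∀ n, IsProbabilityMeasure (P n)] {f : X → ℝ}
    (hP : IsLocalSequence P₀ P f) {S : (n : ℕ) → Set (Fin n → X)}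
    (hS : Tendsto (fun n => sampleLaw P₀ n (S n)) atTop (𝓝 0)) :
    Tendsto (fun n => sampleLaw (P n) n (S n)) atTop (𝓝 0) := by
  obtain ⟨hf, hlim⟩ := hP
  have i0 : ∀ n, IsProbabilityMeasure (sampleLaw P₀ n) := fun n => by
    unfold sampleLaw; infer_instance
  have i1 : ∀ n, IsProbabilityMeasure (sampleLaw (P n) n) := fun n => by
    unfold sampleLaw; infer_instance
  let T : (n : ℕ) → Set (Fin n → X) := fun n => toMeasurable (sampleLaw P₀ n) (S n)
  have hT : ∀ n, MeasurableSet (T n) := fun n => measurableSet_toMeasurable _ _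
  have hT0 : Tendsto (fun n => (sampleLaw P₀ n).real (T n)) atTop (𝓝 0) := by
    have : (fun n => (sampleLaw P₀ n).real (T n)) = fun n => (sampleLaw P₀ n (S n)).toReal := by
      funext n; simp only [Measure.real, T, measure_toMeasurable]
    rw [this]
    exact (ENNReal.tendsto_toReal ENNReal.zero_ne_top).comp hS
  -- densities
  let μ : ℕ → Measure X := fun n => P n + P₀
  let a : ℕ → X → ℝ := fun n x => ((P n).rnDeriv (μ n) x).toReal
  let b : ℕ → X → ℝ := fun n x => (P₀.rnDeriv (μ n) x).toReal
  have hac : ∀ n, P n ≪ μ n := fun n =>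
    Measure.absolutelyContinuous_of_le (Measure.le_add_right le_rfl)
  have hbc : ∀ n, P₀ ≪ μ n := fun n =>
    Measure.absolutelyContinuous_of_le (Measure.le_add_left le_rfl)
  have ma : ∀ n, Measurable (a n) := fun n => (Measure.measurable_rnDeriv _ _).ennreal_toReal
  have mb : ∀ n, Measurable (b n) := fun n => (Measure.measurable_rnDeriv _ _).ennreal_toReal
  have ha0 : ∀ n x, 0 ≤ a n x := fun n x => ENNReal.toReal_nonneg
  have hb0 : ∀ n x, 0 ≤ b n x := fun n x => ENNReal.toReal_nonneg
  have Ia : ∀ n, Integrable (a n) (μ n) := fun n => Measure.integrable_toReal_rnDeriv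
  have Ib : ∀ n, Integrable (b n) (μ n) := fun n => Measure.integrable_toReal_rnDeriv
  have ha1 : ∀ n, ∫ x, a n x ∂(μ n) = 1 := fun n => by
    simp only [a]; rw [Measure.integral_toReal_rnDeriv (hac n)]; simp
  have hb1 : ∀ n, ∫ x, b n x ∂(μ n) = 1 := fun n => by
    simp only [b]; rw [Measure.integral_toReal_rnDeriv (hbc n)]; simp
  have hPa : ∀ n, (μ n).withDensity (fun x => ENNReal.ofReal (a n x)) = P n := fun n =>
    withDensity_ofReal_toReal_rnDeriv (hac n)
  have hPb : ∀ n, (μ n).withDensity (fun x => ENNReal.ofReal (b n x)) = P₀ := fun n =>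
    withDensity_ofReal_toReal_rnDeriv (hbc n)
  -- remainder
  let R : ℕ → X → ℝ := fun n x => √(n : ℝ) * (√(a n x) - √(b n x)) - 1 / 2 * f x * √(b n x)
  have mR : ∀ n, Measurable (R n) := fun n =>
    (((ma n).sqrt.sub (mb n).sqrt).const_mul _).sub ((hf.const_mul _).mul (mb n).sqrt)
  have hfin : ∀ᶠ n in atTop, ∫⁻ x, ENNReal.ofReal (R n x ^ 2) ∂(μ n) < ⊤ :=
    hlim.eventually_lt_const (by simp)
  have IR : ∀ᶠ n in atTop, Integrable (fun x => R n x ^ 2) (μ n) := hfin.mono fun n hn =>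
    ⟨((mR n).pow_const 2).aestronglyMeasurable, by
      rw [hasFiniteIntegral_iff_ofReal (Eventually.of_forall fun x => sq_nonneg _)]
      exact hn⟩
  have hR0 : Tendsto (fun n => ∫ x, R n x ^ 2 ∂(μ n)) atTop (𝓝 0) := by
    have : (fun n => ∫ x, R n x ^ 2 ∂(μ n)) =
        fun n => (∫⁻ x, ENNReal.ofReal (R n x ^ 2) ∂(μ n)).toReal := by
      funext n
      exact integral_eq_lintegral_of_nonneg_ae (Eventually.of_forall fun x => sq_nonneg _)
        ((mR n).pow_const 2).aestronglyMeasurable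
    rw [this]
    exact (ENNReal.tendsto_toReal ENNReal.zero_ne_top).comp hlim
  -- integrals with respect to `P₀`
  have hint : ∀ n (g : X → ℝ), Integrable g P₀ ↔ Integrable (fun x => g x * b n x) (μ n) := by
    intro n g
    rw [← integrable_rnDeriv_smul_iff (hbc n)]
    simp only [smul_eq_mul, mul_comm, b]
  have hintegral : ∀ n (g : X → ℝ), ∫ x, g x * b n x ∂(μ n) = ∫ x, g x ∂P₀ := by
    intro n g
    rw [← integral_rnDeriv_smul (hbc n)]
    simp only [smul_eq_mul, mul_comm, b]
  -- Square integrability of the score is a consequence of locality: at any `n` with finite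
  -- remainder, `f √b` is twice the difference of `√n (√a - √b)` and `R n`, both square integrable.
  have hf2 : Integrable (fun x => f x ^ 2) P₀ := by
    obtain ⟨n, hn⟩ := IR.exists
    rw [hint n]
    refine Integrable.mono' ((((Ia n).add (Ib n)).const_mul (16 * n)).add (hn.const_mul 8))
      ((hf.pow_const 2).mul (mb n)).aestronglyMeasurable (Eventually.of_forall fun x => ?_)
    have h1 := Real.sq_sqrt (ha0 n x)
    have h2 := Real.sq_sqrt (hb0 n x)
    have h3 : √(n : ℝ) ^ 2 = n := Real.sq_sqrt (Nat.cast_nonneg n)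
    have h4 : f x ^ 2 * b n x = (2 * (√(n : ℝ) * (√(a n x) - √(b n x)) - R n x)) ^ 2 := by
      simp only [R]
      rw [← h2]
      simp only [Real.sqrt_sq (Real.sqrt_nonneg _)]
      ring
    rw [Real.norm_of_nonneg (mul_nonneg (sq_nonneg _) (hb0 n x)), h4]
    simp only [Pi.add_apply]
    have h5 : (√(n : ℝ) * (√(a n x) - √(b n x))) ^ 2 ≤ n * (2 * (a n x + b n x)) := by
      rw [mul_pow, h3]
      refine mul_le_mul_of_nonneg_left ?_ (Nat.cast_nonneg n)
      nlinarith [sq_nonneg (√(a n x) + √(b n x))]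
    nlinarith [sq_nonneg (√(n : ℝ) * (√(a n x) - √(b n x)) + R n x)]
  have hρ := tendsto_integral_sq_sub_truncation hf hf2
  have hreal : Tendsto (fun n => (sampleLaw (P n) n).real (T n)) atTop (𝓝 0) := by
    rw [Metric.tendsto_atTop']
    suffices ∀ ε > 0, ∀ᶠ n in atTop, (sampleLaw (P n) n).real (T n) < ε by
      intro ε hε
      obtain ⟨N, hN⟩ := eventually_atTop.1 (this ε hε)
      exact ⟨N, fun n hn => by
        rw [Real.dist_eq, sub_zero, abs_of_nonneg measureReal_nonneg]; exact hN n hn.le⟩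
    intro ε hε
    obtain ⟨δ, hδ0, hδ1, hδε⟩ : ∃ δ : ℝ, 0 < δ ∧ δ ≤ 1 ∧ 4 * δ ≤ ε / 4 :=
      ⟨min 1 (ε / 16), by positivity, min_le_left _ _, by
        linarith [min_le_right 1 (ε / 16)]⟩
    obtain ⟨M, hM⟩ := (hρ.eventually_lt_const hδ0).exists
    set t : X → ℝ := fun x => if |f x| ≤ M then f x else 0 with ht
    have mt : Measurable t :=
      Measurable.ite (measurableSet_le hf.abs measurable_const) hf measurable_const
    have htM : ∀ x, t x ^ 2 ≤ (M : ℝ) ^ 2 := by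
      intro x
      simp only [ht]
      split_ifs with h
      · exact sq_le_sq' (by linarith [(abs_le.1 h).1]) (abs_le.1 h).2
      · simp
    have Ift : Integrable (fun x => (f x - t x) ^ 2) P₀ := by
      refine hf2.mono' ((hf.sub mt).pow_const 2).aestronglyMeasurable
        (Eventually.of_forall fun x => ?_)
      rw [Real.norm_of_nonneg (sq_nonneg _)]
      simp only [ht]
      split_ifs
      · simpa using sq_nonneg (f x)
      · simp
    set E := Real.exp (36 * (M : ℝ) ^ 2) with hE
    have hE0 : 0 < E := Real.exp_pos _
    -- The truncation level `M`, hence `E`, is fixed before `L` and `n`. The final bound is `4δ ≤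
    -- ε/4` plus twice two terms of size at most `ε/8`.
    set L : ℝ := 8 * E / ε with hL
    have hL0 : 0 < L := by positivity
    filter_upwards [IR, hR0.eventually_lt_const (show (0 : ℝ) < δ / 4 by positivity),
      hT0.eventually_lt_const (show (0 : ℝ) < ε / (8 * L) by positivity),
      eventually_ge_atTop (M ^ 2 + 1)] with n h1 h2 h3 h4
    have hn : 0 < n := by omega
    have hn' : (0 : ℝ) < n := by exact_mod_cast hn
    have hMn : (M : ℝ) ^ 2 ≤ n := by exact_mod_cast (by omega : M ^ 2 ≤ n)
    have hsn : √(n : ℝ) ^ 2 = n := Real.sq_sqrt hn'.le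
    have hsn0 : 0 < √(n : ℝ) := Real.sqrt_pos.2 hn'
    have key := pi_withDensity_real_le_of_hellinger hn (μ := μ n) (a := a n) (b := b n)
      (h := fun x => t x / (2 * √(n : ℝ))) (ha0 n) (hb0 n) (Ia n) (Ib n) (ha1 n) (hb1 n)
      (mt.div_const _) (κ := (M : ℝ) ^ 2 / (4 * n)) (δ := δ)
      (by rw [div_le_iff₀ (by positivity)]; linarith)
      (fun x => by
        rw [div_pow, mul_pow, hsn]
        norm_num
        exact div_le_div_of_nonneg_right (htM x) (by positivity)) hδ1 ?_ (hT n) hL0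
    · rw [hPa, hPb] at key
      have e1 : 144 * ((M : ℝ) ^ 2 / (4 * n)) * n = 36 * (M : ℝ) ^ 2 := by field_simp; ring
      rw [e1] at key
      have e2 : L⁻¹ * E = ε / 8 := by rw [hL]; field_simp
      have e3 : L * (sampleLaw P₀ n).real (T n) < ε / 8 := by
        rw [lt_div_iff₀ (by positivity)] at h3
        linarith
      change (sampleLaw (P n) n).real (T n) ≤ 4 * δ +
        2 * (L * (sampleLaw P₀ n).real (T n) + L⁻¹ * E) at key
      linarith
    -- The error against the truncated score splits into the remainder `R n` and the discarded part
    -- `f - t`, whose integrals were made smaller than `δ/4` and `δ`.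
    · have hpt : ∀ x, n * (√(a n x) - (1 + t x / (2 * √(n : ℝ))) * √(b n x)) ^ 2 ≤
          2 * R n x ^ 2 + 1 / 2 * ((f x - t x) ^ 2 * b n x) := by
        intro x
        have e1 : n * (√(a n x) - (1 + t x / (2 * √(n : ℝ))) * √(b n x)) ^ 2 =
            (R n x + 1 / 2 * ((f x - t x) * √(b n x))) ^ 2 := by
          simp only [R]
          rw [← hsn]
          simp only [Real.sqrt_sq hsn0.le]
          field_simp
          ring
        have e2 : ((f x - t x) * √(b n x)) ^ 2 = (f x - t x) ^ 2 * b n x := by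
          rw [mul_pow, Real.sq_sqrt (hb0 n x)]
        rw [e1, ← e2]
        nlinarith [sq_nonneg (R n x - 1 / 2 * ((f x - t x) * √(b n x)))]
      have I3 := (hint n _).1 Ift
      rw [← integral_const_mul]
      calc ∫ x, n * (√(a n x) - (1 + t x / (2 * √(n : ℝ))) * √(b n x)) ^ 2 ∂(μ n)
          ≤ ∫ x, (2 * R n x ^ 2 + 1 / 2 * ((f x - t x) ^ 2 * b n x)) ∂(μ n) :=
            integral_mono_of_nonneg (Eventually.of_forall fun x => by positivity)
              ((h1.const_mul 2).add (I3.const_mul (1 / 2))) (Eventually.of_forall hpt)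
        _ = 2 * ∫ x, R n x ^ 2 ∂(μ n) + 1 / 2 * ∫ x, (f x - t x) ^ 2 ∂P₀ := by
            rw [integral_add (h1.const_mul 2) (I3.const_mul (1 / 2)), integral_const_mul,
              integral_const_mul, hintegral]
        _ ≤ δ := by linarith
  have hE : (fun n => sampleLaw (P n) n (T n)) =
      fun n => ENNReal.ofReal ((sampleLaw (P n) n).real (T n)) := by
    funext n; rw [ofReal_measureReal]
  have hT1 : Tendsto (fun n => sampleLaw (P n) n (T n)) atTop (𝓝 0) := by
    have h := (ENNReal.continuous_ofReal.tendsto 0).comp hreal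
    rw [ENNReal.ofReal_zero] at h
    rw [hE]
    exact h
  exact tendsto_of_tendsto_of_tendsto_of_le_of_le tendsto_const_nhds hT1 (fun n => zero_le)
    fun n => measure_mono (subset_toMeasurable _ _)

/-! ### Consequences of weak convergence -/

/-- A supremum of functionals with a common Lipschitz constant for uniform convergence is again
Lipschitz. This turns suprema over uncountable index sets, such as a modulus of continuity, into
admissible test functions for weak convergence. -/
theorem exists_boundedContinuous_eq_iSup {S V ι : Type*} [PseudoMetricSpace V]
    (ψ : ι → (S → V) → ℝ) (h0 : ∀ i y, 0 ≤ ψ i y) (h1 : ∀ i y, ψ i y ≤ 1) {C : ℝ} (hC : 0 < C)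
    (hψ : ∀ i y z η, (∀ s, dist (y s) (z s) ≤ η) → |ψ i y - ψ i z| ≤ C * η) :
    ∃ h : (S →ᵤ V) →ᵇ ℝ, ∀ y : S → V, h (UniformFun.ofFun y) = ⨆ i, ψ i y := by
  let F : (S →ᵤ V) → ℝ := fun y => ⨆ i, ψ i (UniformFun.toFun y)
  have bdd : ∀ y, BddAbove (Set.range fun i => ψ i y) := fun y => ⟨1, by
    rintro _ ⟨i, rfl⟩; exact h1 i y⟩
  have hF0 : ∀ y, 0 ≤ F y := fun y => Real.iSup_nonneg fun i => h0 i _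
  have hF1 : ∀ y, F y ≤ 1 := fun y => Real.iSup_le (fun i => h1 i _) zero_le_one
  have hle : ∀ y z : S →ᵤ V, ∀ η, 0 ≤ η →
      (∀ s, dist (UniformFun.toFun y s) (UniformFun.toFun z s) ≤ η) → F y ≤ F z + C * η := by
    intro y z η hη h
    refine Real.iSup_le (fun i => ?_) (add_nonneg (hF0 z) (by positivity))
    have e1 := (abs_le.1 (hψ i _ _ η h)).2
    have e2 : ψ i (UniformFun.toFun z) ≤ F z := le_ciSup (bdd (UniformFun.toFun z)) i
    linarith
  have hcont : Continuous F := by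
    rw [continuous_iff_continuousAt]
    intro y
    rw [ContinuousAt, Metric.tendsto_nhds]
    intro ε hε
    have hη : 0 < ε / (2 * C) := by positivity
    filter_upwards [(UniformFun.hasBasis_nhds S V y).mem_of_mem
      (Metric.dist_mem_uniformity hη)] with z hz
    have hz' : ∀ s, dist (UniformFun.toFun y s) (UniformFun.toFun z s) < ε / (2 * C) := hz
    have e1 := hle y z _ hη.le fun s => (hz' s).le
    have e2 := hle z y _ hη.le fun s => by rw [dist_comm]; exact (hz' s).le
    have e3 : C * (ε / (2 * C)) = ε / 2 := by field_simp
    rw [Real.dist_eq, abs_lt]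
    constructor <;> linarith
  refine ⟨BoundedContinuousFunction.ofNormedAddCommGroup F hcont 1 fun y => ?_, fun y => rfl⟩
  rw [Real.norm_of_nonneg (hF0 y)]
  exact hF1 y

/-- Markov's inequality, applied to a measurable majorant nearly attaining the outer expectation. -/
theorem measure_one_le_of_outerExpectation_lt {Ω : Type*} [MeasurableSpace Ω] {μ : Measure Ω}
    [IsProbabilityMeasure μ] {T : Ω → ℝ} (h0 : ∀ ω, 0 ≤ T ω) (h1 : ∀ ω, T ω ≤ 1) {ε : ℝ}
    (h : outerExpectation μ T < ε) : μ {ω | 1 ≤ T ω} ≤ ENNReal.ofReal ε := by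
  have hne : {a | ∃ U : Ω → ℝ, Measurable U ∧ Integrable U μ ∧ (∀ ω, T ω ≤ U ω) ∧
      a = ∫ ω, U ω ∂μ}.Nonempty :=
    ⟨_, fun _ => 1, measurable_const, integrable_const _, h1, rfl⟩
  obtain ⟨a, ⟨U, hU, hUi, hTU, rfl⟩, ha⟩ := exists_lt_of_csInf_lt hne h
  have hU0 : ∀ ω, 0 ≤ U ω := fun ω => (h0 ω).trans (hTU ω)
  have hM := mul_meas_ge_le_integral_of_nonneg (Eventually.of_forall hU0) hUi 1
  rw [one_mul] at hM
  calc μ {ω | 1 ≤ T ω} ≤ μ {ω | 1 ≤ U ω} := measure_mono fun ω hω => le_trans hω (hTU ω)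
    _ = ENNReal.ofReal (μ.real {ω | 1 ≤ U ω}) := (ofReal_measureReal).symm
    _ ≤ ENNReal.ofReal ε := ENNReal.ofReal_le_ofReal (hM.trans ha.le)

/-- Dominated convergence for functions that need not be measurable: the integral of a function
that is not almost everywhere measurable is zero. -/
theorem tendsto_integral_zero_of_bounded {Ω : Type*} [MeasurableSpace Ω] {ν : Measure Ω}
    [IsFiniteMeasure ν] {F : ℕ → Ω → ℝ} {C : ℝ} (hC : ∀ m ω, |F m ω| ≤ C)
    (hF : ∀ ω, Tendsto (fun m => F m ω) atTop (𝓝 0)) :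
    Tendsto (fun m => ∫ ω, F m ω ∂ν) atTop (𝓝 0) := by
  classical
  let F' : ℕ → Ω → ℝ := fun m => if AEStronglyMeasurable (F m) ν then F m else 0
  have hF' : (fun m => ∫ ω, F m ω ∂ν) = fun m => ∫ ω, F' m ω ∂ν := by
    funext m
    by_cases h : AEStronglyMeasurable (F m) ν
    · simp only [F', if_pos h]
    · simp only [F', if_neg h]
      rw [integral_undef fun hi => h hi.aestronglyMeasurable]
      simp
  have hle : ∀ m ω, |F' m ω| ≤ |F m ω| := by
    intro m ω
    by_cases h : AEStronglyMeasurable (F m) ν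
    · simp only [F', if_pos h]; exact le_rfl
    · simp only [F', if_neg h]; simp
  rw [hF']
  have key := tendsto_integral_of_dominated_convergence (μ := ν) (F := F') (f := fun _ => (0 : ℝ))
    (fun _ => C) (fun m => by
      by_cases h : AEStronglyMeasurable (F m) ν
      · simp only [F', if_pos h]; exact h
      · simp only [F', if_neg h]; exact aestronglyMeasurable_zero) (integrable_const _)
    (fun m => Eventually.of_forall fun ω => (hle m ω).trans (hC m ω))
    (Eventually.of_forall fun ω => squeeze_zero_norm (fun m => hle m ω) (by
      simpa using (hF ω).abs))
  simpa using key

/-- The suprema of the `ψ m` tend to zero along every continuous path, so their integrals under the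
limit law are small for some `m`. Weak convergence at that fixed `m` transfers smallness to large
`n`. An empty index type is harmless because the real supremum is then `0`. -/
theorem WeakConvergesToProcess.exists_eventually_le {X : Type*} [MeasurableSpace X] {k : ℕ}
    {S : Type*} [TopologicalSpace S] {P : Measure X} [IsProbabilityMeasure P]
    {Y : (n : ℕ) → (Fin n → X) → S → Fin k → ℝ} {Ω : Type*} [MeasurableSpace Ω] {ν : Measure Ω}
    [IsProbabilityMeasure ν] {G : Ω → C(S, Fin k → ℝ)} (hY : WeakConvergesToProcess P Y ν G)
    {ι : ℕ → Type*} (ψ : (m : ℕ) → ι m → (S → Fin k → ℝ) → ℝ)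
    (h0 : ∀ m i y, 0 ≤ ψ m i y) (h1 : ∀ m i y, ψ m i y ≤ 1) {C : ℝ} (hC : 0 < C)
    (hψ : ∀ m i y z η, (∀ s, dist (y s) (z s) ≤ η) → |ψ m i y - ψ m i z| ≤ C * η)
    (hlim : ∀ y : C(S, Fin k → ℝ), ∀ ε : ℝ, 0 < ε → ∀ᶠ m in atTop, ∀ i, ψ m i y ≤ ε)
    {ε : ℝ} (hε : 0 < ε) :
    ∃ m, ∀ᶠ n in atTop, sampleLaw P n {x | ∃ i, 1 ≤ ψ m i (Y n x)} ≤ ENNReal.ofReal ε := by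
  choose h hh using fun m => exists_boundedContinuous_eq_iSup (ψ m) (h0 m) (h1 m) hC (hψ m)
  have hh0 : ∀ m y, 0 ≤ h m (UniformFun.ofFun y) := fun m y => by
    rw [hh]; exact Real.iSup_nonneg fun i => h0 m i _
  have hh1 : ∀ m y, h m (UniformFun.ofFun y) ≤ 1 := fun m y => by
    rw [hh]; exact Real.iSup_le (fun i => h1 m i _) zero_le_one
  have hT : Tendsto (fun m => ∫ ω, h m (UniformFun.ofFun (G ω)) ∂ν) atTop (𝓝 0) := by
    refine tendsto_integral_zero_of_bounded (C := 1) (fun m ω => ?_) fun ω => ?_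
    · rw [abs_of_nonneg (hh0 m _)]; exact hh1 m _
    · rw [Metric.tendsto_nhds]
      intro δ hδ
      filter_upwards [hlim (G ω) (δ / 2) (by positivity)] with m hm
      rw [Real.dist_eq, sub_zero, abs_of_nonneg (hh0 m _), hh]
      exact (Real.iSup_le (fun i => hm i) (by positivity)).trans_lt (by linarith)
  obtain ⟨m, hm⟩ := (hT.eventually_lt_const hε).exists
  refine ⟨m, ?_⟩
  filter_upwards [(hY (h m)).eventually_lt_const hm] with n hn
  have : IsProbabilityMeasure (sampleLaw P n) := by unfold sampleLaw; infer_instance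
  refine le_trans (measure_mono ?_)
    (measure_one_le_of_outerExpectation_lt (fun x => hh0 m _) (fun x => hh1 m _) hn)
  rintro x ⟨i, hi⟩
  simp only [mem_ofPred_eq, hh]
  exact hi.trans (le_ciSup (f := fun i => ψ m i (Y n x)) ⟨1, by
    rintro _ ⟨i, rfl⟩; exact h1 m i _⟩ i)

theorem WeakConvergesToProcess.exists_bound {X : Type*} [MeasurableSpace X] {k : ℕ}
    {S : Type*} [TopologicalSpace S] [CompactSpace S] {P : Measure X} [IsProbabilityMeasure P]
    {Y : (n : ℕ) → (Fin n → X) → S → Fin k → ℝ} {Ω : Type*} [MeasurableSpace Ω] {ν : Measure Ω}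
    [IsProbabilityMeasure ν] {G : Ω → C(S, Fin k → ℝ)} (hY : WeakConvergesToProcess P Y ν G)
    {ε : ℝ} (hε : 0 < ε) :
    ∃ K : ℝ, ∀ᶠ n in atTop, sampleLaw P n {x | ¬ ∀ s, ‖Y n x s‖ ≤ K} ≤ ENNReal.ofReal ε := by
  obtain ⟨m, hm⟩ := hY.exists_eventually_le (ι := fun _ => S)
    (fun m s y => min 1 (max 0 (‖y s‖ - m))) (fun m s y => by positivity)
    (fun m s y => min_le_left _ _) (C := 1) one_pos
    (fun m s y z η h => by
      rw [one_mul]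
      refine (abs_min_sub_min_le_max _ _ _ _).trans (max_le ?_ ?_)
      · simpa using dist_nonneg.trans (h s)
      · refine (abs_max_sub_max_le_max _ _ _ _).trans (max_le ?_ ?_)
        · simpa using dist_nonneg.trans (h s)
        · rw [show ‖y s‖ - m - (‖z s‖ - m) = ‖y s‖ - ‖z s‖ by ring]
          exact (abs_norm_sub_norm_le _ _).trans (by rw [← dist_eq_norm]; exact h s))
    (fun y δ hδ => by
      obtain ⟨N, hN⟩ := exists_nat_ge ‖y‖
      filter_upwards [eventually_ge_atTop N] with m hm s
      have e1 : ‖y s‖ - m ≤ 0 := by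
        have e2 : (N : ℝ) ≤ m := by exact_mod_cast hm
        linarith [y.norm_coe_le_norm s]
      rw [max_eq_left e1]
      exact (min_le_right _ _).trans hδ.le) hε
  -- The test functional reaches `1` only once the norm exceeds `m` by one, hence the bound `m + 1`.
  refine ⟨m + 1, hm.mono fun n hn => (measure_mono ?_).trans hn⟩
  intro x hx
  simp only [mem_ofPred_eq, not_forall, not_le] at hx ⊢
  obtain ⟨s, hs⟩ := hx
  exact ⟨s, le_min le_rfl (le_max_of_le_right (by linarith))⟩

/-- The index of the test family is a pair of points closer than `1 / (m + 1)`. Uniform continuity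
of a limit path on the compact space makes these functionals vanish uniformly. -/
theorem WeakConvergesToProcess.exists_modulus {X : Type*} [MeasurableSpace X] {k : ℕ}
    {S : Type*} [PseudoMetricSpace S] [CompactSpace S] {P : Measure X} [IsProbabilityMeasure P]
    {Y : (n : ℕ) → (Fin n → X) → S → Fin k → ℝ} {Ω : Type*} [MeasurableSpace Ω] {ν : Measure Ω}
    [IsProbabilityMeasure ν] {G : Ω → C(S, Fin k → ℝ)} (hY : WeakConvergesToProcess P Y ν G)
    {ε η : ℝ} (hε : 0 < ε) (hη : 0 < η) :
    ∃ δ : ℝ, 0 < δ ∧ ∀ᶠ n in atTop, sampleLaw P n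
      {x | ¬ ∀ s t, dist s t < δ → ‖Y n x s - Y n x t‖ < η} ≤ ENNReal.ofReal ε := by
  obtain ⟨m, hm⟩ := hY.exists_eventually_le
    (ι := fun m => {z : S × S // dist z.1 z.2 < 1 / ((m : ℝ) + 1)})
    (fun m z y => min 1 (‖y z.1.1 - y z.1.2‖ / η)) (fun m s y => by positivity)
    (fun m s y => min_le_left _ _) (C := 2 / η) (by positivity)
    (fun m s y z a h => by
      have ha : 0 ≤ a := dist_nonneg.trans (h s.1.1)
      refine (abs_min_sub_min_le_max _ _ _ _).trans (max_le ?_ ?_)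
      · simp only [sub_self, abs_zero]; positivity
      · rw [← sub_div, abs_div, abs_of_pos hη, div_mul_eq_mul_div]
        refine div_le_div_of_nonneg_right ?_ hη.le
        refine (abs_norm_sub_norm_le _ _).trans ?_
        have e1 := h s.1.1
        have e2 := h s.1.2
        rw [dist_eq_norm] at e1 e2
        calc ‖y s.1.1 - y s.1.2 - (z s.1.1 - z s.1.2)‖
            = ‖(y s.1.1 - z s.1.1) - (y s.1.2 - z s.1.2)‖ := by congr 1; abel
          _ ≤ _ := (norm_sub_le _ _).trans (by linarith))
    (fun y a ha => by
      have huc := Metric.uniformContinuous_iff.1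
        (CompactSpace.uniformContinuous_of_continuous y.continuous) (a * η) (by positivity)
      obtain ⟨δ, hδ, hδ'⟩ := huc
      obtain ⟨N, hN⟩ := exists_nat_one_div_lt hδ
      filter_upwards [eventually_ge_atTop N] with m hm z
      refine (min_le_right _ _).trans ?_
      rw [div_le_iff₀ hη, ← dist_eq_norm]
      refine (hδ' (lt_trans (lt_of_lt_of_le z.2 ?_) hN)).le
      exact one_div_le_one_div_of_le (by positivity) (by
        have : (N : ℝ) ≤ m := by exact_mod_cast hm
        linarith)) hε
  refine ⟨1 / ((m : ℝ) + 1), by positivity, hm.mono fun n hn => (measure_mono ?_).trans hn⟩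
  intro x hx
  simp only [mem_ofPred_eq, not_forall, not_lt] at hx ⊢
  obtain ⟨s, t, hst, h⟩ := hx
  exact ⟨⟨(s, t), hst⟩, le_min le_rfl ((one_le_div hη).2 h)⟩

/-! ### Reduction to deterministic sequences -/

/-- Sequences along which the centered moments `g - √N Φ` are bounded and asymptotically
equicontinuous on `Θ`, and the weights `V` converge to `Σ` uniformly on `Θ`. -/
structure AsymptoticallyRegular {p k : ℕ} (Θ : Set (Fin p → ℝ)) (Φ : (Fin p → ℝ) → Fin k → ℝ)
    (Sig : (Fin p → ℝ) → Matrix (Fin k) (Fin k) ℝ) (N : ℕ → ℕ)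
    (g : ℕ → (Fin p → ℝ) → Fin k → ℝ)
    (V : ℕ → (Fin p → ℝ) → Matrix (Fin k) (Fin k) ℝ) : Prop where
  tendsto : Tendsto N atTop atTop
  bounded : ∃ K : ℝ, ∀ᶠ j in atTop, ∀ θ ∈ Θ, ‖g j θ - √(N j : ℝ) • Φ θ‖ ≤ K
  equicontinuous : ∀ η : ℝ, 0 < η → ∃ δ : ℝ, 0 < δ ∧ ∀ᶠ j in atTop, ∀ θ ∈ Θ, ∀ θ' ∈ Θ,
    dist θ θ' < δ → ‖(g j θ - √(N j : ℝ) • Φ θ) - (g j θ' - √(N j : ℝ) • Φ θ')‖ < η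
  variance : ∀ η : ℝ, 0 < η → ∀ᶠ j in atTop, ∀ θ ∈ Θ, ∀ i i', |V j θ i i' - Sig θ i i'| < η

/-- The first `j + 1` exceptional sets have total measure below `ε₀`, so they cannot cover `S n`
whenever `S n` has measure above `ε₀`. A point outside them is chosen for each `j`, with `n`
growing. -/
theorem exists_subsequence_of_frequently {Y : ℕ → Type*} [∀ n, MeasurableSpace (Y n)]
    (μ : (n : ℕ) → Measure (Y n)) {S : (n : ℕ) → Set (Y n)} {A : ℕ → (n : ℕ) → Set (Y n)}
    {ε₀ : ENNReal} {ε : ℕ → ENNReal} (hε : ∑' m, ε m < ε₀)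
    (hA : ∀ m, ∀ᶠ n in atTop, μ n (A m n) ≤ ε m) (hS : ∃ᶠ n in atTop, ε₀ < μ n (S n)) :
    ∃ N : ℕ → ℕ, StrictMono N ∧ ∃ x : (j : ℕ) → Y (N j),
      ∀ j, x j ∈ S (N j) ∧ ∀ m ≤ j, x j ∉ A m (N j) := by
  obtain ⟨N, hN, h⟩ := extraction_forall_of_frequently
    (P := fun j n => ∃ x ∈ S n, ∀ m ≤ j, x ∉ A m n) fun j => by
      have hall : ∀ᶠ n in atTop, ∀ m ∈ Finset.range (j + 1), μ n (A m n) ≤ ε m :=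
        (Finset.eventually_all _).2 fun m _ => hA m
      refine (hS.and_eventually hall).mono fun n ⟨h1, h2⟩ => ?_
      by_contra hcon
      push Not at hcon
      have hsub : S n ⊆ ⋃ m ∈ Finset.range (j + 1), A m n := fun x hx => by
        obtain ⟨m, hm, hxm⟩ := hcon x hx
        exact mem_iUnion₂.2 ⟨m, Finset.mem_range.2 (by omega), hxm⟩
      have := calc μ n (S n) ≤ ∑ m ∈ Finset.range (j + 1), μ n (A m n) :=
            (measure_mono hsub).trans (measure_biUnion_finset_le _ _)
        _ ≤ ∑ m ∈ Finset.range (j + 1), ε m := Finset.sum_le_sum h2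
        _ ≤ ∑' m, ε m := ENNReal.sum_le_tsum _
      exact absurd h1 (not_lt.2 (this.trans hε.le))
  choose x hx using h
  exact ⟨N, hN, x, fun j => ⟨(hx j).1, (hx j).2⟩⟩

/-- At level `m` the exceptional set collects failures of the uniform bound, of equicontinuity at
scale `1 / (m + 1)`, and of variance consistency at that scale. Samples that avoid all levels up to
`j` form a regular sequence. -/
theorem MomentAsymptotics.tendsto_sampleLaw_zero {X : Type*} [MeasurableSpace X] {p k : ℕ}
    {Θ : Set (Fin p → ℝ)} (hΘ : IsCompact Θ) {φ : X → (Fin p → ℝ) → Fin k → ℝ}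
    {Shat : (n : ℕ) → (Fin n → X) → (Fin p → ℝ) → Matrix (Fin k) (Fin k) ℝ}
    {P₀ : Measure X} [IsProbabilityMeasure P₀] {Ω : Type*} [MeasurableSpace Ω] {ν : Measure Ω}
    [IsProbabilityMeasure ν] {G : Ω → C(Θ, Fin k → ℝ)}
    (h : MomentAsymptotics Θ φ Shat P₀ ν G) {S : (n : ℕ) → Set (Fin n → X)}
    (hS : ∀ N : ℕ → ℕ, ∀ x : (j : ℕ) → Fin (N j) → X,
      AsymptoticallyRegular Θ (popMoment φ P₀) (fun θ => momentCov φ P₀ θ θ) N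
        (fun j => sampleMoment φ (N j) (x j)) (fun j => Shat (N j) (x j)) →
      ∀ᶠ j in atTop, x j ∉ S (N j)) :
    Tendsto (fun n => sampleLaw P₀ n (S n)) atTop (𝓝 0) := by
  have := isCompact_iff_compactSpace.1 hΘ
  rw [ENNReal.tendsto_nhds_zero]
  by_contra hcon
  push Not at hcon
  obtain ⟨ε₀, hε₀, hfreq⟩ := hcon
  obtain ⟨ε, hε, hsum⟩ := ENNReal.exists_pos_sum_of_countable hε₀.ne' ℕ
  have hε3 : ∀ m, (0 : ℝ) < ε m / 3 := fun m => by
    have : (0 : ℝ) < ε m := by exact_mod_cast hε m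
    positivity
  choose K hK using fun m => h.weak_convergence.exists_bound (hε3 m)
  choose δ hδ0 hδ using fun m : ℕ => h.weak_convergence.exists_modulus (hε3 m)
    (show (0 : ℝ) < 1 / ((m : ℝ) + 1) by positivity)
  have hV : ∀ m : ℕ, ∀ᶠ n in atTop, sampleLaw P₀ n
      {x | ∃ θ ∈ Θ, ∃ i j, 1 / ((m : ℝ) + 1) ≤ |Shat n x θ i j - momentCov φ P₀ θ θ i j|} ≤
      ENNReal.ofReal (ε m / 3) := fun m =>
    ENNReal.tendsto_nhds_zero.1 (h.consistent_variance (1 / ((m : ℝ) + 1)) (by positivity)) _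
      (ENNReal.ofReal_pos.2 (hε3 m))
  obtain ⟨N, hN, x, hx⟩ := exists_subsequence_of_frequently (fun n => sampleLaw P₀ n)
    (S := S) (A := fun m n =>
      ({x | ¬ ∀ s : Θ, ‖sampleMoment φ n x s - √(n : ℝ) • popMoment φ P₀ s‖ ≤ K m} ∪
      {x | ¬ ∀ s t : Θ, dist s t < δ m →
        ‖(sampleMoment φ n x s - √(n : ℝ) • popMoment φ P₀ s) -
          (sampleMoment φ n x t - √(n : ℝ) • popMoment φ P₀ t)‖ < 1 / ((m : ℝ) + 1)}) ∪
      {x | ∃ θ ∈ Θ, ∃ i j, 1 / ((m : ℝ) + 1) ≤ |Shat n x θ i j - momentCov φ P₀ θ θ i j|})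
    (ε := fun m => (ε m : ENNReal)) hsum (fun m => by
      filter_upwards [hK m, hδ m, hV m] with n h1 h2 h3
      refine (measure_union_le _ _).trans ((add_le_add ((measure_union_le _ _).trans
        (add_le_add h1 h2)) h3).trans ?_)
      rw [← ENNReal.ofReal_add (hε3 m).le (hε3 m).le, ← ENNReal.ofReal_add
        (add_nonneg (hε3 m).le (hε3 m).le) (hε3 m).le,
        show (ε m : ℝ) / 3 + ε m / 3 + ε m / 3 = ε m by ring, ENNReal.ofReal_coe_nnreal]) hfreq
  have hgood : ∀ m j, m ≤ j →
      (∀ s ∈ Θ, ‖sampleMoment φ (N j) (x j) s - √(N j : ℝ) • popMoment φ P₀ s‖ ≤ K m) ∧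
      (∀ s ∈ Θ, ∀ t ∈ Θ, dist s t < δ m →
        ‖(sampleMoment φ (N j) (x j) s - √(N j : ℝ) • popMoment φ P₀ s) -
          (sampleMoment φ (N j) (x j) t - √(N j : ℝ) • popMoment φ P₀ t)‖ < 1 / ((m : ℝ) + 1)) ∧
      ∀ θ ∈ Θ, ∀ i i', |Shat (N j) (x j) θ i i' - momentCov φ P₀ θ θ i i'| <
        1 / ((m : ℝ) + 1) := by
    intro m j hmj
    have h1 := (hx j).2 m hmj
    simp only [mem_union, mem_ofPred_eq, not_or, not_not, not_exists, not_and, not_le] at h1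
    exact ⟨fun s hs => h1.1.1 ⟨s, hs⟩, fun s hs t ht hst => h1.1.2 ⟨s, hs⟩ ⟨t, ht⟩ hst, h1.2⟩
  have hreg := hS N x
    { tendsto := hN.tendsto_atTop
      bounded := ⟨K 0, Eventually.of_forall fun j => (hgood 0 j (Nat.zero_le j)).1⟩
      equicontinuous := fun η hη => by
        obtain ⟨m, hm⟩ := exists_nat_one_div_lt hη
        refine ⟨δ m, hδ0 m, ?_⟩
        filter_upwards [eventually_ge_atTop m] with j hj s hs t ht hst
        exact ((hgood m j hj).2.1 s hs t ht hst).trans hm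
      variance := fun η hη => by
        obtain ⟨m, hm⟩ := exists_nat_one_div_lt hη
        filter_upwards [eventually_ge_atTop m] with j hj θ hθ i i'
        exact ((hgood m j hj).2.2 θ hθ i i').trans hm }
  obtain ⟨j, hj⟩ := hreg.exists
  exact hj (hx j).1

/-! ### Quadratic forms -/

theorem quadForm_eq_sum {m : ℕ} (A : Matrix (Fin m) (Fin m) ℝ) (v : Fin m → ℝ) :
    quadForm A v = ∑ i, ∑ j, v i * A i j * v j := by
  simp only [quadForm, dotProduct, mulVec, Finset.mul_sum, mul_assoc]

theorem continuous_quadForm {m : ℕ} :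
    Continuous fun z : Matrix (Fin m) (Fin m) ℝ × (Fin m → ℝ) => quadForm z.1 z.2 := by
  simp only [quadForm_eq_sum]
  fun_prop

theorem measurable_quadForm {m : ℕ} {Y : Type*} [MeasurableSpace Y]
    {A : Y → Matrix (Fin m) (Fin m) ℝ} (hA : ∀ i j, Measurable fun y => A y i j)
    {v : Y → Fin m → ℝ} (hv : Measurable v) : Measurable fun y => quadForm (A y) (v y) := by
  simp only [quadForm_eq_sum]
  have hv' : ∀ i, Measurable fun y => v y i := fun i => measurable_pi_iff.1 hv i
  exact Finset.measurable_sum _ fun i _ => Finset.measurable_sum _ fun j _ =>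
    ((hv' i).mul (hA i j)).mul (hv' j)

theorem aemeasurable_quadForm {m : ℕ} {Y : Type*} [MeasurableSpace Y] {μ : Measure Y}
    {A : Y → Matrix (Fin m) (Fin m) ℝ} (hA : ∀ i j, AEMeasurable (fun y => A y i j) μ)
    {v : Y → Fin m → ℝ} (hv : AEMeasurable v μ) : AEMeasurable (fun y => quadForm (A y) (v y)) μ := by
  simp only [quadForm_eq_sum]
  have hv' : ∀ i, AEMeasurable (fun y => v y i) μ := fun i => aemeasurable_pi_iff.1 hv i
  exact Finset.aemeasurable_fun_sum _ fun i _ => Finset.aemeasurable_fun_sum _ fun j _ =>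
    ((hv' i).mul (hA i j)).mul (hv' j)

theorem measurable_matrix_inv {m : ℕ} {Y : Type*} [MeasurableSpace Y]
    {A : Y → Matrix (Fin m) (Fin m) ℝ} (hA : ∀ i j, Measurable fun y => A y i j) (i j : Fin m) :
    Measurable fun y => (A y)⁻¹ i j := by
  have hm : Measurable fun y => (fun i j => A y i j : Fin m → Fin m → ℝ) :=
    measurable_pi_lambda _ fun i => measurable_pi_lambda _ fun j => hA i j
  have hdet : Measurable fun y => (A y).det := by
    have : Continuous fun B : Fin m → Fin m → ℝ => (Matrix.of B).det :=
      Continuous.matrix_det continuous_id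
    exact this.measurable.comp hm
  have hadj : Measurable fun y => (A y).adjugate i j := by
    have : Continuous fun B : Fin m → Fin m → ℝ => (Matrix.of B).adjugate i j :=
      (Continuous.matrix_adjugate (A := fun B : Fin m → Fin m → ℝ => Matrix.of B)
        continuous_id).matrix_elem i j
    exact this.measurable.comp hm
  simp only [Matrix.inv_def, Matrix.smul_apply, Ring.inverse_eq_inv', smul_eq_mul]
  exact hdet.inv.mul hadj

theorem abs_quadForm_le {m : ℕ} {A : Matrix (Fin m) (Fin m) ℝ} {ε : ℝ}
    (h : ∀ i j, |A i j| ≤ ε) (v : Fin m → ℝ) : |quadForm A v| ≤ m ^ 2 * ε * ‖v‖ ^ 2 := by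
  rw [quadForm_eq_sum]
  calc |∑ i, ∑ j, v i * A i j * v j| ≤ ∑ i : Fin m, ∑ j : Fin m, ε * ‖v‖ ^ 2 := by
        refine (Finset.abs_sum_le_sum_abs _ _).trans (Finset.sum_le_sum fun i _ =>
          (Finset.abs_sum_le_sum_abs _ _).trans (Finset.sum_le_sum fun j _ => ?_))
        rw [abs_mul, abs_mul]
        have h1 : |v i| ≤ ‖v‖ := norm_le_pi_norm v i
        have h2 : |v j| ≤ ‖v‖ := norm_le_pi_norm v j
        calc |v i| * |A i j| * |v j| ≤ ‖v‖ * ε * ‖v‖ := by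
              have := (abs_nonneg (A i j)).trans (h i j)
              gcongr
              exact h i j
          _ = ε * ‖v‖ ^ 2 := by ring
    _ = _ := by simp; ring

theorem quadForm_sub {m : ℕ} (A B : Matrix (Fin m) (Fin m) ℝ) (v : Fin m → ℝ) :
    quadForm (A - B) v = quadForm A v - quadForm B v := by
  simp only [quadForm, sub_mulVec, dotProduct_sub]

theorem quadForm_smul {m : ℕ} (A : Matrix (Fin m) (Fin m) ℝ) (c : ℝ) (v : Fin m → ℝ) :
    quadForm A (c • v) = c ^ 2 * quadForm A v := by
  simp only [quadForm, mulVec_smul, dotProduct_smul, smul_dotProduct, smul_eq_mul]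
  ring

theorem quadForm_pos {m : ℕ} {A : Matrix (Fin m) (Fin m) ℝ} (hA : A.PosDef)
    {v : Fin m → ℝ} (hv : v ≠ 0) : 0 < quadForm A v := by
  simpa [quadForm] using hA.dotProduct_mulVec_pos hv

theorem quadForm_nonneg {m : ℕ} {A : Matrix (Fin m) (Fin m) ℝ} (hA : A.PosSemidef)
    (v : Fin m → ℝ) : 0 ≤ quadForm A v := by
  simpa [quadForm] using hA.dotProduct_mulVec_nonneg v

theorem exists_quadForm_lower_bound {E : Type*} [TopologicalSpace E] {T : Set E}
    (hT : IsCompact T) {m : ℕ} {A : E → Matrix (Fin m) (Fin m) ℝ} (hA : ContinuousOn A T)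
    (hpos : ∀ t ∈ T, (A t).PosDef) :
    ∃ l : ℝ, 0 < l ∧ ∀ t ∈ T, ∀ v, l * ‖v‖ ^ 2 ≤ quadForm (A t) v := by
  have hK : IsCompact (T ×ˢ Metric.sphere (0 : Fin m → ℝ) 1) := hT.prod (isCompact_sphere _ _)
  have hc : ContinuousOn (fun z : E × (Fin m → ℝ) => quadForm (A z.1) z.2)
      (T ×ˢ Metric.sphere (0 : Fin m → ℝ) 1) :=
    continuous_quadForm.comp_continuousOn ((hA.comp continuousOn_fst fun z hz => hz.1).prodMk
      continuousOn_snd)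
  obtain ⟨l, hl, hl'⟩ : ∃ l : ℝ, 0 < l ∧ ∀ z ∈ T ×ˢ Metric.sphere (0 : Fin m → ℝ) 1,
      l ≤ quadForm (A z.1) z.2 := by
    rcases (T ×ˢ Metric.sphere (0 : Fin m → ℝ) 1).eq_empty_or_nonempty with h | h
    -- Covers an empty `T` and dimension `0`, where the unit sphere is empty.
    · exact ⟨1, one_pos, fun z hz => by simp [h] at hz⟩
    · obtain ⟨z, hz, hmin⟩ := hK.exists_isMinOn h hc
      refine ⟨quadForm (A z.1) z.2, quadForm_pos (hpos _ hz.1) ?_, fun y hy => hmin hy⟩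
      intro h0
      have h2 := hz.2
      rw [h0] at h2
      simp at h2
  refine ⟨l, hl, fun t ht v => ?_⟩
  rcases eq_or_ne v 0 with rfl | hv
  · simp [quadForm]
  have hv' : 0 < ‖v‖ := norm_pos_iff.2 hv
  have h1 := hl' (t, ‖v‖⁻¹ • v) ⟨ht, by simp [norm_smul, hv'.ne']⟩
  simp only [quadForm_smul] at h1
  rw [inv_pow, le_inv_mul_iff₀ (by positivity)] at h1
  linarith

theorem exists_quadForm_upper_bound {E : Type*} [TopologicalSpace E] {T : Set E}
    (hT : IsCompact T) {m : ℕ} {A : E → Matrix (Fin m) (Fin m) ℝ} (hA : ContinuousOn A T) :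
    ∃ l : ℝ, 0 < l ∧ ∀ t ∈ T, ∀ v, quadForm (A t) v ≤ l * ‖v‖ ^ 2 := by
  have hij : ∀ i j, ∃ C, ∀ t ∈ T, |A t i j| ≤ C := fun i j => by
    obtain ⟨C, hC⟩ := hT.exists_bound_of_continuousOn
      (f := fun t => A t i j) ((continuous_id.matrix_elem i j).comp_continuousOn hA)
    exact ⟨C, hC⟩
  choose C hC using hij
  refine ⟨m ^ 2 * (∑ i, ∑ j, |C i j|) + 1, by positivity, fun t ht v => ?_⟩
  have h := abs_quadForm_le (A := A t) (ε := ∑ i, ∑ j, |C i j|) (fun i j =>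
    ((hC i j t ht).trans (le_abs_self _)).trans
      ((Finset.single_le_sum (f := fun j => |C i j|) (fun j _ => abs_nonneg _)
        (Finset.mem_univ j)).trans
      (Finset.single_le_sum (f := fun i => ∑ j, |C i j|)
        (fun i _ => Finset.sum_nonneg fun j _ => abs_nonneg _) (Finset.mem_univ i)))) v
  nlinarith [le_abs_self (quadForm (A t) v), sq_nonneg ‖v‖]

theorem continuousOn_matrix_inv {E : Type*} [TopologicalSpace E] {T : Set E} {m : ℕ}
    {A : E → Matrix (Fin m) (Fin m) ℝ} (hA : ContinuousOn A T) (hdet : ∀ t ∈ T, (A t).det ≠ 0) :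
    ContinuousOn (fun t => (A t)⁻¹) T := by
  intro t ht
  refine ContinuousAt.comp_continuousWithinAt (g := fun B : Matrix (Fin m) (Fin m) ℝ => B⁻¹) ?_
    (hA t ht)
  refine continuousAt_matrix_inv _ ?_
  rw [Ring.inverse_eq_inv']
  exact continuousAt_inv₀ (hdet t ht)

/-- Inversion is continuous at each point of the compact image of `A`, hence uniformly so there,
with the second matrix free to leave the image. One `δ` thus works for all `t` and every nearby `B`.
-/
theorem exists_inv_close {E : Type*} [TopologicalSpace E] {T : Set E} (hT : IsCompact T) {m : ℕ}
    {A : E → Matrix (Fin m) (Fin m) ℝ} (hA : ContinuousOn A T) (hdet : ∀ t ∈ T, (A t).det ≠ 0)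
    {ε : ℝ} (hε : 0 < ε) :
    ∃ δ : ℝ, 0 < δ ∧ ∀ t ∈ T, ∀ B : Matrix (Fin m) (Fin m) ℝ, (∀ i j, |B i j - A t i j| < δ) →
      ∀ i j, |B⁻¹ i j - (A t)⁻¹ i j| ≤ ε := by
  let F : (Fin m → Fin m → ℝ) → Fin m → Fin m → ℝ := fun B i j => (Matrix.of B)⁻¹ i j
  let A' : E → Fin m → Fin m → ℝ := fun t i j => A t i j
  have hK : IsCompact (A' '' T) := hT.image_of_continuousOn hA
  have hF : ∀ B ∈ A' '' T, ContinuousAt F B := by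
    rintro _ ⟨t, ht, rfl⟩
    have : ContinuousAt (fun B : Matrix (Fin m) (Fin m) ℝ => B⁻¹) (A t) := by
      refine continuousAt_matrix_inv _ ?_
      rw [Ring.inverse_eq_inv']
      exact continuousAt_inv₀ (hdet t ht)
    exact this
  have h := hK.uniformContinuousAt_of_continuousAt F hF (Metric.dist_mem_uniformity hε)
  obtain ⟨δ, hδ, hsub⟩ := Metric.mem_uniformity_dist.1 h
  refine ⟨δ, hδ, fun t ht B hB i j => ?_⟩
  have hd : dist (A' t) (fun i j => B i j) < δ := by
    rw [dist_pi_lt_iff hδ]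
    intro i
    rw [dist_pi_lt_iff hδ]
    intro j
    rw [Real.dist_eq, abs_sub_comm]
    exact hB i j
  have h1 : dist (F (A' t)) (F fun i j => B i j) < ε := hsub hd ⟨t, ht, rfl⟩
  have h2 : dist (F (A' t) i j) (F (fun i j => B i j) i j) < ε :=
    ((dist_le_pi_dist _ _ j).trans (dist_le_pi_dist _ _ i)).trans_lt h1
  rw [Real.dist_eq, abs_sub_comm] at h2
  exact h2.le

/-! ### Completing the square -/

theorem isSymm_inv_of_isSymm {m : ℕ} {S : Matrix (Fin m) (Fin m) ℝ} (hS : Sᵀ = S) :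
    S⁻¹ᵀ = S⁻¹ := by
  rw [transpose_nonsing_inv, hS]

theorem dotProduct_mulVec_comm_of_isSymm {m : ℕ} {A : Matrix (Fin m) (Fin m) ℝ} (hA : Aᵀ = A)
    (u v : Fin m → ℝ) : u ⬝ᵥ (A *ᵥ v) = v ⬝ᵥ (A *ᵥ u) := by
  rw [dotProduct_mulVec, ← mulVec_transpose, hA, dotProduct_comm]

theorem quadForm_add {m : ℕ} {A : Matrix (Fin m) (Fin m) ℝ} (hA : Aᵀ = A) (u v : Fin m → ℝ) :
    quadForm A (u + v) = quadForm A u + 2 * (u ⬝ᵥ (A *ᵥ v)) + quadForm A v := by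
  simp only [quadForm, mulVec_add, add_dotProduct, dotProduct_add]
  rw [dotProduct_mulVec_comm_of_isSymm hA v u]
  ring

theorem transpose_infoMatrix {k r : ℕ} {S : Matrix (Fin k) (Fin k) ℝ} (hS : Sᵀ = S)
    (D : Matrix (Fin k) (Fin r) ℝ) : (infoMatrix S D)ᵀ = infoMatrix S D := by
  simp only [infoMatrix, transpose_mul, transpose_transpose, isSymm_inv_of_isSymm hS,
    Matrix.mul_assoc]

theorem quadForm_mulVec_eq {k r : ℕ} (S : Matrix (Fin k) (Fin k) ℝ)
    (D : Matrix (Fin k) (Fin r) ℝ) (u : Fin r → ℝ) :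
    quadForm S⁻¹ (D *ᵥ u) = quadForm (infoMatrix S D) u := by
  simp only [quadForm, infoMatrix, ← mulVec_mulVec]
  rw [dotProduct_mulVec u Dᵀ, vecMul_transpose]

theorem quadForm_reducedWeight {k r : ℕ} {S : Matrix (Fin k) (Fin k) ℝ} (hS : Sᵀ = S)
    (D : Matrix (Fin k) (Fin r) ℝ) (g : Fin k → ℝ) :
    quadForm (reducedWeight S D) g = quadForm S⁻¹ g -
      quadForm (infoMatrix S D)⁻¹ (Dᵀ *ᵥ (S⁻¹ *ᵥ g)) := by
  rw [reducedWeight, quadForm_sub]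
  congr 1
  simp only [quadForm, ← mulVec_mulVec]
  rw [dotProduct_mulVec g S⁻¹, ← mulVec_transpose, isSymm_inv_of_isSymm hS,
    dotProduct_mulVec _ D, ← mulVec_transpose]

/-- The algebraic core of the Laplace step: the nuisance direction `u` appears only in a shifted
form of `J`, and what remains is the reduced objective. -/
theorem quadForm_complete_square {k r : ℕ} {S : Matrix (Fin k) (Fin k) ℝ} (hS : Sᵀ = S)
    {D : Matrix (Fin k) (Fin r) ℝ} (hJ : (infoMatrix S D).det ≠ 0) (u : Fin r → ℝ)
    (g : Fin k → ℝ) :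
    quadForm S⁻¹ (D *ᵥ u + g) =
      quadForm (infoMatrix S D) (u + (infoMatrix S D)⁻¹ *ᵥ (Dᵀ *ᵥ (S⁻¹ *ᵥ g))) +
        quadForm (reducedWeight S D) g := by
  rw [quadForm_reducedWeight hS, quadForm_add (isSymm_inv_of_isSymm hS),
    quadForm_add (transpose_infoMatrix hS D), quadForm_mulVec_eq]
  have hJJ : infoMatrix S D * (infoMatrix S D)⁻¹ = 1 :=
    mul_nonsing_inv _ (isUnit_iff_ne_zero.2 hJ)
  have e1 : infoMatrix S D *ᵥ ((infoMatrix S D)⁻¹ *ᵥ (Dᵀ *ᵥ (S⁻¹ *ᵥ g))) = Dᵀ *ᵥ (S⁻¹ *ᵥ g) := by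
    rw [mulVec_mulVec, hJJ, one_mulVec]
  have e2 : quadForm (infoMatrix S D) ((infoMatrix S D)⁻¹ *ᵥ (Dᵀ *ᵥ (S⁻¹ *ᵥ g))) =
      quadForm (infoMatrix S D)⁻¹ (Dᵀ *ᵥ (S⁻¹ *ᵥ g)) := by
    simp only [quadForm]
    rw [e1, dotProduct_comm]
  have e3 : (D *ᵥ u) ⬝ᵥ (S⁻¹ *ᵥ g) = u ⬝ᵥ (Dᵀ *ᵥ (S⁻¹ *ᵥ g)) := by
    rw [dotProduct_mulVec u Dᵀ, vecMul_transpose]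
  rw [e1, e2, e3]
  ring

/-- At the `u` that kills the shifted square, the reduced form equals a value of the form of `S⁻¹`.
-/
theorem quadForm_reducedWeight_nonneg {k r : ℕ} {S : Matrix (Fin k) (Fin k) ℝ}
    (hS : S.PosDef) {D : Matrix (Fin k) (Fin r) ℝ} (hJ : (infoMatrix S D).PosDef)
    (g : Fin k → ℝ) : 0 ≤ quadForm (reducedWeight S D) g := by
  have hsymm : Sᵀ = S := by simpa using hS.isHermitian.eq
  have h := quadForm_complete_square hsymm hJ.det_pos.ne'
    (-((infoMatrix S D)⁻¹ *ᵥ (Dᵀ *ᵥ (S⁻¹ *ᵥ g)))) g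
  rw [neg_add_cancel] at h
  have h0 : quadForm (infoMatrix S D) 0 = 0 := by simp [quadForm]
  rw [h0, zero_add] at h
  rw [← h]
  exact quadForm_nonneg hS.inv.posSemidef _

theorem quadForm_reducedWeight_le {k r : ℕ} {S : Matrix (Fin k) (Fin k) ℝ}
    (hS : S.PosDef) {D : Matrix (Fin k) (Fin r) ℝ} (hJ : (infoMatrix S D).PosDef)
    (g : Fin k → ℝ) : quadForm (reducedWeight S D) g ≤ quadForm S⁻¹ g := by
  have hsymm : Sᵀ = S := by simpa using hS.isHermitian.eq
  rw [quadForm_reducedWeight hsymm]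
  linarith [quadForm_nonneg hJ.inv.posSemidef (Dᵀ *ᵥ (S⁻¹ *ᵥ g))]

/-! ### The Gaussian integral -/

theorem integrable_exp_neg_mul_sum_sq (r : ℕ) {b : ℝ} (hb : 0 < b) :
    Integrable fun v : Fin r → ℝ => Real.exp (-b * ∑ i, v i ^ 2) := by
  have := Integrable.fintype_prod (ι := Fin r) (μ := fun _ => (volume : Measure ℝ))
    (f := fun _ x => Real.exp (-b * x ^ 2)) fun _ => integrable_exp_neg_mul_sq hb
  simp only [Finset.mul_sum, Real.exp_sum]
  exact this

theorem integral_exp_neg_half_sum_sq (r : ℕ) :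
    ∫ v : Fin r → ℝ, Real.exp (-(1 / 2) * ∑ i, v i ^ 2) = √(2 * Real.pi) ^ r := by
  have := integral_fintype_prod_volume_eq_prod (ι := Fin r) (E := fun _ => ℝ)
    (fun _ x => Real.exp (-(1 / 2) * x ^ 2))
  simp only [Finset.mul_sum, Real.exp_sum]
  rw [this, integral_gaussian]
  simp only [Finset.prod_const, Finset.card_univ, Fintype.card_fin]
  congr 2
  ring

theorem integrable_exp_neg_mul_norm_sq (r : ℕ) {b : ℝ} (hb : 0 < b) :
    Integrable fun v : Fin r → ℝ => Real.exp (-b * ‖v‖ ^ 2) := by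
  -- For the sup norm the sum of squares is at most `r ‖v‖²`. Dividing `b` by `r + 1` also covers `r
  -- = 0`.
  refine (integrable_exp_neg_mul_sum_sq r (b := b / (r + 1)) (by positivity)).mono'
    (by fun_prop) (Eventually.of_forall fun v => ?_)
  rw [Real.norm_of_nonneg (Real.exp_pos _).le]
  refine Real.exp_le_exp.2 ?_
  have h : ∑ i, v i ^ 2 ≤ r * ‖v‖ ^ 2 := by
    calc ∑ i, v i ^ 2 ≤ ∑ _i : Fin r, ‖v‖ ^ 2 := Finset.sum_le_sum fun i _ => by
          rw [← sq_abs]; exact pow_le_pow_left₀ (abs_nonneg _) (norm_le_pi_norm v i) 2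
      _ = _ := by simp
  have h2 : b / (r + 1) * ∑ i, v i ^ 2 ≤ b / (r + 1) * ((r + 1) * ‖v‖ ^ 2) :=
    mul_le_mul_of_nonneg_left (h.trans (by nlinarith [sq_nonneg ‖v‖])) (by positivity)
  have h3 : b / ((r : ℝ) + 1) * ((r + 1) * ‖v‖ ^ 2) = b * ‖v‖ ^ 2 := by field_simp
  linarith

open scoped MatrixOrder in
theorem integral_exp_neg_half_quadForm {r : ℕ} {A : Matrix (Fin r) (Fin r) ℝ} (hA : A.PosDef)
    (a : Fin r → ℝ) :
    ∫ u, Real.exp (-(1 / 2) * quadForm A (u + a)) = √(2 * Real.pi) ^ r * A.det ^ (-(1 / 2) : ℝ) := by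
  rw [integral_add_right_eq_self (μ := (volume : Measure (Fin r → ℝ)))
    (fun u => Real.exp (-(1 / 2) * quadForm A u))]
  -- The substitution `v = C u` with `A = Cᵀ C` reduces to the standard Gaussian; its Jacobian `|det
  -- C|` is the root of `det A`.
  obtain ⟨C, hC⟩ : ∃ C : Matrix (Fin r) (Fin r) ℝ, A = Cᴴ * C :=
    CStarAlgebra.nonneg_iff_eq_star_mul_self.1 hA.posSemidef.nonneg
  have hC' : A = Cᵀ * C := by simpa using hC
  have hdet : A.det = C.det ^ 2 := by rw [hC', det_mul, det_transpose, sq]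
  have hC0 : C.det ≠ 0 := fun h => by
    have := hA.det_pos
    rw [hdet, h] at this
    simp at this
  have hq : ∀ u, quadForm A u = ∑ i, (C *ᵥ u) i ^ 2 := by
    intro u
    rw [quadForm, hC', ← mulVec_mulVec, dotProduct_mulVec, vecMul_transpose]
    simp [dotProduct, sq]
  have hmap := Real.map_matrix_volume_pi_eq_smul_volume_pi hC0
  have hm : Measurable (toLin' C) := (toLin' C).continuous_of_finiteDimensional.measurable
  have h1 := integral_map (μ := (volume : Measure (Fin r → ℝ))) hm.aemeasurable
    (f := fun v => Real.exp (-(1 / 2) * ∑ i, v i ^ 2))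
    (by fun_prop : Continuous fun v : Fin r → ℝ =>
      Real.exp (-(1 / 2) * ∑ i, v i ^ 2)).aestronglyMeasurable
  rw [hmap, integral_smul_measure, integral_exp_neg_half_sum_sq] at h1
  simp only [toLin'_apply] at h1
  simp only [hq]
  rw [← h1, ENNReal.toReal_ofReal (abs_nonneg _), smul_eq_mul, mul_comm, abs_inv, hdet,
    ← sq_abs, Real.rpow_neg (by positivity), ← Real.sqrt_eq_rpow, Real.sqrt_sq (abs_nonneg _)]

/-! ### Deterministic models -/

theorem continuousOn_matrix_mul {E : Type*} [TopologicalSpace E] {T : Set E} {a b c : ℕ}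
    {A : E → Matrix (Fin a) (Fin b) ℝ} {A' : E → Matrix (Fin b) (Fin c) ℝ}
    (hA : ContinuousOn A T) (hA' : ContinuousOn A' T) : ContinuousOn (fun t => A t * A' t) T := by
  have : Continuous fun z : Matrix (Fin a) (Fin b) ℝ × Matrix (Fin b) (Fin c) ℝ => z.1 * z.2 :=
    continuous_fst.matrix_mul continuous_snd
  exact this.comp_continuousOn (hA.prodMk hA')

theorem continuousOn_matrix_transpose {E : Type*} [TopologicalSpace E] {T : Set E} {a b : ℕ}
    {A : E → Matrix (Fin a) (Fin b) ℝ} (hA : ContinuousOn A T) :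
    ContinuousOn (fun t => (A t)ᵀ) T := by
  have : Continuous fun z : Matrix (Fin a) (Fin b) ℝ => zᵀ := continuous_id.matrix_transpose
  exact this.comp_continuousOn hA

/-- The conditions on the moments `Φ`, their variance `Sig`, the prior `π` and the
reparameterization that the Laplace approximation relies on. -/
structure RegularModel {p k q r : ℕ} (Θ : Set (Fin p → ℝ)) (Φ : (Fin p → ℝ) → Fin k → ℝ)
    (Sig : (Fin p → ℝ) → Matrix (Fin k) (Fin k) ℝ) (π : Measure (Fin p → ℝ))
    (Θs : Set (Fin p → ℝ)) (B : Set (Fin q → ℝ)) (Γ : (Fin q → ℝ) → Set (Fin r → ℝ))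
    (ϑ : (Fin q → ℝ) × (Fin r → ℝ) → Fin p → ℝ)
    (joint : Measure ((Fin q → ℝ) × (Fin r → ℝ))) (dens : (Fin q → ℝ) → (Fin r → ℝ) → ℝ)
    (D : (Fin q → ℝ) → Matrix (Fin k) (Fin r) ℝ) : Prop where
  compact : IsCompact Θ
  continuous_mean : ContinuousOn Φ Θ
  continuous_cov : ContinuousOn Sig Θ
  posDef_cov : ∀ θ ∈ Θ, (Sig θ).PosDef
  finite_prior : IsFiniteMeasure π
  prior_compl : π Θᶜ = 0
  rep : Reparameterization Θ {θ | θ ∈ Θ ∧ Φ θ = 0} Θs π B Γ ϑ joint dens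
  unif_differentiable : ∀ ε : ℝ, 0 < ε → ∃ δ : ℝ, 0 < δ ∧ ∀ z ∈ graphSet B Γ, ‖z.2‖ < δ →
    ‖Φ (ϑ z) - Φ (ϑ (z.1, 0)) - D z.1 *ᵥ z.2‖ ≤ ε * ‖z.2‖
  posDef_info : ∀ β ∈ B, (infoMatrix (Sig (ϑ (β, 0))) (D β)).PosDef

namespace RegularModel

variable {p k q r : ℕ} {Θ : Set (Fin p → ℝ)} {Φ : (Fin p → ℝ) → Fin k → ℝ}
  {Sig : (Fin p → ℝ) → Matrix (Fin k) (Fin k) ℝ} {π : Measure (Fin p → ℝ)}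
  {Θs : Set (Fin p → ℝ)} {B : Set (Fin q → ℝ)} {Γ : (Fin q → ℝ) → Set (Fin r → ℝ)}
  {ϑ : (Fin q → ℝ) × (Fin r → ℝ) → Fin p → ℝ}
  {joint : Measure ((Fin q → ℝ) × (Fin r → ℝ))} {dens : (Fin q → ℝ) → (Fin r → ℝ) → ℝ}
  {D : (Fin q → ℝ) → Matrix (Fin k) (Fin r) ℝ}

/-! ### Geometry of the reparameterization and identification bounds -/

section Geometry

variable (h : RegularModel Θ Φ Sig π Θs B Γ ϑ joint dens D)
include h

theorem mem_graphSet_zero {β : Fin q → ℝ} (hβ : β ∈ B) : (β, (0 : Fin r → ℝ)) ∈ graphSet B Γ := by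
  obtain ⟨δ, hδ, hB⟩ := h.rep.zero_interior
  exact ⟨hβ, hB β hβ (Metric.mem_ball_self hδ)⟩

theorem map_mem {z : (Fin q → ℝ) × (Fin r → ℝ)} (hz : z ∈ graphSet B Γ) : ϑ z ∈ Θ :=
  h.rep.subset (h.rep.maps_to hz)

theorem mean_eq_zero {β : Fin q → ℝ} (hβ : β ∈ B) : Φ (ϑ (β, 0)) = 0 :=
  (((h.rep.mem_iff _ (h.mem_graphSet_zero hβ)).2 rfl) : _ ∧ _).2

theorem isCompact_base : IsCompact B := by
  have : B = Prod.fst '' graphSet B Γ := by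
    ext β
    exact ⟨fun hβ => ⟨(β, 0), h.mem_graphSet_zero hβ, rfl⟩, fun ⟨z, hz, e⟩ => e ▸ hz.1⟩
  rw [this]
  exact h.rep.compact.image continuous_fst

theorem continuousOn_map : ContinuousOn ϑ (graphSet B Γ) := h.rep.cont_diff.continuousOn

theorem continuousOn_map_zero : ContinuousOn (fun β => ϑ (β, 0)) B :=
  h.continuousOn_map.comp (by fun_prop) fun β hβ => h.mem_graphSet_zero hβ

theorem continuousOn_mean_map : ContinuousOn (fun z => Φ (ϑ z)) (graphSet B Γ) :=
  h.continuous_mean.comp h.continuousOn_map fun _ hz => h.map_mem hz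

theorem continuousOn_cov_map_zero : ContinuousOn (fun β => Sig (ϑ (β, 0))) B :=
  h.continuous_cov.comp h.continuousOn_map_zero fun _ hβ => h.map_mem (h.mem_graphSet_zero hβ)

theorem eventually_mem_graphSet {β : Fin q → ℝ} (hβ : β ∈ B) :
    ∀ᶠ γ in 𝓝 (0 : Fin r → ℝ), (β, γ) ∈ graphSet B Γ := by
  obtain ⟨δ, hδ, hB⟩ := h.rep.zero_interior
  filter_upwards [Metric.ball_mem_nhds (0 : Fin r → ℝ) hδ] with γ hγ
  exact ⟨hβ, hB β hβ hγ⟩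

/-- Continuity of `D` is deduced: `D β v` is a uniform limit in `β` of the difference quotients `t⁻¹
Φ(ϑ(β, t v))`, each continuous in `β`. The ball around `0` common to all `Γ β` lets one `t` serve
every `β`. -/
theorem continuousOn_derivative_mulVec (v : Fin r → ℝ) : ContinuousOn (fun β => D β *ᵥ v) B := by
  obtain ⟨δ₀, hδ₀, hB⟩ := h.rep.zero_interior
  refine continuousOn_of_uniform_approx_of_continuousOn fun U hU => ?_
  obtain ⟨ε, hε, hεU⟩ := Metric.mem_uniformity_dist.1 hU
  obtain ⟨δ, hδ, hδ'⟩ := h.unif_differentiable (ε / (‖v‖ + 1)) (by positivity)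
  obtain ⟨t, ht, htδ⟩ : ∃ t : ℝ, 0 < t ∧ t * (‖v‖ + 1) = min δ δ₀ :=
    ⟨min δ δ₀ / (‖v‖ + 1), by positivity, by field_simp⟩
  have htv : ‖t • v‖ < min δ δ₀ := by
    rw [norm_smul, Real.norm_of_nonneg ht.le, ← htδ]
    nlinarith
  have hmem : ∀ β ∈ B, (β, t • v) ∈ graphSet B Γ := fun β hβ =>
    ⟨hβ, hB β hβ (by simpa using htv.trans_le (min_le_right _ _))⟩
  refine ⟨fun β => t⁻¹ • Φ (ϑ (β, t • v)), ?_, fun β hβ => hεU ?_⟩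
  · exact (h.continuousOn_mean_map.comp (by fun_prop) hmem).const_smul t⁻¹
  · have h1 := hδ' (β, t • v) (hmem β hβ) (htv.trans_le (min_le_left _ _))
    simp only [h.mean_eq_zero hβ, sub_zero, mulVec_smul] at h1
    have h2 : D β *ᵥ v - t⁻¹ • Φ (ϑ (β, t • v)) =
        -(t⁻¹ • (Φ (ϑ (β, t • v)) - t • D β *ᵥ v)) := by
      rw [smul_sub, smul_smul, inv_mul_cancel₀ ht.ne', one_smul, neg_sub]
    rw [dist_eq_norm, h2, norm_neg, norm_smul, norm_inv, Real.norm_of_nonneg ht.le,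
      inv_mul_lt_iff₀ ht]
    refine h1.trans_lt ?_
    rw [norm_smul, Real.norm_of_nonneg ht.le, div_mul_eq_mul_div, div_lt_iff₀ (by positivity)]
    have := mul_pos hε ht
    nlinarith [norm_nonneg v]

theorem continuousOn_derivative : ContinuousOn D B := by
  refine continuousOn_pi.2 fun i => continuousOn_pi.2 fun j => ?_
  have h1 := continuousOn_pi.1 (h.continuousOn_derivative_mulVec (Pi.single j 1)) i
  simpa [mulVec_single_one] using h1

theorem continuousOn_inv_cov : ContinuousOn (fun β => (Sig (ϑ (β, 0)))⁻¹) B :=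
  continuousOn_matrix_inv h.continuousOn_cov_map_zero fun _ hβ =>
    (h.posDef_cov _ (h.map_mem (h.mem_graphSet_zero hβ))).det_pos.ne'

theorem continuousOn_infoMatrix :
    ContinuousOn (fun β => infoMatrix (Sig (ϑ (β, 0))) (D β)) B := by
  unfold infoMatrix
  exact continuousOn_matrix_mul (continuousOn_matrix_mul
    (continuousOn_matrix_transpose h.continuousOn_derivative) h.continuousOn_inv_cov)
    h.continuousOn_derivative

theorem continuousOn_reducedWeight :
    ContinuousOn (fun β => reducedWeight (Sig (ϑ (β, 0))) (D β)) B := by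
  have h4 := continuousOn_matrix_inv h.continuousOn_infoMatrix
    fun β hβ => (h.posDef_info β hβ).det_pos.ne'
  unfold reducedWeight
  exact h.continuousOn_inv_cov.sub (continuousOn_matrix_mul (continuousOn_matrix_mul
    (continuousOn_matrix_mul (continuousOn_matrix_mul h.continuousOn_inv_cov
      h.continuousOn_derivative) h4)
    (continuousOn_matrix_transpose h.continuousOn_derivative)) h.continuousOn_inv_cov)

/-- The form of `J` at `u` is the form of `Σ⁻¹` at `D u`. The first is bounded below and the second
above, uniformly over the compact `B`. -/
theorem exists_derivative_lower_bound :
    ∃ c : ℝ, 0 < c ∧ ∀ β ∈ B, ∀ u, c * ‖u‖ ≤ ‖D β *ᵥ u‖ := by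
  obtain ⟨l, hl, hl'⟩ := exists_quadForm_lower_bound h.isCompact_base h.continuousOn_infoMatrix
    h.posDef_info
  obtain ⟨L, hL, hL'⟩ := exists_quadForm_upper_bound h.isCompact_base h.continuousOn_inv_cov
  refine ⟨√(l / L), Real.sqrt_pos.2 (by positivity), fun β hβ u => ?_⟩
  refine abs_le_of_sq_le_sq' ?_ (norm_nonneg _) |>.2
  rw [mul_pow, Real.sq_sqrt (by positivity), div_mul_eq_mul_div, div_le_iff₀ hL]
  have h1 := hl' β hβ u
  rw [← quadForm_mulVec_eq] at h1
  linarith [hL' β hβ (D β *ᵥ u)]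

/-- For small `γ` the linear expansion gives half the constant of the derivative. For `‖γ‖ ≥ δ` the
mean does not vanish on a compact set, and `‖γ‖` is bounded there. -/
theorem exists_mean_lower_bound :
    ∃ c : ℝ, 0 < c ∧ ∀ z ∈ graphSet B Γ, c * ‖z.2‖ ≤ ‖Φ (ϑ z)‖ := by
  obtain ⟨c, hc, hc'⟩ := h.exists_derivative_lower_bound
  obtain ⟨δ, hδ, hδ'⟩ := h.unif_differentiable (c / 2) (by positivity)
  have hK : IsCompact (graphSet B Γ ∩ {z | δ ≤ ‖z.2‖}) :=
    h.rep.compact.inter_right (isClosed_le continuous_const continuous_snd.norm)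
  have hcont : ContinuousOn (fun z => ‖Φ (ϑ z)‖) (graphSet B Γ ∩ {z | δ ≤ ‖z.2‖}) :=
    (h.continuousOn_mean_map.mono inter_subset_left).norm
  obtain ⟨m, hm, hm'⟩ : ∃ m : ℝ, 0 < m ∧ ∀ z ∈ graphSet B Γ ∩ {z | δ ≤ ‖z.2‖}, m ≤ ‖Φ (ϑ z)‖ := by
    rcases (graphSet B Γ ∩ {z | δ ≤ ‖z.2‖}).eq_empty_or_nonempty with he | hne
    · exact ⟨1, one_pos, fun z hz => by simp [he] at hz⟩
    · obtain ⟨z, hz, hmin⟩ := hK.exists_isMinOn hne hcont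
      refine ⟨‖Φ (ϑ z)‖, norm_pos_iff.2 fun h0 => ?_, fun y hy => hmin hy⟩
      have : z.2 = 0 := (h.rep.mem_iff z hz.1).1 ⟨h.map_mem hz.1, h0⟩
      have h2 : δ ≤ ‖z.2‖ := hz.2
      rw [this, norm_zero] at h2
      linarith
  obtain ⟨R, hR⟩ := h.rep.compact.exists_bound_of_continuousOn
    (f := fun z : (Fin q → ℝ) × (Fin r → ℝ) => z.2) continuousOn_snd
  refine ⟨min (c / 2) (m / (|R| + 1)), by positivity, fun z hz => ?_⟩
  rcases lt_or_ge ‖z.2‖ δ with hlt | hge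
  · have h1 := hδ' z hz hlt
    rw [h.mean_eq_zero hz.1, sub_zero] at h1
    have h2 := hc' z.1 hz.1 z.2
    have h3 := norm_sub_norm_le (D z.1 *ᵥ z.2) (Φ (ϑ z))
    rw [norm_sub_rev] at h3
    have h4 := mul_le_mul_of_nonneg_right (min_le_left (c / 2) (m / (|R| + 1))) (norm_nonneg z.2)
    linarith
  · have h1 := hm' z ⟨hz, hge⟩
    have h2 : ‖z.2‖ ≤ |R| + 1 := by linarith [hR z hz, le_abs_self R]
    calc min (c / 2) (m / (|R| + 1)) * ‖z.2‖ ≤ m / (|R| + 1) * (|R| + 1) := by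
          gcongr
          exact min_le_right _ _
      _ = m := by field_simp
      _ ≤ _ := h1

/-- Points outside `Θs` with means tending to zero would accumulate at a point of the identified
set, near which `Θs` fills `Θ`. -/
theorem exists_mean_lower_bound_compl :
    ∃ c : ℝ, 0 < c ∧ ∀ θ ∈ Θ, θ ∉ Θs → c ≤ ‖Φ θ‖ := by
  by_contra hcon
  push Not at hcon
  have hseq : ∀ n : ℕ, ∃ θ ∈ Θ, θ ∉ Θs ∧ ‖Φ θ‖ < 1 / ((n : ℝ) + 1) := fun n =>
    hcon _ (by positivity)
  choose θ hθ hθs hθΦ using hseq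
  obtain ⟨θ₀, hθ₀, s, hs, hlim⟩ := h.compact.tendsto_subseq hθ
  have hw : Tendsto (θ ∘ s) atTop (𝓝[Θ] θ₀) :=
    tendsto_nhdsWithin_iff.2 ⟨hlim, Eventually.of_forall fun n => hθ _⟩
  have h1 : Tendsto (fun n => ‖Φ (θ (s n))‖) atTop (𝓝 ‖Φ θ₀‖) :=
    ((h.continuous_mean θ₀ hθ₀).tendsto.comp hw).norm
  have h2 : Tendsto (fun n => ‖Φ (θ (s n))‖) atTop (𝓝 0) :=
    squeeze_zero (fun n => norm_nonneg _) (fun n => (hθΦ (s n)).le)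
      (tendsto_one_div_add_atTop_nhds_zero_nat.comp hs.tendsto_atTop)
  have h3 : Φ θ₀ = 0 := norm_eq_zero.1 (tendsto_nhds_unique h1 h2)
  obtain ⟨n, hn⟩ := (hw.eventually (h.rep.neighborhood θ₀ ⟨hθ₀, h3⟩)).exists
  exact hθs _ hn

theorem aemeasurable_map : AEMeasurable ϑ joint := by
  have hm : MeasurableSet (graphSet B Γ) := h.rep.compact.measurableSet
  rw [h.rep.joint_eq]
  exact (h.continuousOn_map.aemeasurable hm).mono_ac (withDensity_absolutelyContinuous _ _)

theorem isFiniteMeasure_joint : IsFiniteMeasure joint := by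
  have := h.finite_prior
  refine ⟨?_⟩
  have h1 := congrArg (fun μ => μ univ) h.rep.pushforward
  simp only [Measure.map_apply_of_aemeasurable h.aemeasurable_map MeasurableSet.univ,
    preimage_univ] at h1
  rw [h1]
  exact measure_lt_top _ _

theorem joint_compl : joint (graphSet B Γ)ᶜ = 0 := by
  have hm : MeasurableSet (graphSet B Γ) := h.rep.compact.measurableSet
  rw [h.rep.joint_eq]
  refine withDensity_absolutelyContinuous _ _ ?_
  rw [Measure.restrict_apply hm.compl]
  simp

theorem fst_compl : joint.fst Bᶜ = 0 := by
  rw [Measure.fst_apply h.isCompact_base.measurableSet.compl]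
  refine measure_mono_null (fun z hz => ?_) h.joint_compl
  exact fun hz' => hz hz'.1

theorem fst_restrict : joint.fst.restrict B = joint.fst :=
  Measure.restrict_eq_self_of_ae_mem (mem_ae_iff.2 h.fst_compl)

theorem prior_pos : 0 < π Set.univ := by
  have h1 := congrArg (fun μ => μ univ) h.rep.pushforward
  simp only [Measure.map_apply_of_aemeasurable h.aemeasurable_map MeasurableSet.univ,
    preimage_univ] at h1
  have h2 : 0 < joint univ := by
    have h3 := h.rep.marginal_pos
    rw [Measure.fst_apply h.isCompact_base.measurableSet] at h3
    exact h3.trans_le (measure_mono (subset_univ _))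
  rw [h1] at h2
  exact h2.trans_le (Measure.restrict_apply_le _ _)

end Geometry

end RegularModel

/-! ### Limits along asymptotically regular sequences -/

theorem half_sq_sub_sq_le {a b K : ℝ} (ha : 0 ≤ a) (h : a ≤ b + K) :
    1 / 2 * a ^ 2 - K ^ 2 ≤ b ^ 2 := by
  have h1 := pow_le_pow_left₀ ha h 2
  nlinarith [sq_nonneg (b - K)]

/-- The vectors `b j` are only bounded, so the statement concerns a difference. It rests on uniform
continuity of the form near a compact set of pairs. -/
theorem tendsto_quadForm_sub {m : ℕ} {A : ℕ → Matrix (Fin m) (Fin m) ℝ}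
    {A₀ : Matrix (Fin m) (Fin m) ℝ} (hA : ∀ i i', Tendsto (fun j => A j i i') atTop (𝓝 (A₀ i i')))
    {a b : ℕ → Fin m → ℝ} (hab : Tendsto (fun j => a j - b j) atTop (𝓝 0)) {K : ℝ}
    (hb : ∀ᶠ j in atTop, ‖b j‖ ≤ K) :
    Tendsto (fun j => quadForm (A j) (a j) - quadForm A₀ (b j)) atTop (𝓝 0) := by
  let F : (Fin m → Fin m → ℝ) × (Fin m → ℝ) → ℝ := fun z => quadForm (Matrix.of z.1) z.2
  have hF : Continuous F := by
    simp only [F, quadForm_eq_sum, Matrix.of_apply]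
    fun_prop
  have hK : IsCompact ({fun i i' => A₀ i i'} ×ˢ Metric.closedBall (0 : Fin m → ℝ) K :
      Set ((Fin m → Fin m → ℝ) × (Fin m → ℝ))) := isCompact_singleton.prod (isCompact_closedBall _ _)
  have hA' : Tendsto (fun j => (fun i i' => A j i i' : Fin m → Fin m → ℝ)) atTop
      (𝓝 fun i i' => A₀ i i') :=
    tendsto_pi_nhds.2 fun i => tendsto_pi_nhds.2 fun i' => hA i i'
  rw [Metric.tendsto_nhds]
  intro ε hε
  obtain ⟨δ, hδ, hsub⟩ := Metric.mem_uniformity_dist.1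
    (hK.uniformContinuousAt_of_continuousAt F (fun _ _ => hF.continuousAt)
      (Metric.dist_mem_uniformity hε))
  filter_upwards [Metric.tendsto_nhds.1 hA' δ hδ, Metric.tendsto_nhds.1 hab δ hδ, hb] with j h1 h2 h3
  have hd : dist ((fun i i' => A₀ i i', b j) : (Fin m → Fin m → ℝ) × (Fin m → ℝ))
      (fun i i' => A j i i', a j) < δ := by
    rw [Prod.dist_eq]
    refine max_lt (by rw [dist_comm]; exact h1) ?_
    rw [dist_comm, dist_eq_norm]
    simpa using h2
  have h4 : dist (F (fun i i' => A₀ i i', b j)) (F (fun i i' => A j i i', a j)) < ε :=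
    hsub hd ⟨rfl, by simpa using h3⟩
  rw [dist_comm, Real.dist_eq] at h4
  rw [Real.dist_eq, sub_zero]
  exact h4

theorem AsymptoticallyRegular.tendsto_inv_sqrt {p k : ℕ} {Θ : Set (Fin p → ℝ)}
    {Φ : (Fin p → ℝ) → Fin k → ℝ} {Sig : (Fin p → ℝ) → Matrix (Fin k) (Fin k) ℝ} {N : ℕ → ℕ}
    {g : ℕ → (Fin p → ℝ) → Fin k → ℝ} {V : ℕ → (Fin p → ℝ) → Matrix (Fin k) (Fin k) ℝ}
    (hreg : AsymptoticallyRegular Θ Φ Sig N g V) :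
    Tendsto (fun j => (√(N j : ℝ))⁻¹) atTop (𝓝 0) :=
  tendsto_inv_atTop_zero.comp (Real.tendsto_sqrt_atTop.comp
    (tendsto_natCast_atTop_atTop.comp hreg.tendsto))

namespace RegularModel

variable {p k q r : ℕ} {Θ : Set (Fin p → ℝ)} {Φ : (Fin p → ℝ) → Fin k → ℝ}
  {Sig : (Fin p → ℝ) → Matrix (Fin k) (Fin k) ℝ} {π : Measure (Fin p → ℝ)}
  {Θs : Set (Fin p → ℝ)} {B : Set (Fin q → ℝ)} {Γ : (Fin q → ℝ) → Set (Fin r → ℝ)}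
  {ϑ : (Fin q → ℝ) × (Fin r → ℝ) → Fin p → ℝ}
  {joint : Measure ((Fin q → ℝ) × (Fin r → ℝ))} {dens : (Fin q → ℝ) → (Fin r → ℝ) → ℝ}
  {D : (Fin q → ℝ) → Matrix (Fin k) (Fin r) ℝ}
  {N : ℕ → ℕ} {g : ℕ → (Fin p → ℝ) → Fin k → ℝ}
  {V : ℕ → (Fin p → ℝ) → Matrix (Fin k) (Fin k) ℝ}

theorem moment_zero_eq (h : RegularModel Θ Φ Sig π Θs B Γ ϑ joint dens D) {β : Fin q → ℝ}
    (hβ : β ∈ B) (j : ℕ) :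
    g j (ϑ (β, 0)) - √(N j : ℝ) • Φ (ϑ (β, 0)) = g j (ϑ (β, 0)) := by
  rw [h.mean_eq_zero hβ, smul_zero, sub_zero]

section Sequences

variable (h : RegularModel Θ Φ Sig π Θs B Γ ϑ joint dens D)
  (hreg : AsymptoticallyRegular Θ Φ Sig N g V)
include h hreg

theorem eventually_inv_close {ε : ℝ} (hε : 0 < ε) :
    ∀ᶠ j in atTop, ∀ θ ∈ Θ, ∀ i i', |(V j θ)⁻¹ i i' - (Sig θ)⁻¹ i i'| ≤ ε := by
  obtain ⟨δ, hδ, hδ'⟩ := exists_inv_close h.compact h.continuous_cov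
    (fun θ hθ => (h.posDef_cov θ hθ).det_pos.ne') hε
  filter_upwards [hreg.variance δ hδ] with j hj θ hθ
  exact hδ' θ hθ _ (hj θ hθ)

theorem exists_weight_lower_bound :
    ∃ l : ℝ, 0 < l ∧ (∀ θ ∈ Θ, ∀ v, l * ‖v‖ ^ 2 ≤ quadForm (Sig θ)⁻¹ v) ∧
      ∀ᶠ j in atTop, ∀ θ ∈ Θ, ∀ v, l * ‖v‖ ^ 2 ≤ quadForm (V j θ)⁻¹ v := by
  obtain ⟨l, hl, hl'⟩ := exists_quadForm_lower_bound h.compact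
    (continuousOn_matrix_inv h.continuous_cov fun θ hθ => (h.posDef_cov θ hθ).det_pos.ne')
    fun θ hθ => (h.posDef_cov θ hθ).inv
  refine ⟨l / 2, by positivity, fun θ hθ v => ?_, ?_⟩
  · nlinarith [hl' θ hθ v, sq_nonneg ‖v‖]
  -- An entrywise error `ε` changes the form by at most `k² ε ‖v‖²`; this `ε` loses at most half of
  -- `l`, without requiring `V j θ` to be symmetric.
  · have hε : 0 < l / (2 * ((k : ℝ) ^ 2 + 1)) := by positivity
    filter_upwards [h.eventually_inv_close hreg hε] with j hj θ hθ v
    have h1 := abs_quadForm_le (A := (V j θ)⁻¹ - (Sig θ)⁻¹) (hj θ hθ) v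
    rw [quadForm_sub] at h1
    have h2 := (abs_le.1 h1).1
    have h3 : (k : ℝ) ^ 2 * (l / (2 * ((k : ℝ) ^ 2 + 1))) ≤ l / 2 := by
      rw [mul_div_assoc', div_le_div_iff₀ (by positivity) (by positivity)]
      nlinarith [sq_nonneg (k : ℝ)]
    have h4 := mul_le_mul_of_nonneg_right h3 (sq_nonneg ‖v‖)
    linarith [hl' θ hθ v]

theorem tendsto_local_param {β : Fin q → ℝ} (hβ : β ∈ B) (u : Fin r → ℝ) :
    Tendsto (fun j => ϑ (β, (√(N j : ℝ))⁻¹ • u)) atTop (𝓝[Θ] (ϑ (β, 0))) := by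
  have h1 : Tendsto (fun j => (√(N j : ℝ))⁻¹ • u) atTop (𝓝 0) := by
    simpa using hreg.tendsto_inv_sqrt.smul_const u
  have h2 : ∀ᶠ j in atTop, (β, (√(N j : ℝ))⁻¹ • u) ∈ graphSet B Γ :=
    h1.eventually (h.eventually_mem_graphSet hβ)
  have h3 : Tendsto (fun j => (β, (√(N j : ℝ))⁻¹ • u)) atTop (𝓝[graphSet B Γ] (β, 0)) :=
    tendsto_nhdsWithin_iff.2 ⟨tendsto_const_nhds.prodMk_nhds h1, h2⟩
  exact tendsto_nhdsWithin_iff.2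
    ⟨(h.continuousOn_map _ (h.mem_graphSet_zero hβ)).tendsto.comp h3, h2.mono fun j hj => h.map_mem hj⟩

theorem tendsto_scaled_mean {β : Fin q → ℝ} (hβ : β ∈ B) (u : Fin r → ℝ) :
    Tendsto (fun j => √(N j : ℝ) • Φ (ϑ (β, (√(N j : ℝ))⁻¹ • u))) atTop (𝓝 (D β *ᵥ u)) := by
  have h1 : Tendsto (fun j => (√(N j : ℝ))⁻¹ • u) atTop (𝓝 0) := by
    simpa using hreg.tendsto_inv_sqrt.smul_const u
  have h2 : ∀ᶠ j in atTop, (β, (√(N j : ℝ))⁻¹ • u) ∈ graphSet B Γ :=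
    h1.eventually (h.eventually_mem_graphSet hβ)
  rw [Metric.tendsto_nhds]
  intro ε hε
  obtain ⟨δ, hδ, hδ'⟩ := h.unif_differentiable (ε / (‖u‖ + 1)) (by positivity)
  filter_upwards [h2, Metric.tendsto_nhds.1 h1 δ hδ, hreg.tendsto.eventually_gt_atTop 0]
    with j h3 h4 h5
  have hN : 0 < √(N j : ℝ) := Real.sqrt_pos.2 (by exact_mod_cast h5)
  have h6 := hδ' _ h3 (by simpa using h4)
  simp only [h.mean_eq_zero hβ, sub_zero, mulVec_smul] at h6
  have h7 : √(N j : ℝ) • Φ (ϑ (β, (√(N j : ℝ))⁻¹ • u)) - D β *ᵥ u =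
      √(N j : ℝ) • (Φ (ϑ (β, (√(N j : ℝ))⁻¹ • u)) - (√(N j : ℝ))⁻¹ • D β *ᵥ u) := by
    rw [smul_sub, smul_smul, mul_inv_cancel₀ hN.ne', one_smul]
  rw [dist_eq_norm, h7, norm_smul, Real.norm_of_nonneg hN.le]
  rw [norm_smul, norm_inv, Real.norm_of_nonneg hN.le] at h6
  calc √(N j : ℝ) * _ ≤ √(N j : ℝ) * (ε / (‖u‖ + 1) * ((√(N j : ℝ))⁻¹ * ‖u‖)) := by gcongr
    _ = ε / (‖u‖ + 1) * ‖u‖ := by field_simp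
    _ < ε := by
      rw [div_mul_eq_mul_div, div_lt_iff₀ (by positivity)]
      nlinarith [norm_nonneg u]

theorem exists_moment_zero_bound :
    ∃ K : ℝ, ∀ᶠ j in atTop, ∀ β ∈ B, ‖g j (ϑ (β, 0))‖ ≤ K := by
  obtain ⟨K, hK⟩ := hreg.bounded
  refine ⟨K, hK.mono fun j hj β hβ => ?_⟩
  rw [← h.moment_zero_eq (N := N) (g := g) hβ]
  exact hj _ (h.map_mem (h.mem_graphSet_zero hβ))

/-- Write the moment at `ϑ(β, u/√N)` as `√N Φ` plus its centered part. The first tends to `D β u` by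
differentiability; the second approaches `g j` at `ϑ(β, 0)` by equicontinuity, the centering being
zero there. -/
theorem tendsto_objective_sub {β : Fin q → ℝ} (hβ : β ∈ B) (u : Fin r → ℝ) :
    Tendsto (fun j => quadForm (V j (ϑ (β, (√(N j : ℝ))⁻¹ • u)))⁻¹
        (g j (ϑ (β, (√(N j : ℝ))⁻¹ • u))) -
      quadForm (Sig (ϑ (β, 0)))⁻¹ (D β *ᵥ u + g j (ϑ (β, 0)))) atTop (𝓝 0) := by
  have hθ := h.tendsto_local_param hreg hβ u
  have hθ₀ : ϑ (β, 0) ∈ Θ := h.map_mem (h.mem_graphSet_zero hβ)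
  obtain ⟨K, hK⟩ := h.exists_moment_zero_bound hreg
  refine tendsto_quadForm_sub (fun i i' => ?_) ?_ (K := ‖D β *ᵥ u‖ + K) ?_
  · have h1 : Tendsto (fun j => (Sig (ϑ (β, (√(N j : ℝ))⁻¹ • u)))⁻¹ i i') atTop
        (𝓝 ((Sig (ϑ (β, 0)))⁻¹ i i')) := by
      have h2 := (continuousOn_matrix_inv h.continuous_cov
        (fun θ hθ => (h.posDef_cov θ hθ).det_pos.ne') _ hθ₀).tendsto.comp hθ
      exact ((continuous_id.matrix_elem i i').tendsto _).comp h2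
    have h3 : Tendsto (fun j => (V j (ϑ (β, (√(N j : ℝ))⁻¹ • u)))⁻¹ i i' -
        (Sig (ϑ (β, (√(N j : ℝ))⁻¹ • u)))⁻¹ i i') atTop (𝓝 0) := by
      rw [Metric.tendsto_nhds]
      intro ε hε
      filter_upwards [h.eventually_inv_close hreg (half_pos hε),
        hθ.eventually self_mem_nhdsWithin] with j hj hj'
      rw [Real.dist_eq, sub_zero]
      linarith [hj _ hj' i i']
    simpa using h3.add h1
  · have h1 := h.tendsto_scaled_mean hreg hβ u
    have h2 : Tendsto (fun j => (g j (ϑ (β, (√(N j : ℝ))⁻¹ • u)) -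
        √(N j : ℝ) • Φ (ϑ (β, (√(N j : ℝ))⁻¹ • u))) - g j (ϑ (β, 0))) atTop (𝓝 0) := by
      rw [Metric.tendsto_nhds]
      intro ε hε
      obtain ⟨δ, hδ, hδ'⟩ := hreg.equicontinuous ε hε
      filter_upwards [hδ', hθ.eventually self_mem_nhdsWithin,
        (tendsto_nhdsWithin_iff.1 hθ).1.eventually (Metric.ball_mem_nhds _ hδ)] with j h3 h4 h5
      have h6 := h3 _ h4 _ hθ₀ h5
      rw [h.moment_zero_eq hβ] at h6
      simpa using h6
    have h3 := (h1.sub_const (D β *ᵥ u)).add h2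
    rw [sub_self, zero_add] at h3
    refine h3.congr fun j => ?_
    abel
  · filter_upwards [hK] with j hj
    exact (norm_add_le _ _).trans (by linarith [hj β hβ])

/-- The objective is eventually bounded below by a quadratic function of the local parameter. -/
theorem exists_objective_lower_bound :
    ∃ b C : ℝ, 0 < b ∧
      (∀ᶠ j in atTop, ∀ z ∈ graphSet B Γ,
        b * (√(N j : ℝ) * ‖z.2‖) ^ 2 - C ≤ quadForm (V j (ϑ z))⁻¹ (g j (ϑ z))) ∧
      (∀ᶠ j in atTop, ∀ β ∈ B, ∀ u,
        b * ‖u‖ ^ 2 - C ≤ quadForm (Sig (ϑ (β, 0)))⁻¹ (D β *ᵥ u + g j (ϑ (β, 0)))) ∧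
      (∀ᶠ j in atTop, ∀ θ ∈ Θ, θ ∉ Θs → b * N j - C ≤ quadForm (V j θ)⁻¹ (g j θ)) := by
  obtain ⟨l, hl, hl1, hl2⟩ := h.exists_weight_lower_bound hreg
  obtain ⟨K, hK⟩ := hreg.bounded
  obtain ⟨K', hK'⟩ := h.exists_moment_zero_bound hreg
  obtain ⟨c₁, hc₁, hc₁'⟩ := h.exists_mean_lower_bound
  obtain ⟨c₂, hc₂, hc₂'⟩ := h.exists_derivative_lower_bound
  obtain ⟨c₃, hc₃, hc₃'⟩ := h.exists_mean_lower_bound_compl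
  obtain ⟨c, hc, h1, h2, h3⟩ : ∃ c : ℝ, 0 < c ∧ c ≤ c₁ ∧ c ≤ c₂ ∧ c ≤ c₃ :=
    ⟨min c₁ (min c₂ c₃), by positivity, min_le_left _ _, (min_le_right _ _).trans (min_le_left _ _),
      (min_le_right _ _).trans (min_le_right _ _)⟩
  -- All three bounds have this form, with `t` equal to `√N ‖γ‖`, `‖u‖` or `√N`. Taking the smallest
  -- constant `c` and the sum `K² + K'²` makes one pair of constants serve them all.
  have key : ∀ {A : Matrix (Fin k) (Fin k) ℝ} {v : Fin k → ℝ} {t L : ℝ}, 0 ≤ t →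
      (∀ v, l * ‖v‖ ^ 2 ≤ quadForm A v) → c * t ≤ ‖v‖ + L → L ^ 2 ≤ K ^ 2 + K' ^ 2 →
      l * c ^ 2 / 2 * t ^ 2 - l * (K ^ 2 + K' ^ 2) ≤ quadForm A v := by
    intro A v t L ht hA hv hL
    have e1 := half_sq_sub_sq_le (mul_nonneg hc.le ht) hv
    have e2 := mul_le_mul_of_nonneg_left e1 hl.le
    have e3 := mul_le_mul_of_nonneg_left hL hl.le
    nlinarith [hA v]
  have hsplit : ∀ j θ, √(N j : ℝ) * ‖Φ θ‖ ≤ ‖g j θ‖ + ‖g j θ - √(N j : ℝ) • Φ θ‖ := by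
    intro j θ
    have := norm_sub_le (g j θ) (g j θ - √(N j : ℝ) • Φ θ)
    rwa [sub_sub_cancel, norm_smul, Real.norm_of_nonneg (Real.sqrt_nonneg _)] at this
  refine ⟨l * c ^ 2 / 2, l * (K ^ 2 + K' ^ 2), by positivity, ?_, ?_, ?_⟩
  · filter_upwards [hl2, hK] with j e1 e2 z hz
    refine key (L := K) (by positivity) (e1 _ (h.map_mem hz)) ?_ (by nlinarith [sq_nonneg K'])
    have e3 := mul_le_mul_of_nonneg_left ((mul_le_mul_of_nonneg_right h1 (norm_nonneg z.2)).trans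
      (hc₁' z hz)) (Real.sqrt_nonneg (N j : ℝ))
    linarith [hsplit j (ϑ z), e2 _ (h.map_mem hz)]
  · filter_upwards [hK'] with j e1 β hβ u
    refine key (L := K') (norm_nonneg u) (hl1 _ (h.map_mem (h.mem_graphSet_zero hβ))) ?_
      (by nlinarith [sq_nonneg K])
    have e2 := (mul_le_mul_of_nonneg_right h2 (norm_nonneg u)).trans (hc₂' β hβ u)
    have e3 := norm_sub_le (D β *ᵥ u + g j (ϑ (β, 0))) (g j (ϑ (β, 0)))
    rw [add_sub_cancel_right] at e3
    linarith [e1 β hβ]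
  · filter_upwards [hl2, hK] with j e1 e2 θ hθ hθs
    have e3 := key (v := g j θ) (t := √(N j : ℝ)) (L := K) (Real.sqrt_nonneg _) (e1 _ hθ) ?_
      (by nlinarith [sq_nonneg K'])
    · rwa [Real.sq_sqrt (Nat.cast_nonneg _)] at e3
    · have e4 := mul_le_mul_of_nonneg_left (h3.trans (hc₃' θ hθ hθs))
        (Real.sqrt_nonneg (N j : ℝ))
      linarith [hsplit j θ, e2 _ hθ]

theorem eventually_objective_nonneg :
    ∀ᶠ j in atTop, ∀ θ ∈ Θ, 0 ≤ quadForm (V j θ)⁻¹ (g j θ) := by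
  obtain ⟨l, hl, -, hl2⟩ := h.exists_weight_lower_bound hreg
  filter_upwards [hl2] with j hj θ hθ
  exact (by positivity : (0 : ℝ) ≤ l * ‖g j θ‖ ^ 2).trans (hj θ hθ _)

end Sequences

end RegularModel

/-- The integrand of the quasi-posterior in the coordinates `(β, γ)`. -/
def localIntegrand {p q r : ℕ} (B : Set (Fin q → ℝ)) (Γ : (Fin q → ℝ) → Set (Fin r → ℝ))
    (ϑ : (Fin q → ℝ) × (Fin r → ℝ) → Fin p → ℝ) (dens : (Fin q → ℝ) → (Fin r → ℝ) → ℝ)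
    (c Q : (Fin p → ℝ) → ℝ) : (Fin q → ℝ) × (Fin r → ℝ) → ℝ :=
  (graphSet B Γ).indicator fun z => dens z.1 z.2 * (c (ϑ z) * Real.exp (-(1 / 2) * Q (ϑ z)))

/-- The adjusted prior, for a general variance function. -/
def limitPrior {p k q r : ℕ} (Sig : (Fin p → ℝ) → Matrix (Fin k) (Fin k) ℝ)
    (B : Set (Fin q → ℝ)) (ϑ : (Fin q → ℝ) × (Fin r → ℝ) → Fin p → ℝ)
    (joint : Measure ((Fin q → ℝ) × (Fin r → ℝ))) (dens : (Fin q → ℝ) → (Fin r → ℝ) → ℝ)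
    (D : (Fin q → ℝ) → Matrix (Fin k) (Fin r) ℝ) : Measure (Fin q → ℝ) :=
  (joint.fst.restrict B).withDensity fun β => ENNReal.ofReal
    (dens β 0 * (infoMatrix (Sig (ϑ (β, 0))) (D β)).det ^ (-(1 / 2) : ℝ))

/-- The reduced objective, for a general variance function. -/
def limitObjective {p k q r : ℕ} (Sig : (Fin p → ℝ) → Matrix (Fin k) (Fin k) ℝ)
    (ϑ : (Fin q → ℝ) × (Fin r → ℝ) → Fin p → ℝ)
    (D : (Fin q → ℝ) → Matrix (Fin k) (Fin r) ℝ) (g : (Fin p → ℝ) → Fin k → ℝ)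
    (β : Fin q → ℝ) : ℝ :=
  quadForm (reducedWeight (Sig (ϑ (β, 0))) (D β)) (g (ϑ (β, 0)))

theorem abs_exp_sub_exp_le {a b : ℝ} (ha : 0 ≤ a) (hb : 0 ≤ b) :
    |Real.exp (-(1 / 2) * a) - Real.exp (-(1 / 2) * b)| ≤ |a - b| := by
  have key : ∀ {a b : ℝ}, 0 ≤ a → a ≤ b →
      |Real.exp (-(1 / 2) * a) - Real.exp (-(1 / 2) * b)| ≤ |a - b| := by
    intro a b ha hab
    have h1 : Real.exp (-(1 / 2) * b) ≤ Real.exp (-(1 / 2) * a) :=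
      Real.exp_le_exp.2 (by linarith)
    have h2 : Real.exp (-(1 / 2) * a) ≤ 1 := Real.exp_le_one_iff.2 (by linarith)
    have h3 : Real.exp (-(1 / 2) * b) =
        Real.exp (-(1 / 2) * a) * Real.exp (-(1 / 2) * (b - a)) := by
      rw [← Real.exp_add]; ring_nf
    have h4 := Real.add_one_le_exp (-(1 / 2) * (b - a))
    have h5 : Real.exp (-(1 / 2) * (b - a)) ≤ 1 := Real.exp_le_one_iff.2 (by linarith)
    rw [abs_of_nonneg (by linarith), abs_of_nonpos (by linarith), h3]
    have h6 := Real.exp_pos (-(1 / 2) * a)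
    nlinarith
  rcases le_total a b with hab | hab
  · exact key ha hab
  · rw [abs_sub_comm, abs_sub_comm a]
    exact key hb hab

/-! ### Integrals in local coordinates and the limit measure on `B` -/

namespace RegularModel

variable {p k q r : ℕ} {Θ : Set (Fin p → ℝ)} {Φ : (Fin p → ℝ) → Fin k → ℝ}
  {Sig : (Fin p → ℝ) → Matrix (Fin k) (Fin k) ℝ} {π : Measure (Fin p → ℝ)}
  {Θs : Set (Fin p → ℝ)} {B : Set (Fin q → ℝ)} {Γ : (Fin q → ℝ) → Set (Fin r → ℝ)}
  {ϑ : (Fin q → ℝ) × (Fin r → ℝ) → Fin p → ℝ}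
  {joint : Measure ((Fin q → ℝ) × (Fin r → ℝ))} {dens : (Fin q → ℝ) → (Fin r → ℝ) → ℝ}
  {D : (Fin q → ℝ) → Matrix (Fin k) (Fin r) ℝ}
  {N : ℕ → ℕ} {g : ℕ → (Fin p → ℝ) → Fin k → ℝ}
  {V : ℕ → (Fin p → ℝ) → Matrix (Fin k) (Fin k) ℝ}

theorem measurable_localIntegrand (h : RegularModel Θ Φ Sig π Θs B Γ ϑ joint dens D)
    {c Q : (Fin p → ℝ) → ℝ} (hc : Measurable c) (hQ : Measurable Q) :
    Measurable (localIntegrand B Γ ϑ dens c Q) := by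
  classical
  have hm : MeasurableSet (graphSet B Γ) := h.rep.compact.measurableSet
  -- `ϑ` is only controlled on the compact graph; extending it by `0` gives a measurable map with
  -- the same integrand.
  have hϑ : Measurable ((graphSet B Γ).piecewise ϑ 0) :=
    h.continuousOn_map.measurable_piecewise continuousOn_const hm
  have heq : localIntegrand B Γ ϑ dens c Q = (graphSet B Γ).indicator fun z =>
      dens z.1 z.2 * (c ((graphSet B Γ).piecewise ϑ 0 z) *
        Real.exp (-(1 / 2) * Q ((graphSet B Γ).piecewise ϑ 0 z))) :=
    indicator_congr fun z hz => by rw [piecewise_eq_of_mem _ _ _ hz]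
  rw [heq]
  exact (h.rep.measurable_dens.mul ((hc.comp hϑ).mul
    ((hQ.comp hϑ).const_mul _).exp)).indicator hm

theorem setIntegral_eq_integral_localIntegrand
    (h : RegularModel Θ Φ Sig π Θs B Γ ϑ joint dens D)
    {c Q : (Fin p → ℝ) → ℝ} (hc : Measurable c) (hQ : Measurable Q) :
    ∫ θ in Θs, c θ * Real.exp (-(1 / 2) * Q θ) ∂π =
      ∫ z, localIntegrand B Γ ϑ dens c Q z ∂(joint.fst.prod volume) := by
  have := h.isFiniteMeasure_joint
  have hm : MeasurableSet (graphSet B Γ) := h.rep.compact.measurableSet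
  have hF : Measurable fun θ => c θ * Real.exp (-(1 / 2) * Q θ) := hc.mul (hQ.const_mul _).exp
  rw [← h.rep.pushforward, integral_map h.aemeasurable_map hF.aestronglyMeasurable]
  conv_lhs => rw [h.rep.joint_eq]
  rw [integral_withDensity_eq_integral_toReal_smul₀
    h.rep.measurable_dens.ennreal_ofReal.aemeasurable
    (Eventually.of_forall fun z => ENNReal.ofReal_lt_top), localIntegrand, integral_indicator hm]
  refine setIntegral_congr_fun hm fun z hz => ?_
  obtain ⟨C, hC⟩ := h.rep.dens_bounded
  simp only [ENNReal.toReal_ofReal (hC z hz).1, smul_eq_mul]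

theorem integrable_localIntegrand (h : RegularModel Θ Φ Sig π Θs B Γ ϑ joint dens D)
    {c Q : (Fin p → ℝ) → ℝ} (hc : Measurable c) (hQ : Measurable Q) {C : ℝ}
    (hC : ∀ θ ∈ Θ, |c θ| ≤ C) (hQ0 : ∀ θ ∈ Θ, 0 ≤ Q θ) :
    Integrable (localIntegrand B Γ ϑ dens c Q) (joint.fst.prod volume) := by
  have := h.isFiniteMeasure_joint
  obtain ⟨Cd, hCd⟩ := h.rep.dens_bounded
  have hm : MeasurableSet (graphSet B Γ) := h.rep.compact.measurableSet
  have hfin : (joint.fst.prod volume) (graphSet B Γ) < ⊤ := h.rep.compact.measure_lt_top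
  refine Integrable.mono' (g := (graphSet B Γ).indicator fun _ => Cd * C)
    ((integrable_indicator_iff hm).2 (integrableOn_const hfin.ne))
    (h.measurable_localIntegrand hc hQ).aestronglyMeasurable (Eventually.of_forall fun z => ?_)
  by_cases hz : z ∈ graphSet B Γ
  · rw [localIntegrand, indicator_of_mem hz, indicator_of_mem hz, norm_mul, norm_mul,
      Real.norm_of_nonneg (hCd z hz).1, Real.norm_of_nonneg (Real.exp_pos _).le]
    have e1 : Real.exp (-(1 / 2) * Q (ϑ z)) ≤ 1 :=
      Real.exp_le_one_iff.2 (by linarith [hQ0 _ (h.map_mem hz)])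
    have e2 : ‖c (ϑ z)‖ ≤ C := hC _ (h.map_mem hz)
    have e3 : ‖c (ϑ z)‖ * Real.exp (-(1 / 2) * Q (ϑ z)) ≤ C := by
      nlinarith [norm_nonneg (c (ϑ z)), Real.exp_pos (-(1 / 2) * Q (ϑ z))]
    have e4 := (hCd z hz).1
    exact mul_le_mul (hCd z hz).2 e3 (by positivity) (e4.trans (hCd z hz).2)
  · rw [localIntegrand, indicator_of_notMem hz, indicator_of_notMem hz, norm_zero]

theorem limitObjective_nonneg (h : RegularModel Θ Φ Sig π Θs B Γ ϑ joint dens D)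
    (g : (Fin p → ℝ) → Fin k → ℝ) {β : Fin q → ℝ} (hβ : β ∈ B) :
    0 ≤ limitObjective Sig ϑ D g β :=
  quadForm_reducedWeight_nonneg (h.posDef_cov _ (h.map_mem (h.mem_graphSet_zero hβ)))
    (h.posDef_info β hβ) _

/-- Translation invariance removes the shift left by completing the square. This is the source of
the factor `|J|^{-1/2}` in the adjusted prior. -/
theorem integral_local_limit (h : RegularModel Θ Φ Sig π Θs B Γ ϑ joint dens D)
    (g : (Fin p → ℝ) → Fin k → ℝ) {β : Fin q → ℝ} (hβ : β ∈ B) (a : ℝ) :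
    ∫ u, a * Real.exp (-(1 / 2) *
        quadForm (Sig (ϑ (β, 0)))⁻¹ (D β *ᵥ u + g (ϑ (β, 0)))) =
      a * Real.exp (-(1 / 2) * limitObjective Sig ϑ D g β) *
        (√(2 * Real.pi) ^ r * (infoMatrix (Sig (ϑ (β, 0))) (D β)).det ^ (-(1 / 2) : ℝ)) := by
  have hS := h.posDef_cov _ (h.map_mem (h.mem_graphSet_zero hβ))
  have hsymm : (Sig (ϑ (β, 0)))ᵀ = Sig (ϑ (β, 0)) := by simpa using hS.isHermitian.eq
  have hJ := h.posDef_info β hβ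
  simp only [quadForm_complete_square hsymm hJ.det_pos.ne', mul_add, Real.exp_add,
    limitObjective]
  rw [integral_const_mul, integral_mul_const, integral_exp_neg_half_quadForm hJ]
  ring

theorem aemeasurable_limitObjective (h : RegularModel Θ Φ Sig π Θs B Γ ϑ joint dens D)
    {g : (Fin p → ℝ) → Fin k → ℝ} (hg : Measurable g) :
    AEMeasurable (limitObjective Sig ϑ D g) (joint.fst.restrict B) := by
  have hB := h.isCompact_base.measurableSet
  refine aemeasurable_quadForm (fun i i' => ?_)
    (hg.comp_aemeasurable (h.continuousOn_map_zero.aemeasurable hB))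
  exact ((continuous_id.matrix_elem i i').comp_continuousOn
    h.continuousOn_reducedWeight).aemeasurable hB

theorem aemeasurable_adjustment (h : RegularModel Θ Φ Sig π Θs B Γ ϑ joint dens D) :
    AEMeasurable (fun β => dens β 0 *
      (infoMatrix (Sig (ϑ (β, 0))) (D β)).det ^ (-(1 / 2) : ℝ)) (joint.fst.restrict B) := by
  have hB := h.isCompact_base.measurableSet
  have h1 : Measurable fun β : Fin q → ℝ => dens β 0 :=
    h.rep.measurable_dens.comp (measurable_id.prodMk measurable_const)
  have h2 : ContinuousOn (fun β => (infoMatrix (Sig (ϑ (β, 0))) (D β)).det) B :=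
    continuous_id.matrix_det.comp_continuousOn h.continuousOn_infoMatrix
  exact h1.aemeasurable.mul ((h2.aemeasurable hB).pow_const _)

theorem exists_adjustment_bound (h : RegularModel Θ Φ Sig π Θs B Γ ϑ joint dens D) :
    ∃ C : ℝ, ∀ β ∈ B, 0 < dens β 0 * (infoMatrix (Sig (ϑ (β, 0))) (D β)).det ^ (-(1 / 2) : ℝ) ∧
      dens β 0 * (infoMatrix (Sig (ϑ (β, 0))) (D β)).det ^ (-(1 / 2) : ℝ) ≤ C := by
  obtain ⟨Cd, hCd⟩ := h.rep.dens_bounded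
  have h2 : ContinuousOn (fun β => (infoMatrix (Sig (ϑ (β, 0))) (D β)).det ^ (-(1 / 2) : ℝ)) B :=
    ContinuousOn.rpow_const (continuous_id.matrix_det.comp_continuousOn h.continuousOn_infoMatrix)
      fun β hβ => Or.inl (h.posDef_info β hβ).det_pos.ne'
  obtain ⟨Cj, hCj⟩ := h.isCompact_base.exists_bound_of_continuousOn h2
  refine ⟨Cd * Cj, fun β hβ => ?_⟩
  have h3 := Real.rpow_pos_of_pos (h.posDef_info β hβ).det_pos (-(1 / 2) : ℝ)
  have h4 := hCj β hβ
  rw [Real.norm_of_nonneg h3.le] at h4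
  have h5 := h.rep.dens_pos β hβ
  have h6 := (hCd _ (h.mem_graphSet_zero hβ)).2
  exact ⟨mul_pos h5 h3, mul_le_mul h6 h4 h3.le (h5.le.trans h6)⟩

theorem integral_limitPrior (h : RegularModel Θ Φ Sig π Θs B Γ ϑ joint dens D)
    (F : (Fin q → ℝ) → ℝ) :
    ∫ β, F β ∂(limitPrior Sig B ϑ joint dens D) = ∫ β in B, dens β 0 *
      (infoMatrix (Sig (ϑ (β, 0))) (D β)).det ^ (-(1 / 2) : ℝ) * F β ∂joint.fst := by
  have hB := h.isCompact_base.measurableSet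
  rw [limitPrior, integral_withDensity_eq_integral_toReal_smul₀
    h.aemeasurable_adjustment.ennreal_ofReal
    (Eventually.of_forall fun z => ENNReal.ofReal_lt_top)]
  obtain ⟨C, hC⟩ := h.exists_adjustment_bound
  refine setIntegral_congr_fun hB fun β hβ => ?_
  simp only [ENNReal.toReal_ofReal (hC β hβ).1.le, smul_eq_mul]

theorem isFiniteMeasure_limitPrior (h : RegularModel Θ Φ Sig π Θs B Γ ϑ joint dens D) :
    IsFiniteMeasure (limitPrior Sig B ϑ joint dens D) := by
  have := h.isFiniteMeasure_joint
  have hB := h.isCompact_base.measurableSet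
  obtain ⟨C, hC⟩ := h.exists_adjustment_bound
  refine isFiniteMeasure_withDensity_ofReal
    (Integrable.of_bound h.aemeasurable_adjustment.aestronglyMeasurable C ?_).2
  filter_upwards [ae_restrict_mem hB] with β hβ
  rw [Real.norm_of_nonneg (hC β hβ).1.le]
  exact (hC β hβ).2

/-- The density is positive at each point of `B`, a set of positive marginal mass; no uniform lower
bound is needed. -/
theorem limitPrior_pos (h : RegularModel Θ Φ Sig π Θs B Γ ϑ joint dens D) :
    0 < limitPrior Sig B ϑ joint dens D univ := by
  have hB := h.isCompact_base.measurableSet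
  obtain ⟨C, hC⟩ := h.exists_adjustment_bound
  rw [pos_iff_ne_zero, limitPrior, Ne, withDensity_apply_eq_zero' h.aemeasurable_adjustment.ennreal_ofReal,
    inter_univ]
  refine ne_of_gt (h.rep.marginal_pos.trans_le ?_)
  rw [Measure.restrict_apply' hB]
  refine measure_mono fun β hβ => ⟨?_, hβ⟩
  exact (ENNReal.ofReal_pos.2 (hC β hβ).1).ne'

theorem ae_limitPrior_mem (h : RegularModel Θ Φ Sig π Θs B Γ ϑ joint dens D) :
    ∀ᵐ β ∂(limitPrior Sig B ϑ joint dens D), β ∈ B :=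
  (withDensity_absolutelyContinuous _ _).ae_le (ae_restrict_mem h.isCompact_base.measurableSet)

theorem integrable_exp_limitObjective (h : RegularModel Θ Φ Sig π Θs B Γ ϑ joint dens D)
    {g : (Fin p → ℝ) → Fin k → ℝ} (hg : Measurable g) :
    Integrable (fun β => Real.exp (-(1 / 2) * limitObjective Sig ϑ D g β))
      (limitPrior Sig B ϑ joint dens D) := by
  have := h.isFiniteMeasure_limitPrior
  refine Integrable.of_bound (((h.aemeasurable_limitObjective hg).const_mul
    _).exp.mono_ac (withDensity_absolutelyContinuous _ _)).aestronglyMeasurable 1 ?_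
  filter_upwards [h.ae_limitPrior_mem] with β hβ
  rw [Real.norm_of_nonneg (Real.exp_pos _).le]
  exact Real.exp_le_one_iff.2 (by linarith [h.limitObjective_nonneg g hβ])

end RegularModel

/-! ### Laplace approximation by dominated convergence -/

namespace RegularModel

variable {p k q r : ℕ} {Θ : Set (Fin p → ℝ)} {Φ : (Fin p → ℝ) → Fin k → ℝ}
  {Sig : (Fin p → ℝ) → Matrix (Fin k) (Fin k) ℝ} {π : Measure (Fin p → ℝ)}
  {Θs : Set (Fin p → ℝ)} {B : Set (Fin q → ℝ)} {Γ : (Fin q → ℝ) → Set (Fin r → ℝ)}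
  {ϑ : (Fin q → ℝ) × (Fin r → ℝ) → Fin p → ℝ}
  {joint : Measure ((Fin q → ℝ) × (Fin r → ℝ))} {dens : (Fin q → ℝ) → (Fin r → ℝ) → ℝ}
  {D : (Fin q → ℝ) → Matrix (Fin k) (Fin r) ℝ}
  {N : ℕ → ℕ} {g : ℕ → (Fin p → ℝ) → Fin k → ℝ}
  {V : ℕ → (Fin p → ℝ) → Matrix (Fin k) (Fin k) ℝ}

/-- Gaussian domination of the local integrands and of their limits. -/
theorem exists_localIntegrand_bound (h : RegularModel Θ Φ Sig π Θs B Γ ϑ joint dens D)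
    (hreg : AsymptoticallyRegular Θ Φ Sig N g V) (C : ℝ) :
    ∃ b A : ℝ, 0 < b ∧ ∀ᶠ j in atTop, ∀ c : (Fin p → ℝ) → ℝ, (∀ θ ∈ Θ, |c θ| ≤ C) →
      (∀ β u, |localIntegrand B Γ ϑ dens c (fun θ => quadForm (V j θ)⁻¹ (g j θ))
        (β, (√(N j : ℝ))⁻¹ • u)| ≤ A * Real.exp (-b * ‖u‖ ^ 2)) ∧
      ∀ β ∈ B, ∀ u, ∀ a : ℝ, |a| ≤ C → |a * dens β 0 * Real.exp (-(1 / 2) *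
        quadForm (Sig (ϑ (β, 0)))⁻¹ (D β *ᵥ u + g j (ϑ (β, 0))))| ≤
          A * Real.exp (-b * ‖u‖ ^ 2) := by
  obtain ⟨b, K, hb, h1, h2, -⟩ := h.exists_objective_lower_bound hreg
  obtain ⟨Cd, hCd⟩ := h.rep.dens_bounded
  -- The factor `1/2` in the exponent turns the lower bound `b t² - K` on the objective into `exp (K
  -- / 2) * exp (-(b / 2) t²)`.
  refine ⟨b / 2, |Cd| * (|C| * Real.exp (K / 2)), by positivity, ?_⟩
  have key : ∀ {d c x t : ℝ}, 0 ≤ d → d ≤ Cd → |c| ≤ C → b * t ^ 2 - K ≤ x →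
      |d * (c * Real.exp (-(1 / 2) * x))| ≤
        |Cd| * (|C| * Real.exp (K / 2)) * Real.exp (-(b / 2) * t ^ 2) := by
    intro d c x t hd hdC hc hx
    have e1 : Real.exp (-(1 / 2) * x) ≤ Real.exp (K / 2) * Real.exp (-(b / 2) * t ^ 2) := by
      rw [← Real.exp_add]
      exact Real.exp_le_exp.2 (by linarith)
    rw [abs_mul, abs_mul, abs_of_nonneg hd, abs_of_pos (Real.exp_pos _)]
    calc d * (|c| * Real.exp (-(1 / 2) * x))
        ≤ |Cd| * (|C| * (Real.exp (K / 2) * Real.exp (-(b / 2) * t ^ 2))) := by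
          exact mul_le_mul (hdC.trans (le_abs_self _))
            (mul_le_mul (hc.trans (le_abs_self _)) e1 (Real.exp_pos _).le (abs_nonneg _))
            (by positivity) (abs_nonneg _)
      _ = _ := by ring
  filter_upwards [h1, h2, hreg.tendsto.eventually_gt_atTop 0] with j e1 e2 e3 c hc
  have hN : 0 < √(N j : ℝ) := Real.sqrt_pos.2 (by exact_mod_cast e3)
  refine ⟨fun β u => ?_, fun β hβ u a ha => ?_⟩
  · by_cases hz : (β, (√(N j : ℝ))⁻¹ • u) ∈ graphSet B Γ
    · rw [localIntegrand, indicator_of_mem hz]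
      have e4 := e1 _ hz
      have e5 : √(N j : ℝ) * ‖(√(N j : ℝ))⁻¹ • u‖ = ‖u‖ := by
        rw [norm_smul, norm_inv, Real.norm_of_nonneg hN.le, mul_inv_cancel_left₀ hN.ne']
      simp only [e5] at e4
      exact key (hCd _ hz).1 (hCd _ hz).2 (hc _ (h.map_mem hz)) e4
    · rw [localIntegrand, indicator_of_notMem hz, abs_zero]
      positivity
  · rw [mul_comm a, mul_assoc]
    have hz := h.mem_graphSet_zero hβ
    exact key (hCd _ hz).1 (hCd _ hz).2 ha (e2 β hβ u)

/-- Neither term need converge. The difference is split into a change of the prefactor, multiplied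
by an exponential at most `1`, and a fixed prefactor times a difference of exponentials, controlled
by the difference of the objectives. -/
theorem tendsto_localIntegrand_sub (h : RegularModel Θ Φ Sig π Θs B Γ ϑ joint dens D)
    (hreg : AsymptoticallyRegular Θ Φ Sig N g V) {c : ℕ → (Fin p → ℝ) → ℝ}
    {β : Fin q → ℝ} (hβ : β ∈ B) {c₀ : ℝ} {u : Fin r → ℝ}
    (hlim : Tendsto (fun j => c j (ϑ (β, (√(N j : ℝ))⁻¹ • u))) atTop (𝓝 c₀)) :
    Tendsto (fun j => localIntegrand B Γ ϑ dens (c j) (fun θ => quadForm (V j θ)⁻¹ (g j θ))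
        (β, (√(N j : ℝ))⁻¹ • u) - c₀ * dens β 0 * Real.exp (-(1 / 2) *
          quadForm (Sig (ϑ (β, 0)))⁻¹ (D β *ᵥ u + g j (ϑ (β, 0))))) atTop (𝓝 0) := by
  have hu : Tendsto (fun j => (√(N j : ℝ))⁻¹ • u) atTop (𝓝 0) := by
    simpa using hreg.tendsto_inv_sqrt.smul_const u
  have hmem : ∀ᶠ j in atTop, (β, (√(N j : ℝ))⁻¹ • u) ∈ graphSet B Γ :=
    hu.eventually (h.eventually_mem_graphSet hβ)
  have hθ₀ : ϑ (β, 0) ∈ Θ := h.map_mem (h.mem_graphSet_zero hβ)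
  have hdens : Tendsto (fun j => dens β ((√(N j : ℝ))⁻¹ • u)) atTop (𝓝 (dens β 0)) := by
    rw [Metric.tendsto_nhds]
    intro ε hε
    obtain ⟨δ, hδ, hδ'⟩ := h.rep.dens_unif_cont ε hε
    filter_upwards [hmem, Metric.tendsto_nhds.1 hu δ hδ] with j h1 h2
    exact hδ' _ h1 (by simpa using h2)
  set E₁ : ℕ → ℝ := fun j => Real.exp (-(1 / 2) *
    quadForm (V j (ϑ (β, (√(N j : ℝ))⁻¹ • u)))⁻¹ (g j (ϑ (β, (√(N j : ℝ))⁻¹ • u)))) with hE₁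
  set E₂ : ℕ → ℝ := fun j => Real.exp (-(1 / 2) *
    quadForm (Sig (ϑ (β, 0)))⁻¹ (D β *ᵥ u + g j (ϑ (β, 0)))) with hE₂
  have hnn : ∀ᶠ j in atTop,
      0 ≤ quadForm (V j (ϑ (β, (√(N j : ℝ))⁻¹ • u)))⁻¹ (g j (ϑ (β, (√(N j : ℝ))⁻¹ • u))) := by
    filter_upwards [hmem, h.eventually_objective_nonneg hreg] with j h1 h2
    exact h2 _ (h.map_mem h1)
  have hE : Tendsto (fun j => E₁ j - E₂ j) atTop (𝓝 0) := by
    refine squeeze_zero_norm' ?_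
      (by simpa using (h.tendsto_objective_sub hreg hβ u).abs)
    filter_upwards [hnn] with j h1
    exact abs_exp_sub_exp_le h1 (quadForm_nonneg (h.posDef_cov _ hθ₀).inv.posSemidef _)
  have hprod : Tendsto (fun j => dens β ((√(N j : ℝ))⁻¹ • u) *
      c j (ϑ (β, (√(N j : ℝ))⁻¹ • u)) - dens β 0 * c₀) atTop (𝓝 0) := by
    simpa using (hdens.mul hlim).sub_const (dens β 0 * c₀)
  have h1 : Tendsto (fun j => (dens β ((√(N j : ℝ))⁻¹ • u) *
      c j (ϑ (β, (√(N j : ℝ))⁻¹ • u)) - dens β 0 * c₀) * E₁ j) atTop (𝓝 0) := by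
    refine squeeze_zero_norm' ?_ (by simpa using hprod.abs)
    filter_upwards [hnn] with j h1
    rw [norm_mul, Real.norm_of_nonneg (Real.exp_pos _).le]
    exact mul_le_of_le_one_right (norm_nonneg _) (Real.exp_le_one_iff.2 (by linarith))
  have h2 := h1.add (hE.const_mul (dens β 0 * c₀))
  rw [mul_zero, add_zero] at h2
  refine h2.congr' ?_
  filter_upwards [hmem] with j hj
  rw [localIntegrand, indicator_of_mem hj]
  simp only [hE₁, hE₂]
  ring

theorem tendsto_inner_integral_sub (h : RegularModel Θ Φ Sig π Θs B Γ ϑ joint dens D)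
    (hreg : AsymptoticallyRegular Θ Φ Sig N g V) (hg : ∀ j, Measurable (g j))
    (hV : ∀ j i i', Measurable fun θ => V j θ i i') {c : ℕ → (Fin p → ℝ) → ℝ}
    (hc : ∀ j, Measurable (c j)) {C : ℝ} (hC : ∀ j, ∀ θ ∈ Θ, |c j θ| ≤ C) {β : Fin q → ℝ}
    (hβ : β ∈ B) {c₀ : ℝ} (hc₀ : |c₀| ≤ C)
    (hlim : ∀ u, Tendsto (fun j => c j (ϑ (β, (√(N j : ℝ))⁻¹ • u))) atTop (𝓝 c₀)) :
    Tendsto (fun j => (∫ u, localIntegrand B Γ ϑ dens (c j)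
        (fun θ => quadForm (V j θ)⁻¹ (g j θ)) (β, (√(N j : ℝ))⁻¹ • u)) -
      c₀ * dens β 0 * Real.exp (-(1 / 2) * limitObjective Sig ϑ D (g j) β) *
        (√(2 * Real.pi) ^ r * (infoMatrix (Sig (ϑ (β, 0))) (D β)).det ^ (-(1 / 2) : ℝ)))
      atTop (𝓝 0) := by
  obtain ⟨b, A, hb, hbd⟩ := h.exists_localIntegrand_bound hreg C
  have hI := (integrable_exp_neg_mul_norm_sq r hb).const_mul A
  have hm1 : ∀ j, Measurable fun u : Fin r → ℝ => localIntegrand B Γ ϑ dens (c j)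
      (fun θ => quadForm (V j θ)⁻¹ (g j θ)) (β, (√(N j : ℝ))⁻¹ • u) := fun j =>
    (h.measurable_localIntegrand (hc j) (measurable_quadForm (measurable_matrix_inv (hV j))
      (hg j))).comp (by fun_prop)
  have hm2 : ∀ j, Measurable fun u : Fin r → ℝ => c₀ * dens β 0 * Real.exp (-(1 / 2) *
      quadForm (Sig (ϑ (β, 0)))⁻¹ (D β *ᵥ u + g j (ϑ (β, 0)))) := fun j => by
    have : Continuous fun u : Fin r → ℝ => D β *ᵥ u + g j (ϑ (β, 0)) := by fun_prop
    have hQ : Measurable fun u : Fin r → ℝ =>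
        quadForm (Sig (ϑ (β, 0)))⁻¹ (D β *ᵥ u + g j (ϑ (β, 0))) :=
      measurable_quadForm (A := fun _ => (Sig (ϑ (β, 0)))⁻¹) (fun _ _ => measurable_const)
        this.measurable
    exact (hQ.const_mul (-(1 / 2))).exp.const_mul (c₀ * dens β 0)
  have key := tendsto_integral_filter_of_dominated_convergence
    (μ := (volume : Measure (Fin r → ℝ))) (f := fun _ => (0 : ℝ)) (l := atTop)
    (F := fun j u => localIntegrand B Γ ϑ dens (c j)
      (fun θ => quadForm (V j θ)⁻¹ (g j θ)) (β, (√(N j : ℝ))⁻¹ • u) -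
      c₀ * dens β 0 * Real.exp (-(1 / 2) *
        quadForm (Sig (ϑ (β, 0)))⁻¹ (D β *ᵥ u + g j (ϑ (β, 0)))))
    (fun u => A * Real.exp (-b * ‖u‖ ^ 2) + A * Real.exp (-b * ‖u‖ ^ 2))
    (Eventually.of_forall fun j => ((hm1 j).sub (hm2 j)).aestronglyMeasurable)
    (hbd.mono fun j hj => Eventually.of_forall fun u => (norm_sub_le _ _).trans
      (add_le_add ((hj (c j) (hC j)).1 β u) ((hj (c j) (hC j)).2 β hβ u c₀ hc₀)))
    (hI.add hI)
    (Eventually.of_forall fun u => h.tendsto_localIntegrand_sub hreg hβ (hlim u))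
  rw [integral_zero] at key
  refine key.congr' ?_
  filter_upwards [hbd] with j hj
  rw [integral_sub, h.integral_local_limit (g j) hβ]
  · exact hI.mono' (hm1 j).aestronglyMeasurable
      (Eventually.of_forall fun u => (hj (c j) (hC j)).1 β u)
  · exact hI.mono' (hm2 j).aestronglyMeasurable
      (Eventually.of_forall fun u => (hj (c j) (hC j)).2 β hβ u c₀ hc₀)

/-- The rescaled integral over the neighbourhood `Θs` of the identified set. -/
theorem tendsto_setIntegral_sub (h : RegularModel Θ Φ Sig π Θs B Γ ϑ joint dens D)
    (hreg : AsymptoticallyRegular Θ Φ Sig N g V) (hg : ∀ j, Measurable (g j))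
    (hV : ∀ j i i', Measurable fun θ => V j θ i i') {c : ℕ → (Fin p → ℝ) → ℝ}
    (hc : ∀ j, Measurable (c j)) {C : ℝ} (hC : ∀ j, ∀ θ ∈ Θ, |c j θ| ≤ C)
    {c₀ : (Fin q → ℝ) → ℝ} (hc₀m : AEMeasurable c₀ (joint.fst.restrict B))
    (hc₀ : ∀ β ∈ B, |c₀ β| ≤ C)
    (hlim : ∀ β ∈ B, ∀ u,
      Tendsto (fun j => c j (ϑ (β, (√(N j : ℝ))⁻¹ • u))) atTop (𝓝 (c₀ β))) :
    Tendsto (fun j => √(N j : ℝ) ^ r *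
        (∫ θ in Θs, c j θ * Real.exp (-(1 / 2) * quadForm (V j θ)⁻¹ (g j θ)) ∂π) -
      √(2 * Real.pi) ^ r * ∫ β, c₀ β * Real.exp (-(1 / 2) * limitObjective Sig ϑ D (g j) β)
        ∂(limitPrior Sig B ϑ joint dens D)) atTop (𝓝 0) := by
  have hfin := h.isFiniteMeasure_joint
  have hB := h.isCompact_base.measurableSet
  have hQm : ∀ j, Measurable fun θ => quadForm (V j θ)⁻¹ (g j θ) := fun j =>
    measurable_quadForm (measurable_matrix_inv (hV j)) (hg j)
  obtain ⟨b, A, hb, hbd⟩ := h.exists_localIntegrand_bound hreg C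
  let I : ℕ → (Fin q → ℝ) → ℝ := fun j β => ∫ u, localIntegrand B Γ ϑ dens (c j)
    (fun θ => quadForm (V j θ)⁻¹ (g j θ)) (β, (√(N j : ℝ))⁻¹ • u)
  let Lim : ℕ → (Fin q → ℝ) → ℝ := fun j β =>
    c₀ β * dens β 0 * Real.exp (-(1 / 2) * limitObjective Sig ϑ D (g j) β) *
      (√(2 * Real.pi) ^ r * (infoMatrix (Sig (ϑ (β, 0))) (D β)).det ^ (-(1 / 2) : ℝ))
  let R : ℝ := ∫ u : Fin r → ℝ, A * Real.exp (-b * ‖u‖ ^ 2)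
  have hI := (integrable_exp_neg_mul_norm_sq r hb).const_mul A
  have hIbd : ∀ᶠ j in atTop, ∀ β, |I j β| ≤ R := hbd.mono fun j hj β => by
    rw [← Real.norm_eq_abs]
    exact norm_integral_le_of_norm_le hI (Eventually.of_forall fun u => (hj (c j) (hC j)).1 β u)
  have hLbd : ∀ᶠ j in atTop, ∀ β ∈ B, |Lim j β| ≤ R := hbd.mono fun j hj β hβ => by
    simp only [Lim]
    rw [← h.integral_local_limit (g j) hβ, ← Real.norm_eq_abs]
    exact norm_integral_le_of_norm_le hI
      (Eventually.of_forall fun u => (hj (c j) (hC j)).2 β hβ u _ (hc₀ β hβ))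
  have hIm : ∀ j, Measurable (I j) := fun j => by
    have h1 : Measurable fun z : (Fin q → ℝ) × (Fin r → ℝ) => localIntegrand B Γ ϑ dens (c j)
        (fun θ => quadForm (V j θ)⁻¹ (g j θ)) (z.1, (√(N j : ℝ))⁻¹ • z.2) :=
      (h.measurable_localIntegrand (hc j) (hQm j)).comp (by fun_prop)
    exact h1.stronglyMeasurable.integral_prod_right.measurable
  have hLeq : ∀ j, Lim j = fun β => √(2 * Real.pi) ^ r * ((dens β 0 *
      (infoMatrix (Sig (ϑ (β, 0))) (D β)).det ^ (-(1 / 2) : ℝ)) *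
      (c₀ β * Real.exp (-(1 / 2) * limitObjective Sig ϑ D (g j) β))) := fun j => by
    funext β; simp only [Lim]; ring
  have hLm : ∀ j, AEMeasurable (Lim j) (joint.fst.restrict B) := fun j => by
    rw [hLeq]
    exact (h.aemeasurable_adjustment.mul (hc₀m.mul
      ((h.aemeasurable_limitObjective (hg j)).const_mul _).exp)).const_mul _
  -- The inner integrals and their limits are bounded by the same Gaussian integral `R` for every
  -- `β`, which dominates the outer integral over the finite marginal.
  have key := tendsto_integral_filter_of_dominated_convergence (μ := joint.fst.restrict B)
    (f := fun _ => (0 : ℝ)) (l := atTop) (F := fun j β => I j β - Lim j β) (fun _ => R + R)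
    (Eventually.of_forall fun j => ((hIm j).aemeasurable.sub (hLm j)).aestronglyMeasurable)
    (by
      filter_upwards [hIbd, hLbd] with j h1 h2
      filter_upwards [ae_restrict_mem hB] with β hβ
      exact (norm_sub_le _ _).trans (add_le_add (h1 β) (h2 β hβ)))
    (integrable_const _)
    (by
      filter_upwards [ae_restrict_mem hB] with β hβ
      exact h.tendsto_inner_integral_sub hreg hg hV hc hC hβ (hc₀ β hβ) (hlim β hβ))
  rw [integral_zero] at key
  refine key.congr' ?_
  filter_upwards [hIbd, hLbd, hreg.tendsto.eventually_gt_atTop 0,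
    h.eventually_objective_nonneg hreg] with j h1 h2 h3 h4
  have hN : 0 < √(N j : ℝ) := Real.sqrt_pos.2 (by exact_mod_cast h3)
  rw [integral_sub, h.integral_limitPrior]
  · congr 1
    · rw [h.setIntegral_eq_integral_localIntegrand (hc j) (hQm j),
        integral_prod _ (h.integrable_localIntegrand (hc j) (hQm j) (hC j) h4),
        ← integral_const_mul, h.fst_restrict]
      refine integral_congr_ae (Eventually.of_forall fun β => ?_)
      simp only [I]
      -- The Jacobian of `γ = u / √N` is what the normalization `√N ^ r` absorbs.
      rw [Measure.integral_comp_inv_smul_of_nonneg volume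
        (fun γ => localIntegrand B Γ ϑ dens (c j) (fun θ => quadForm (V j θ)⁻¹ (g j θ)) (β, γ))
        hN.le]
      simp
    · rw [hLeq, integral_const_mul]
  · exact Integrable.of_bound (hIm j).aestronglyMeasurable R (Eventually.of_forall h1)
  · refine Integrable.of_bound (hLm j).aestronglyMeasurable R ?_
    filter_upwards [ae_restrict_mem hB] with β hβ
    exact h2 β hβ

theorem integrable_mul_exp_objective (h : RegularModel Θ Φ Sig π Θs B Γ ϑ joint dens D)
    {c Q : (Fin p → ℝ) → ℝ} (hc : Measurable c) (hQ : Measurable Q) {C : ℝ}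
    (hC : ∀ θ ∈ Θ, |c θ| ≤ C) (hQ0 : ∀ θ ∈ Θ, 0 ≤ Q θ) :
    Integrable (fun θ => c θ * Real.exp (-(1 / 2) * Q θ)) π := by
  have := h.finite_prior
  refine Integrable.of_bound (hc.mul (hQ.const_mul _).exp).aestronglyMeasurable C ?_
  filter_upwards [mem_ae_iff.2 h.prior_compl] with θ hθ
  rw [norm_mul, Real.norm_of_nonneg (Real.exp_pos _).le]
  have e1 : Real.exp (-(1 / 2) * Q θ) ≤ 1 := Real.exp_le_one_iff.2 (by linarith [hQ0 θ hθ])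
  exact (mul_le_of_le_one_right (norm_nonneg _) e1).trans (hC θ hθ)

/-- Off `Θs` the objective grows linearly in `N`, so the integrand decays exponentially and beats
the polynomial normalization. -/
theorem tendsto_setIntegral_compl (h : RegularModel Θ Φ Sig π Θs B Γ ϑ joint dens D)
    (hreg : AsymptoticallyRegular Θ Φ Sig N g V) {c : ℕ → (Fin p → ℝ) → ℝ} {C : ℝ}
    (hC : ∀ j, ∀ θ ∈ Θ, |c j θ| ≤ C) :
    Tendsto (fun j => √(N j : ℝ) ^ r *
      (∫ θ in Θsᶜ, c j θ * Real.exp (-(1 / 2) * quadForm (V j θ)⁻¹ (g j θ)) ∂π))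
      atTop (𝓝 0) := by
  have hfin := h.finite_prior
  obtain ⟨b, K, hb, -, -, h3⟩ := h.exists_objective_lower_bound hreg
  have h4 : Tendsto (fun j => ((N j : ℝ) ^ (r : ℝ) * Real.exp (-(b / 2) * N j)) *
      (|C| * Real.exp (K / 2) * π.real Θsᶜ)) atTop (𝓝 0) := by
    simpa using ((tendsto_rpow_mul_exp_neg_mul_atTop_nhds_zero r (b / 2) (by positivity)).comp
      (tendsto_natCast_atTop_atTop.comp hreg.tendsto)).mul_const (|C| * Real.exp (K / 2) * π.real Θsᶜ)
  refine squeeze_zero_norm' ?_ h4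
  filter_upwards [h3, hreg.tendsto.eventually_gt_atTop 0] with j e1 e2
  have hN1 : (1 : ℝ) ≤ N j := by exact_mod_cast e2
  have e3 : ‖∫ θ in Θsᶜ, c j θ * Real.exp (-(1 / 2) * quadForm (V j θ)⁻¹ (g j θ)) ∂π‖ ≤
      |C| * (Real.exp (K / 2) * Real.exp (-(b / 2) * N j)) * π.real Θsᶜ := by
    refine norm_setIntegral_le_of_norm_le_const_ae (measure_lt_top _ _) ?_
    rw [ae_restrict_iff' h.rep.measurable_set.compl]
    filter_upwards [mem_ae_iff.2 h.prior_compl] with θ hθ hθs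
    rw [norm_mul, Real.norm_of_nonneg (Real.exp_pos _).le, ← Real.exp_add]
    have e4 : ‖c j θ‖ ≤ |C| := (hC j θ hθ).trans (le_abs_self _)
    have e5 := e1 θ hθ hθs
    exact mul_le_mul e4 (Real.exp_le_exp.2 (by linarith)) (Real.exp_pos _).le (abs_nonneg _)
  have e6 : √(N j : ℝ) ^ r ≤ (N j : ℝ) ^ (r : ℝ) := by
    rw [Real.rpow_natCast]
    refine pow_le_pow_left₀ (Real.sqrt_nonneg _) ?_ r
    rw [Real.sqrt_le_left (by linarith)]
    nlinarith
  rw [norm_mul, Real.norm_of_nonneg (by positivity)]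
  calc _ ≤ (N j : ℝ) ^ (r : ℝ) *
        (|C| * (Real.exp (K / 2) * Real.exp (-(b / 2) * N j)) * π.real Θsᶜ) := by
        gcongr
    _ = _ := by ring

/-- **Laplace approximation** of rescaled integrals with respect to the prior. -/
theorem tendsto_integral_sub (h : RegularModel Θ Φ Sig π Θs B Γ ϑ joint dens D)
    (hreg : AsymptoticallyRegular Θ Φ Sig N g V) (hg : ∀ j, Measurable (g j))
    (hV : ∀ j i i', Measurable fun θ => V j θ i i') {c : ℕ → (Fin p → ℝ) → ℝ}
    (hc : ∀ j, Measurable (c j)) {C : ℝ} (hC : ∀ j, ∀ θ ∈ Θ, |c j θ| ≤ C)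
    {c₀ : (Fin q → ℝ) → ℝ} (hc₀m : AEMeasurable c₀ (joint.fst.restrict B))
    (hc₀ : ∀ β ∈ B, |c₀ β| ≤ C)
    (hlim : ∀ β ∈ B, ∀ u,
      Tendsto (fun j => c j (ϑ (β, (√(N j : ℝ))⁻¹ • u))) atTop (𝓝 (c₀ β))) :
    Tendsto (fun j => √(N j : ℝ) ^ r *
        (∫ θ, c j θ * Real.exp (-(1 / 2) * quadForm (V j θ)⁻¹ (g j θ)) ∂π) -
      √(2 * Real.pi) ^ r * ∫ β, c₀ β * Real.exp (-(1 / 2) * limitObjective Sig ϑ D (g j) β)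
        ∂(limitPrior Sig B ϑ joint dens D)) atTop (𝓝 0) := by
  have h1 := (h.tendsto_setIntegral_sub hreg hg hV hc hC hc₀m hc₀ hlim).add
    (h.tendsto_setIntegral_compl hreg hC)
  rw [add_zero] at h1
  refine h1.congr' ?_
  filter_upwards [h.eventually_objective_nonneg hreg] with j hj
  rw [← integral_add_compl h.rep.measurable_set (h.integrable_mul_exp_objective (hc j)
    (measurable_quadForm (measurable_matrix_inv (hV j)) (hg j)) (hC j) hj)]
  ring

end RegularModel

/-- Numerators and denominators need not converge: it is enough that the reference denominators stay
away from zero and the reference quotients stay bounded. -/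
theorem tendsto_div_sub_div {a a' d d' : ℕ → ℝ} {m C : ℝ} (hm : 0 < m)
    (ha : Tendsto (fun j => a j - a' j) atTop (𝓝 0))
    (hd : Tendsto (fun j => d j - d' j) atTop (𝓝 0)) (hd' : ∀ᶠ j in atTop, m ≤ d' j)
    (ha' : ∀ᶠ j in atTop, |a' j| ≤ C * d' j) :
    Tendsto (fun j => a j / d j - a' j / d' j) atTop (𝓝 0) := by
  have hlim : Tendsto (fun j => 2 / m * (|a j - a' j| + C * |d j - d' j|)) atTop (𝓝 0) := by
    have h1 : Tendsto (fun j => |a j - a' j|) atTop (𝓝 0) := by simpa using ha.abs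
    have h2 : Tendsto (fun j => |d j - d' j|) atTop (𝓝 0) := by simpa using hd.abs
    simpa using (h1.add (h2.const_mul C)).const_mul (2 / m)
  refine squeeze_zero_norm' ?_ hlim
  filter_upwards [hd', ha', Metric.tendsto_nhds.1 hd (m / 2) (by positivity)] with j h1 h2 h3
  rw [Real.dist_eq, sub_zero] at h3
  have hd0' : 0 < d' j := by linarith
  have hdm : m / 2 ≤ d j := by linarith [(abs_lt.1 h3).1]
  have hd0 : 0 < d j := by linarith
  have heq : a j / d j - a' j / d' j =
      ((a j - a' j) - a' j / d' j * (d j - d' j)) / d j := by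
    field_simp
    ring
  have hq : |a' j / d' j| ≤ C := by
    rw [abs_div, abs_of_pos hd0', div_le_iff₀ hd0']
    exact h2
  rw [Real.norm_eq_abs, heq, abs_div, abs_of_pos hd0, div_le_iff₀ hd0]
  have h4 : |(a j - a' j) - a' j / d' j * (d j - d' j)| ≤
      |a j - a' j| + C * |d j - d' j| := by
    refine (abs_sub _ _).trans (add_le_add le_rfl ?_)
    rw [abs_mul]
    exact mul_le_mul_of_nonneg_right hq (abs_nonneg _)
  have hC : 0 ≤ C := (abs_nonneg _).trans hq
  have h5 : 1 ≤ 2 / m * d j := by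
    rw [div_mul_eq_mul_div, one_le_div hm]
    linarith
  have h6 : 0 ≤ |a j - a' j| + C * |d j - d' j| := by positivity
  nlinarith

/-! ### From integrals to posterior expectations -/

namespace RegularModel

variable {p k q r : ℕ} {Θ : Set (Fin p → ℝ)} {Φ : (Fin p → ℝ) → Fin k → ℝ}
  {Sig : (Fin p → ℝ) → Matrix (Fin k) (Fin k) ℝ} {π : Measure (Fin p → ℝ)}
  {Θs : Set (Fin p → ℝ)} {B : Set (Fin q → ℝ)} {Γ : (Fin q → ℝ) → Set (Fin r → ℝ)}
  {ϑ : (Fin q → ℝ) × (Fin r → ℝ) → Fin p → ℝ}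
  {joint : Measure ((Fin q → ℝ) × (Fin r → ℝ))} {dens : (Fin q → ℝ) → (Fin r → ℝ) → ℝ}
  {D : (Fin q → ℝ) → Matrix (Fin k) (Fin r) ℝ}
  {N : ℕ → ℕ} {g : ℕ → (Fin p → ℝ) → Fin k → ℝ}
  {V : ℕ → (Fin p → ℝ) → Matrix (Fin k) (Fin k) ℝ}

theorem integral_exp_limitObjective_pos (h : RegularModel Θ Φ Sig π Θs B Γ ϑ joint dens D)
    {g : (Fin p → ℝ) → Fin k → ℝ} (hg : Measurable g) :
    0 < ∫ β, Real.exp (-(1 / 2) * limitObjective Sig ϑ D g β)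
      ∂(limitPrior Sig B ϑ joint dens D) := by
  have : NeZero (limitPrior Sig B ϑ joint dens D) :=
    ⟨fun h0 => by simpa [h0] using h.limitPrior_pos⟩
  exact integral_exp_pos (h.integrable_exp_limitObjective hg)

/-- The reduced weight is at most `Σ⁻¹`, and the moments on the identified set are bounded along the
sequence, so the integrand has a positive lower bound. -/
theorem exists_integral_exp_lower_bound (h : RegularModel Θ Φ Sig π Θs B Γ ϑ joint dens D)
    (hreg : AsymptoticallyRegular Θ Φ Sig N g V) (hg : ∀ j, Measurable (g j)) :
    ∃ m : ℝ, 0 < m ∧ ∀ᶠ j in atTop, m ≤ ∫ β, Real.exp (-(1 / 2) *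
      limitObjective Sig ϑ D (g j) β) ∂(limitPrior Sig B ϑ joint dens D) := by
  have hfin := h.isFiniteMeasure_limitPrior
  obtain ⟨L, hL, hL'⟩ := exists_quadForm_upper_bound h.isCompact_base h.continuousOn_inv_cov
  obtain ⟨K, hK⟩ := h.exists_moment_zero_bound hreg
  refine ⟨(limitPrior Sig B ϑ joint dens D).real univ * Real.exp (-(1 / 2) * (L * K ^ 2)),
    mul_pos (ENNReal.toReal_pos h.limitPrior_pos.ne' (measure_ne_top _ _)) (Real.exp_pos _), ?_⟩
  filter_upwards [hK] with j hj
  rw [← smul_eq_mul, ← integral_const]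
  refine integral_mono_ae (integrable_const _) (h.integrable_exp_limitObjective (hg j)) ?_
  filter_upwards [h.ae_limitPrior_mem] with β hβ
  refine Real.exp_le_exp.2 ?_
  have h1 : limitObjective Sig ϑ D (g j) β ≤ quadForm (Sig (ϑ (β, 0)))⁻¹ (g j (ϑ (β, 0))) :=
    quadForm_reducedWeight_le (h.posDef_cov _ (h.map_mem (h.mem_graphSet_zero hβ)))
      (h.posDef_info β hβ) _
  have h2 := hL' β hβ (g j (ϑ (β, 0)))
  have h3 := mul_le_mul_of_nonneg_left
    (pow_le_pow_left₀ (norm_nonneg _) (hj β hβ) 2) hL.le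
  linarith

theorem eventually_isProbabilityMeasure_tilted
    (h : RegularModel Θ Φ Sig π Θs B Γ ϑ joint dens D)
    (hreg : AsymptoticallyRegular Θ Φ Sig N g V) (hg : ∀ j, Measurable (g j))
    (hV : ∀ j i i', Measurable fun θ => V j θ i i') :
    ∀ᶠ j in atTop, IsProbabilityMeasure
      (π.tilted fun θ => -(1 / 2) * quadForm (V j θ)⁻¹ (g j θ)) := by
  have : NeZero π := ⟨fun h0 => by simpa [h0] using h.prior_pos⟩
  filter_upwards [h.eventually_objective_nonneg hreg] with j hj
  refine isProbabilityMeasure_tilted ?_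
  simpa using h.integrable_mul_exp_objective (c := fun _ => 1) measurable_const
    (measurable_quadForm (measurable_matrix_inv (hV j)) (hg j)) (C := 1) (by simp) hj

/-- Asymptotic equivalence of posterior expectations. -/
theorem tendsto_posterior_sub (h : RegularModel Θ Φ Sig π Θs B Γ ϑ joint dens D)
    (hreg : AsymptoticallyRegular Θ Φ Sig N g V) (hg : ∀ j, Measurable (g j))
    (hV : ∀ j i i', Measurable fun θ => V j θ i i') {c : ℕ → (Fin p → ℝ) → ℝ}
    (hc : ∀ j, Measurable (c j)) {C : ℝ} (hC : ∀ j, ∀ θ ∈ Θ, |c j θ| ≤ C)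
    {c₀ : (Fin q → ℝ) → ℝ} (hc₀m : AEMeasurable c₀ (joint.fst.restrict B))
    (hc₀ : ∀ β ∈ B, |c₀ β| ≤ C)
    (hlim : ∀ β ∈ B, ∀ u,
      Tendsto (fun j => c j (ϑ (β, (√(N j : ℝ))⁻¹ • u))) atTop (𝓝 (c₀ β))) :
    Tendsto (fun j =>
      (∫ θ, c j θ ∂(π.tilted fun θ => -(1 / 2) * quadForm (V j θ)⁻¹ (g j θ))) -
      (∫ β, c₀ β * Real.exp (-(1 / 2) * limitObjective Sig ϑ D (g j) β)
        ∂(limitPrior Sig B ϑ joint dens D)) /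
      (∫ β, Real.exp (-(1 / 2) * limitObjective Sig ϑ D (g j) β)
        ∂(limitPrior Sig B ϑ joint dens D))) atTop (𝓝 0) := by
  have hnum := h.tendsto_integral_sub hreg hg hV hc hC hc₀m hc₀ hlim
  -- The denominators are the case of the constant function `1`.
  have hden := h.tendsto_integral_sub hreg hg hV (c := fun _ _ => 1) (C := 1) (c₀ := fun _ => 1)
    (fun _ => measurable_const) (by simp) aemeasurable_const (by simp)
    (fun _ _ _ => tendsto_const_nhds)
  simp only [one_mul] at hden
  obtain ⟨m, hm, hm'⟩ := h.exists_integral_exp_lower_bound hreg hg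
  have hs : 0 < √(2 * Real.pi) ^ r := by positivity
  have key := tendsto_div_sub_div (m := √(2 * Real.pi) ^ r * m) (C := C) (by positivity) hnum hden
    (hm'.mono fun j hj => mul_le_mul_of_nonneg_left hj hs.le)
    (Eventually.of_forall fun j => by
      rw [abs_mul, abs_of_pos hs, mul_left_comm]
      refine mul_le_mul_of_nonneg_left ?_ hs.le
      rw [← integral_const_mul, ← Real.norm_eq_abs]
      refine norm_integral_le_of_norm_le ((h.integrable_exp_limitObjective (hg j)).const_mul C) ?_
      filter_upwards [h.ae_limitPrior_mem] with β hβ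
      rw [norm_mul, Real.norm_of_nonneg (Real.exp_pos _).le]
      exact mul_le_mul_of_nonneg_right (hc₀ β hβ) (Real.exp_pos _).le)
  refine key.congr' ?_
  filter_upwards [hreg.tendsto.eventually_gt_atTop 0] with j hj
  have hN : 0 < √(N j : ℝ) ^ r := pow_pos (Real.sqrt_pos.2 (by exact_mod_cast hj)) r
  rw [mul_div_mul_left _ _ hN.ne', mul_div_mul_left _ _ hs.ne', integral_tilted]
  congr 1
  rw [div_eq_inv_mul, ← integral_const_mul]
  refine integral_congr_ae (Eventually.of_forall fun θ => ?_)
  simp only [smul_eq_mul]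
  ring

theorem measurableSet_le_objective (h : RegularModel Θ Φ Sig π Θs B Γ ϑ joint dens D) (t : ℝ) :
    MeasurableSet {θ | θ ∈ Θ ∧ t ≤ quadForm (Sig θ)⁻¹ (Φ θ)} := by
  have hc : ContinuousOn (fun θ => quadForm (Sig θ)⁻¹ (Φ θ)) Θ :=
    continuous_quadForm.comp_continuousOn ((continuousOn_matrix_inv h.continuous_cov
      fun θ hθ => (h.posDef_cov θ hθ).det_pos.ne').prodMk h.continuous_mean)
  exact (hc.preimage_isClosed_of_isClosed h.compact.isClosed isClosed_Ici).measurableSet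

/-- Concentration of the posterior on `1 / √n`-neighbourhoods of the identified set. -/
theorem tendsto_posterior_compl (h : RegularModel Θ Φ Sig π Θs B Γ ϑ joint dens D)
    (hreg : AsymptoticallyRegular Θ Φ Sig N g V) (hg : ∀ j, Measurable (g j))
    (hV : ∀ j i i', Measurable fun θ => V j θ i i') {t : ℕ → ℝ} (ht : Tendsto t atTop atTop) :
    Tendsto (fun j => (π.tilted fun θ => -(1 / 2) * quadForm (V j θ)⁻¹ (g j θ)).real
      {θ | θ ∈ Θ ∧ t (N j) / N j ≤ quadForm (Sig θ)⁻¹ (Φ θ)}) atTop (𝓝 0) := by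
  classical
  let A : ℕ → Set (Fin p → ℝ) := fun j =>
    {θ | θ ∈ Θ ∧ t (N j) / N j ≤ quadForm (Sig θ)⁻¹ (Φ θ)}
  have hA : ∀ j, MeasurableSet (A j) := fun j => h.measurableSet_le_objective _
  -- Concentration is the case of indicators with limit `0`. At `ϑ(β, u/√N)`, `N` times the
  -- population criterion converges to a finite value, whereas the threshold `t (N j)` diverges, so
  -- each fixed local point eventually leaves the set.
  have key := h.tendsto_posterior_sub hreg hg hV (c := fun j => (A j).indicator 1) (C := 1)
    (c₀ := fun _ => 0) (fun j => measurable_one.indicator (hA j))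
    (fun j θ _ => by
      by_cases hθ : θ ∈ A j
      · simp [indicator_of_mem hθ]
      · simp [indicator_of_notMem hθ]) aemeasurable_const (by simp) ?_
  · simp only [zero_mul, integral_zero, zero_div, sub_zero] at key
    refine key.congr fun j => ?_
    rw [integral_indicator_one (hA j)]
  · intro β hβ u
    have hθ := h.tendsto_local_param hreg hβ u
    have hθ₀ : ϑ (β, 0) ∈ Θ := h.map_mem (h.mem_graphSet_zero hβ)
    have hb := h.tendsto_scaled_mean hreg hβ u
    have h1 : Tendsto (fun j => quadForm (Sig (ϑ (β, (√(N j : ℝ))⁻¹ • u)))⁻¹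
        (√(N j : ℝ) • Φ (ϑ (β, (√(N j : ℝ))⁻¹ • u))) -
        quadForm (Sig (ϑ (β, 0)))⁻¹ (D β *ᵥ u)) atTop (𝓝 0) := by
      refine tendsto_quadForm_sub (b := fun _ => D β *ᵥ u) (K := ‖D β *ᵥ u‖) (fun i i' => ?_) ?_
        (Eventually.of_forall fun _ => le_rfl)
      · have h2 := (continuousOn_matrix_inv h.continuous_cov
          (fun θ hθ => (h.posDef_cov θ hθ).det_pos.ne') _ hθ₀).tendsto.comp hθ
        exact ((continuous_id.matrix_elem i i').tendsto _).comp h2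
      · simpa using hb.sub_const (D β *ᵥ u)
    refine tendsto_const_nhds.congr' ?_
    filter_upwards [Metric.tendsto_nhds.1 h1 1 one_pos, hreg.tendsto.eventually_gt_atTop 0,
      (ht.comp hreg.tendsto).eventually_gt_atTop
        (quadForm (Sig (ϑ (β, 0)))⁻¹ (D β *ᵥ u) + 1)] with j e1 e2 e3
    have hN : (0 : ℝ) < N j := by exact_mod_cast e2
    rw [indicator_of_notMem]
    rintro ⟨-, e4⟩
    rw [quadForm_smul, Real.sq_sqrt hN.le, Real.dist_eq, sub_zero] at e1
    rw [div_le_iff₀ hN] at e4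
    simp only [Function.comp_apply] at e3
    linarith [(abs_lt.1 e1).2]

end RegularModel

/-! ### Data from a sequence local to `P₀` -/

/-- The form at `v` is the variance of the combination of moments with weights `v`; a nonzero
determinant upgrades semidefiniteness. -/
theorem posDef_momentCov {X : Type*} [MeasurableSpace X] {p k : ℕ}
    {φ : X → (Fin p → ℝ) → Fin k → ℝ} {P : Measure X} [IsProbabilityMeasure P] {θ : Fin p → ℝ}
    (h2 : ∀ i, MemLp (fun x => φ x θ i) 2 P) (hdet : (momentCov φ P θ θ).det ≠ 0) :
    (momentCov φ P θ θ).PosDef := by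
  refine (PosSemidef.posDef_iff_det_ne_zero ?_).2 hdet
  refine .of_dotProduct_mulVec_nonneg ?_ fun v => ?_
  · ext i j
    simp only [momentCov, conjTranspose_apply, Matrix.of_apply, star_trivial]
    exact covariance_comm _ _
  · have hv : ∀ i, MemLp (fun x => v i * φ x θ i) 2 P := fun i => (h2 i).const_mul (v i)
    have h3 := covariance_fun_sum_fun_sum hv hv
    have h4 : quadForm (momentCov φ P θ θ) v =
        cov[fun x => ∑ i, v i * φ x θ i, fun x => ∑ i, v i * φ x θ i; P] := by
      rw [h3, quadForm_eq_sum]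
      refine Finset.sum_congr rfl fun i _ => Finset.sum_congr rfl fun j _ => ?_
      rw [covariance_const_mul_left, covariance_const_mul_right]
      simp only [momentCov, Matrix.of_apply]
      ring
    have h5 : (0 : ℝ) ≤ quadForm (momentCov φ P θ θ) v := by
      rw [h4, covariance_self (memLp_finsetSum _ fun i _ => hv i).aestronglyMeasurable.aemeasurable]
      exact variance_nonneg _ _
    simpa [quadForm] using h5

theorem HasBoundedDensityOn.isFiniteMeasure {p : ℕ} {π : Measure (Fin p → ℝ)}
    {Θ : Set (Fin p → ℝ)} (h : HasBoundedDensityOn π Θ) (hΘ : IsCompact Θ) :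
    IsFiniteMeasure π := by
  obtain ⟨ρ, hρ, ⟨C, hC⟩, rfl⟩ := h
  refine isFiniteMeasure_withDensity (ne_of_lt ?_)
  calc ∫⁻ θ in Θ, ENNReal.ofReal (ρ θ) ≤ ∫⁻ _ in Θ, ENNReal.ofReal C :=
        setLIntegral_mono' hΘ.measurableSet fun θ hθ => ENNReal.ofReal_le_ofReal (hC θ hθ)
    _ < ⊤ := by
        rw [setLIntegral_const]
        exact ENNReal.mul_lt_top ENNReal.ofReal_lt_top hΘ.measure_lt_top

theorem HasBoundedDensityOn.compl_eq_zero {p : ℕ} {π : Measure (Fin p → ℝ)}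
    {Θ : Set (Fin p → ℝ)} (h : HasBoundedDensityOn π Θ) (hΘ : IsCompact Θ) : π Θᶜ = 0 := by
  obtain ⟨ρ, hρ, -, rfl⟩ := h
  refine withDensity_absolutelyContinuous _ _ ?_
  rw [Measure.restrict_apply hΘ.measurableSet.compl]
  simp

theorem measurable_sampleMoment {X : Type*} [MeasurableSpace X] {p k : ℕ}
    {φ : X → (Fin p → ℝ) → Fin k → ℝ}
    (hφ : Measurable fun z : X × (Fin p → ℝ) => φ z.1 z.2) (n : ℕ) (x : Fin n → X) :
    Measurable (sampleMoment φ n x) := by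
  have h : Measurable fun θ => ∑ i, φ (x i) θ := Finset.measurable_sum _ fun i _ =>
    hφ.comp (measurable_const.prodMk measurable_id)
  exact h.const_smul (√(n : ℝ))⁻¹

theorem regularModel_of_assumptions {X : Type*} [MeasurableSpace X] {p k q r : ℕ}
    {Θ : Set (Fin p → ℝ)} (hΘ : IsCompact Θ) {φ : X → (Fin p → ℝ) → Fin k → ℝ}
    {Shat : (n : ℕ) → (Fin n → X) → (Fin p → ℝ) → Matrix (Fin k) (Fin k) ℝ}
    {P₀ : Measure X} [IsProbabilityMeasure P₀] {Ω : Type*} [MeasurableSpace Ω] {ν : Measure Ω}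
    {G : Ω → C(Θ, Fin k → ℝ)} (hasymp : MomentAsymptotics Θ φ Shat P₀ ν G)
    {π : Measure (Fin p → ℝ)} (hπ : HasBoundedDensityOn π Θ) {Θs : Set (Fin p → ℝ)}
    {B : Set (Fin q → ℝ)} {Γ : (Fin q → ℝ) → Set (Fin r → ℝ)}
    {ϑ : (Fin q → ℝ) × (Fin r → ℝ) → Fin p → ℝ}
    {joint : Measure ((Fin q → ℝ) × (Fin r → ℝ))} {dens : (Fin q → ℝ) → (Fin r → ℝ) → ℝ}
    (hrep : Reparameterization Θ (identifiedSet Θ φ P₀) Θs π B Γ ϑ joint dens)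
    {D : (Fin q → ℝ) → Matrix (Fin k) (Fin r) ℝ} (hexp : MomentExpansion φ P₀ B Γ ϑ D) :
    RegularModel Θ (popMoment φ P₀) (fun θ => momentCov φ P₀ θ θ) π Θs B Γ ϑ joint dens D where
  compact := hΘ
  continuous_mean := hasymp.continuous_mean
  continuous_cov := hasymp.continuous_cov.comp (f := fun θ : Fin p → ℝ => (θ, θ)) (by fun_prop)
    fun _ hθ => ⟨hθ, hθ⟩
  posDef_cov θ hθ := posDef_momentCov (hasymp.square_integrable θ hθ) (hasymp.det_ne_zero θ hθ)
  finite_prior := hπ.isFiniteMeasure hΘ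
  prior_compl := hπ.compl_eq_zero hΘ
  rep := hrep
  unif_differentiable := hexp.unif_differentiable
  posDef_info := hexp.posDef

/-- Statistics that vanish along all asymptotically regular sequences are `o_p(1)`. -/
theorem isLittleOp_of_regular {X : Type*} [MeasurableSpace X] {p k : ℕ}
    {Θ : Set (Fin p → ℝ)} (hΘ : IsCompact Θ) {φ : X → (Fin p → ℝ) → Fin k → ℝ}
    {Shat : (n : ℕ) → (Fin n → X) → (Fin p → ℝ) → Matrix (Fin k) (Fin k) ℝ}
    {P₀ : Measure X} [IsProbabilityMeasure P₀] {Ω : Type*} [MeasurableSpace Ω] {ν : Measure Ω}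
    [IsProbabilityMeasure ν] {G : Ω → C(Θ, Fin k → ℝ)}
    (hasymp : MomentAsymptotics Θ φ Shat P₀ ν G) {P : ℕ → Measure X}
    [∀ n, IsProbabilityMeasure (P n)] {f : X → ℝ} (hP : IsLocalSequence P₀ P f)
    {Z : (n : ℕ) → (Fin n → X) → ℝ}
    (hZ : ∀ N : ℕ → ℕ, ∀ x : (j : ℕ) → Fin (N j) → X,
      AsymptoticallyRegular Θ (popMoment φ P₀) (fun θ => momentCov φ P₀ θ θ) N
        (fun j => sampleMoment φ (N j) (x j)) (fun j => Shat (N j) (x j)) →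
      Tendsto (fun j => Z (N j) (x j)) atTop (𝓝 0)) : IsLittleOp P Z := by
  intro ε hε
  refine hP.tendsto_sampleLaw (hasymp.tendsto_sampleLaw_zero hΘ fun N x hreg => ?_)
  filter_upwards [Metric.tendsto_nhds.1 (hZ N x hreg) ε hε] with j hj
  rw [Real.dist_eq, sub_zero] at hj
  exact fun hmem => absurd hj (not_lt.2 hmem)

end WeakGMM

end

/-! ### Assembly of the three claims -/

theorem theorem5
    {X : Type*} [MeasurableSpace X] {p k q r : ℕ}
    -- the model: parameter space, moment function, variance estimator
    (Θ : Set (Fin p → ℝ)) (hΘ : IsCompact Θ)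
    (φ : X → (Fin p → ℝ) → Fin k → ℝ)
    (hφ : Measurable fun z : X × (Fin p → ℝ) => φ z.1 z.2)
    (Shat : (n : ℕ) → (Fin n → X) → (Fin p → ℝ) → Matrix (Fin k) (Fin k) ℝ)
    (hShat : ∀ n i j, Measurable fun z : (Fin n → X) × (Fin p → ℝ) => Shat n z.1 z.2 i j)
    -- limit distribution of the data, and the limiting Gaussian process
    (P₀ : Measure X) [IsProbabilityMeasure P₀]
    {Ω : Type*} [MeasurableSpace Ω] (ν : Measure Ω) [IsProbabilityMeasure ν]
    (G : Ω → C(Θ, Fin k → ℝ))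
    (hasymp : WeakGMM.MomentAsymptotics Θ φ Shat P₀ ν G)
    -- the prior and the reparameterization
    (π : Measure (Fin p → ℝ)) (hπ : WeakGMM.HasBoundedDensityOn π Θ)
    (Θs : Set (Fin p → ℝ)) (B : Set (Fin q → ℝ)) (Γ : (Fin q → ℝ) → Set (Fin r → ℝ))
    (ϑ : (Fin q → ℝ) × (Fin r → ℝ) → Fin p → ℝ)
    (joint : Measure ((Fin q → ℝ) × (Fin r → ℝ))) (dens : (Fin q → ℝ) → (Fin r → ℝ) → ℝ)
    (hrep : WeakGMM.Reparameterization Θ (WeakGMM.identifiedSet Θ φ P₀) Θs π B Γ ϑ joint dens)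
    (D : (Fin q → ℝ) → Matrix (Fin k) (Fin r) ℝ)
    (hexp : WeakGMM.MomentExpansion φ P₀ B Γ ϑ D)
    -- the sequence of data distributions local to `P₀`
    (P : ℕ → Measure X) [∀ n, IsProbabilityMeasure (P n)] (f : X → ℝ)
    (hP : WeakGMM.IsLocalSequence P₀ P f) :
    -- the two posteriors are well defined with probability tending to one
    (Tendsto (fun n => WeakGMM.sampleLaw (P n) n {x | ¬
        (IsProbabilityMeasure (WeakGMM.quasiPosterior π φ Shat n x) ∧
          Integrable (fun β => Real.exp (-(1 / 2) * WeakGMM.reducedObjective φ P₀ ϑ D n x β))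
            (WeakGMM.adjustedPrior φ P₀ B ϑ joint dens D) ∧
          0 < ∫ β, Real.exp (-(1 / 2) * WeakGMM.reducedObjective φ P₀ ϑ D n x β)
            ∂(WeakGMM.adjustedPrior φ P₀ B ϑ joint dens D))}) atTop (𝓝 0)) ∧
    -- concentration of the quasi-posterior
    (∀ c : ℕ → ℝ, Tendsto c atTop atTop →
      WeakGMM.IsLittleOp P fun n x =>
        (WeakGMM.quasiPosterior π φ Shat n x).real
          {θ | θ ∈ Θ ∧ c n / n ≤
            WeakGMM.quadForm (WeakGMM.momentCov φ P₀ θ θ)⁻¹ (WeakGMM.popMoment φ P₀ θ)}) ∧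
    -- asymptotic equivalence with the infeasible posterior
    (∀ c : (Fin p → ℝ) → ℝ, Measurable c → (∃ C : ℝ, ∀ θ ∈ Θ, |c θ| ≤ C) →
      (∀ ε : ℝ, 0 < ε → ∃ δ : ℝ, 0 < δ ∧ ∀ θ₀ ∈ WeakGMM.identifiedSet Θ φ P₀, ∀ θ ∈ Θ,
        ‖θ - θ₀‖ < δ → |c θ - c θ₀| < ε) →
      WeakGMM.IsLittleOp P fun n x =>
        (∫ θ, c θ ∂(WeakGMM.quasiPosterior π φ Shat n x)) -
          (∫ β, c (ϑ (β, 0)) * Real.exp (-(1 / 2) * WeakGMM.reducedObjective φ P₀ ϑ D n x β)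
              ∂(WeakGMM.adjustedPrior φ P₀ B ϑ joint dens D)) /
            (∫ β, Real.exp (-(1 / 2) * WeakGMM.reducedObjective φ P₀ ϑ D n x β)
              ∂(WeakGMM.adjustedPrior φ P₀ B ϑ joint dens D))) := by
  have h := WeakGMM.regularModel_of_assumptions hΘ hasymp hπ hrep hexp
  have hg : ∀ (N : ℕ → ℕ) (x : (j : ℕ) → Fin (N j) → X) (j : ℕ),
      Measurable (WeakGMM.sampleMoment φ (N j) (x j)) := fun N x j =>
    WeakGMM.measurable_sampleMoment hφ (N j) (x j)
  have hV : ∀ (N : ℕ → ℕ) (x : (j : ℕ) → Fin (N j) → X) (j : ℕ) i i',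
      Measurable fun θ => Shat (N j) (x j) θ i i' := fun N x j i i' =>
    (hShat (N j) i i').comp (measurable_const.prodMk measurable_id)
  refine ⟨?_, fun c hc => ?_, fun c hc hbd hunif => ?_⟩
  · refine hP.tendsto_sampleLaw (hasymp.tendsto_sampleLaw_zero hΘ fun N x hreg => ?_)
    filter_upwards [h.eventually_isProbabilityMeasure_tilted hreg (hg N x) (hV N x)] with j hj
    exact not_not.2 ⟨hj, h.integrable_exp_limitObjective (hg N x j),
      h.integral_exp_limitObjective_pos (hg N x j)⟩
  · exact WeakGMM.isLittleOp_of_regular hΘ hasymp hP fun N x hreg =>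
      h.tendsto_posterior_compl hreg (hg N x) (hV N x) hc
  · obtain ⟨C, hC⟩ := hbd
    refine WeakGMM.isLittleOp_of_regular hΘ hasymp hP fun N x hreg =>
      h.tendsto_posterior_sub hreg (hg N x) (hV N x) (c := fun _ => c)
        (c₀ := fun β => c (ϑ (β, 0))) (C := C) (fun _ => hc) (fun _ => hC)
        (hc.comp_aemeasurable (h.continuousOn_map_zero.aemeasurable
          h.isCompact_base.measurableSet))
        (fun β hβ => hC _ (h.map_mem (h.mem_graphSet_zero hβ))) fun β hβ u => ?_
    -- Continuity of `c` is needed only at points `ϑ(β, 0)` of the identified set, along parameters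
    -- converging to them within `Θ`.
    have hθ := h.tendsto_local_param hreg hβ u
    rw [Metric.tendsto_nhds]
    intro ε hε
    obtain ⟨δ, hδ, hδ'⟩ := hunif ε hε
    filter_upwards [hθ.eventually self_mem_nhdsWithin,
      (tendsto_nhdsWithin_iff.1 hθ).1.eventually (Metric.ball_mem_nhds _ hδ)] with j h1 h2
    refine hδ' _ ⟨h.map_mem (h.mem_graphSet_zero hβ), h.mean_eq_zero hβ⟩ _ h1 ?_
    rwa [dist_eq_norm] at h2
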